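/- Let $A$ and $H$ be compact quantum group algebras, that is, cosemisimple Hopf $*$-algebras over $\mathbb{C}$ whose Haar functional $\mathbf{h}$ (the unique linear functional with $\mathbf{h}(1)=1$ and $(\mathrm{id}\otimes\mathbf{h})\Delta(a)=\mathbf{h}(a)1=(\mathbf{h}\otimes\mathrm{id})\Delta(a)$) satisfies $\mathbf{h}(a^*a)>0$ for all $a\neq 0$. Let $\pi:A\to H$ be a surjective Hopf $*$-algebra map, and $B=A^{\mathrm{co}(H)}=\{b\in A: (\mathrm{id}\otimes\pi)\Delta(b)=b\otimes 1\}$. Let $\mathbf{H}=(B,\Omega^\bullet,\Omega^{(\bullet,\bullet)},\sigma)$ be a compact quantum homogeneous Hermitian (CQH-Hermitian) space, by which we mean the following. (1) $(\Omega^\bullet,\mathrm{d})$ is a differential $*$-calculus over $B$: a differential graded algebra with $\Omega^0=B$, generated as an algebra by $B$ and $\mathrm{d}B$, with a conjugate-linear involution $*$ that extends the one of $B$, commutes with $\mathrm{d}$, and satisfies $(\omega\wedge\nu)^*=(-1)^{kl}\nu^*\wedge\omega^*$ for $\omega\in\Omega^k$, $\nu\in\Omega^l$. The coaction $\Delta|_B:B\to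 A\otimes B$ extends to a left $A$-comodule algebra structure on $\Omega^\bullet$ for which $\mathrm{d}$ is a comodule map. Moreover $\Omega^\bullet$ is finitely generated as a left $B$-module, and $\Omega^\bullet B^+=B^+\Omega^\bullet$ for $B^+=B\cap\ker\varepsilon$. (2) $\Omega^{(\bullet,\bullet)}$ is a covariant complex structure: an $\mathbb{N}_0^2$-algebra grading of $\Omega^\bullet$ by left $A$-subcomodules with $\Omega^k=\bigoplus_{a+b=k}\Omega^{(a,b)}$, $(\Omega^{(a,b)})^*=\Omega^{(b,a)}$ and $\mathrm{d}\Omega^{(a,b)}\subseteq\Omega^{(a+1,b)}\oplus\Omega^{(a,b+1)}$. Let $\overline\partial$ be the component of $\mathrm{d}$ of bidegree $(0,1)$. (3) $\Omega^\bullet$ has total degree $2n$ ($n\in\mathbb{N}_0$; that is, $\Omega^{2n}\ne0$ and $\Omega^k=0$ for $k>2n$), and $\sigma\in\Omega^{(1,1)}$ is central, real ($\sigma^*=\sigma$) and left $A$-coinvariant, such that, with $L(\omega)=\sigma\wedge\omega$, the map $L^{n-k}:\Omega^k\to\Omega^{2n-k}$ is an isomorphism for $0\le k<n$. The Hodge map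 $\ast_\sigma$ is the unique linear map on $\Omega^\bullet$ with $$\ast_\sigma(L^j\omega)=(-1)^{k(k+1)/2}\,\mathbf{i}^{a-b}\,\frac{j!}{(n-j-k)!}\,L^{n-j-k}\omega$$ for all $a,b,j\ge0$, with $k=a+b$ and $j+k\le n$, and all $\omega\in\Omega^{(a,b)}$ with $L^{n-k+1}\omega=0$. The metric $g_\sigma$ is defined by $g_\sigma(\Omega^k,\Omega^l)=0$ for $k\neq l$ and $g_\sigma(\omega,\nu)=\ast_\sigma(\omega\wedge\ast_\sigma(\nu^*))\in B$ for $\omega,\nu\in\Omega^k$. (4) The integral is closed: $\mathbf{h}(\ast_\sigma(\mathrm{d}\omega))=0$ for all $\omega\in\Omega^{2n-1}$. The metric is positive: for each $\omega\neq0$ in $\Omega^\bullet$, $g_\sigma(\omega,\omega)$ is a non-zero finite sum of elements $b^*b$ with $b\in B$. Let $\langle\omega,\nu\rangle=\mathbf{h}(g_\sigma(\omega,\nu))$ be the associated inner product on $\Omega^\bullet$, let $\overline\partial^\dagger$ be the adjoint of $\overline\partial$ on $\Omega^\bullet$, and let $L^2(\Omega^{(0,\bullet)})$ be the Hilbert space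 completion of $\Omega^{(0,\bullet)}=\bigoplus_b\Omega^{(0,b)}$. Let $D_{\overline\partial}$ be the closure in $L^2(\Omega^{(0,\bullet)})$ of the Dolbeault–Dirac operator $\overline\partial+\overline\partial^\dagger:\Omega^{(0,\bullet)}\to\Omega^{(0,\bullet)}$. Then right multiplication, $\rho(b)\omega=\omega b$, extends from $\Omega^{(0,\bullet)}$ to a unital $*$-representation $\rho$ of the opposite algebra $B^{\mathrm{op}}$ by bounded operators on $L^2(\Omega^{(0,\bullet)})$; the grading $\gamma(\omega)=(-1)^k\omega$, $\omega\in\Omega^{(0,k)}$, extends to a bounded operator on $L^2(\Omega^{(0,\bullet)})$; and with these $$\left(B^{\mathrm{op}},\,L^2(\Omega^{(0,\bullet)}),\,D_{\overline\partial},\,\gamma\right)$$ is an even spectral triple if and only if the eigenvalues of $D_{\overline\partial}$ tend to infinity in absolute value (for each $R$, only finitely many eigenvalues $\mu$ satisfy $|\mu|\le R$) and have finite multiplicity. Here $(\mathcal{A},\mathcal{H},D,\gamma)$ is an even spectral triple if $\mathcal{A}$ is a unital $*$-algebra with a faithful $*$-representation $\rho$ on the separable Hilbert space $\mathcal{H}$;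 $D$ is a densely defined self-adjoint operator on $\mathcal{H}$; for all $a\in\mathcal{A}$, $\rho(a)\,\mathrm{dom}(D)\subseteq\mathrm{dom}(D)$ and $[D,\rho(a)]$ is bounded; $(D^2+\mathbf{i})^{-1}$ is compact; and $\gamma$ is a self-adjoint unitary that commutes with each $\rho(a)$, preserves $\mathrm{dom}(D)$ and anticommutes with $D$. -/

import Mathlib

open scoped TensorProduct ComplexOrder InnerProductSpace

noncomputable section

/-! ### Compact quantum group algebras -/

/-- A Haar functional on a Hopf algebra: normalised and bi-invariant. -/
structure IsHaarFunctional {A : Type*} [Ring A] [HopfAlgebra ℂ A] (h : A →ₗ[ℂ] ℂ) : Prop where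
  map_one : h 1 = 1
  left_inv : ∀ a : A, TensorProduct.lid ℂ A (h.rTensor A (Coalgebra.comul a)) = h a • (1 : A)
  right_inv : ∀ a : A, TensorProduct.rid ℂ A (h.lTensor A (Coalgebra.comul a)) = h a • (1 : A)

/-- A compact quantum group algebra: a Hopf `*`-algebra which is cosemisimple, i.e. which admits a
(necessarily unique) Haar functional, and whose Haar functional is positive. -/
class CQGA (A : Type*) [Ring A] [HopfAlgebra ℂ A] [StarRing A] [StarModule ℂ A] : Prop where
  comul_star : ∀ a : A, (Coalgebra.comul (star a) : A ⊗[ℂ] A) = star (Coalgebra.comul a)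
  exists_haar : ∃ h : A →ₗ[ℂ] ℂ, IsHaarFunctional h ∧ ∀ a : A, a ≠ 0 → 0 < h (star a * a)

section Haar

variable (A : Type*) [Ring A] [HopfAlgebra ℂ A] [StarRing A] [StarModule ℂ A] [CQGA A]

/-- The Haar functional of a compact quantum group algebra. -/
def haar : A →ₗ[ℂ] ℂ := (CQGA.exists_haar (A := A)).choose

theorem haar_isHaarFunctional : IsHaarFunctional (haar A) :=
  (CQGA.exists_haar (A := A)).choose_spec.1

variable {A}

theorem haar_pos {a : A} (ha : a ≠ 0) : 0 < haar A (star a * a) :=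
  (CQGA.exists_haar (A := A)).choose_spec.2 a ha

end Haar

/-! ### Quantum homogeneous spaces -/

section Coinvariants

variable {A H : Type*} [Ring A] [HopfAlgebra ℂ A] [StarRing A] [StarModule ℂ A] [CQGA A]
  [Ring H] [HopfAlgebra ℂ H] [StarRing H] [StarModule ℂ H]

/-- The right coaction `(id ⊗ π) ∘ Δ` of `H` on `A`. -/
def rightCoaction (π : A →ₐc[ℂ] H) : A →ₐ[ℂ] A ⊗[ℂ] H :=
  (Algebra.TensorProduct.map (AlgHom.id ℂ A) (π : A →ₐ[ℂ] H)).comp (Bialgebra.comulAlgHom ℂ A)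

theorem rightCoaction_star (π : A →ₐc[ℂ] H) (hπ : ∀ a, π (star a) = star (π a)) (a : A) :
    rightCoaction π (star a) = star (rightCoaction π a) := by
  change (π : A →ₗ[ℂ] H).lTensor A (Coalgebra.comul (star a)) =
    star ((π : A →ₗ[ℂ] H).lTensor A (Coalgebra.comul a))
  rw [CQGA.comul_star]
  induction (Coalgebra.comul a : A ⊗[ℂ] A) using TensorProduct.induction_on with
  | zero => simp
  | tmul x y => simp [TensorProduct.star_tmul, hπ]
  | add x y hx hy => rw [star_add, map_add, map_add, star_add, hx, hy]

/-- The algebra `B = A^{co H}` of coinvariants, `{a | (id ⊗ π) Δ a = a ⊗ 1}`. -/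
def coinvariants (π : A →ₐc[ℂ] H) (hπ : ∀ a, π (star a) = star (π a)) : StarSubalgebra ℂ A where
  toSubalgebra := AlgHom.equalizer (rightCoaction π) Algebra.TensorProduct.includeLeft
  star_mem' := by
    intro a ha
    change rightCoaction π a = a ⊗ₜ[ℂ] (1 : H) at ha
    change rightCoaction π (star a) = star a ⊗ₜ[ℂ] (1 : H)
    rw [rightCoaction_star π hπ, ha, TensorProduct.star_tmul, star_one]

theorem mem_coinvariants {π : A →ₐc[ℂ] H} {hπ : ∀ a, π (star a) = star (π a)} {a : A} :
    a ∈ coinvariants π hπ ↔ rightCoaction π a = a ⊗ₜ[ℂ] (1 : H) := Iff.rfl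

/-- The inclusion of the coinvariants, as a linear map. -/
def coinvariantsIncl (π : A →ₐc[ℂ] H) (hπ : ∀ a, π (star a) = star (π a)) :
    coinvariants π hπ →ₗ[ℂ] A :=
  (coinvariants π hπ).subtype.toAlgHom.toLinearMap

theorem coinvariantsIncl_lTensor_injective (π : A →ₐc[ℂ] H)
    (hπ : ∀ a, π (star a) = star (π a)) :
    Function.Injective ((coinvariantsIncl π hπ).lTensor A) :=
  Module.Flat.lTensor_preserves_injective_linearMap _ Subtype.val_injective

theorem comul_mem_range_lTensor (π : A →ₐc[ℂ] H) (hπ : ∀ a, π (star a) = star (π a))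
    (b : coinvariants π hπ) :
    (Coalgebra.comul (b : A) : A ⊗[ℂ] A) ∈
      LinearMap.range ((coinvariantsIncl π hπ).lTensor A) := by
  let δ : A →ₗ[ℂ] A ⊗[ℂ] H :=
    (π : A →ₗ[ℂ] H).lTensor A ∘ₗ Coalgebra.comul - (TensorProduct.mk ℂ A H).flip 1
  have hδ : Function.Exact (coinvariantsIncl π hπ) δ := by
    intro a
    constructor
    · intro h
      have h' : rightCoaction π a = a ⊗ₜ[ℂ] (1 : H) := sub_eq_zero.mp h
      exact ⟨⟨a, h'⟩, rfl⟩
    · rintro ⟨c, rfl⟩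
      exact sub_eq_zero.mpr c.2
  have hex := Module.Flat.lTensor_exact A hδ
  refine (hex _).mp ?_
  have h1 : (δ.lTensor A) (Coalgebra.comul (b : A)) =
      TensorProduct.assoc ℂ A A H ((Coalgebra.comul (R := ℂ) (A := A)).rTensor H
        ((π : A →ₗ[ℂ] H).lTensor A (Coalgebra.comul (b : A)))) -
      TensorProduct.assoc ℂ A A H (Coalgebra.comul (b : A) ⊗ₜ[ℂ] (1 : H)) := by
    have e1 : ∀ t : A ⊗[ℂ] A, (((TensorProduct.mk ℂ A H).flip 1).lTensor A) t =
        TensorProduct.assoc ℂ A A H (t ⊗ₜ[ℂ] (1 : H)) := by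
      intro t
      induction t using TensorProduct.induction_on with
      | zero => simp
      | tmul x y => simp
      | add x y hx hy => rw [map_add, hx, hy, TensorProduct.add_tmul, map_add]
    have e2 : ∀ t : A ⊗[ℂ] A, TensorProduct.assoc ℂ A A H
        ((Coalgebra.comul (R := ℂ) (A := A)).rTensor H ((π : A →ₗ[ℂ] H).lTensor A t)) =
        (((π : A →ₗ[ℂ] H).lTensor A).lTensor A) (TensorProduct.assoc ℂ A A A
          ((Coalgebra.comul (R := ℂ) (A := A)).rTensor A t)) := by
      intro t
      induction t using TensorProduct.induction_on with
      | zero => simp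
      | tmul x y =>
        simp only [LinearMap.lTensor_tmul, LinearMap.rTensor_tmul]
        induction (Coalgebra.comul x : A ⊗[ℂ] A) using TensorProduct.induction_on with
        | zero => simp
        | tmul u v => simp
        | add u v hu hv =>
          rw [TensorProduct.add_tmul, TensorProduct.add_tmul, map_add, map_add, map_add, hu, hv]
      | add x y hx hy => simp only [map_add, hx, hy]
    rw [e2, Coalgebra.coassoc_apply, ← e1]
    simp only [δ, LinearMap.lTensor_sub, LinearMap.sub_apply, LinearMap.lTensor_comp,
      LinearMap.comp_apply]
  have hb : (π : A →ₗ[ℂ] H).lTensor A (Coalgebra.comul (b : A)) = (b : A) ⊗ₜ[ℂ] (1 : H) := b.2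
  rw [h1, hb, LinearMap.rTensor_tmul, sub_self]

/-- The left coaction `Δ_L : B → A ⊗ B` on the coinvariants, the restriction of the coproduct. -/
def leftCoaction (π : A →ₐc[ℂ] H) (hπ : ∀ a, π (star a) = star (π a)) :
    coinvariants π hπ →ₗ[ℂ] A ⊗[ℂ] coinvariants π hπ :=
  (LinearEquiv.ofInjective _ (coinvariantsIncl_lTensor_injective π hπ)).symm.toLinearMap ∘ₗ
    (Coalgebra.comul ∘ₗ coinvariantsIncl π hπ).codRestrict _ (comul_mem_range_lTensor π hπ)

theorem lTensor_leftCoaction (π : A →ₐc[ℂ] H) (hπ : ∀ a, π (star a) = star (π a))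
    (b : coinvariants π hπ) :
    (coinvariantsIncl π hπ).lTensor A (leftCoaction π hπ b) = Coalgebra.comul (b : A) := by
  have := (LinearEquiv.ofInjective _ (coinvariantsIncl_lTensor_injective π hπ)).apply_symm_apply
    ((Coalgebra.comul ∘ₗ coinvariantsIncl π hπ).codRestrict _ (comul_mem_range_lTensor π hπ) b)
  exact congrArg Subtype.val this

end Coinvariants

/-! ### Differential calculi, complex structures, Hermitian structures -/

/-- A differential `*`-calculus over the `*`-algebra `B`, with algebra of forms `Ω`. -/
structure StarCalculus (B Ω : Type*) [Ring B] [Algebra ℂ B] [StarRing B]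
    [Ring Ω] [Algebra ℂ Ω] where
  /-- the forms of degree `k` -/
  deg : ℕ → Submodule ℂ Ω
  gradedAlgebra : GradedAlgebra deg
  /-- the identification of `B` with the forms of degree zero -/
  incl : B →ₐ[ℂ] Ω
  incl_injective : Function.Injective incl
  range_incl : LinearMap.range incl.toLinearMap = deg 0
  /-- the exterior derivative -/
  d : Ω →ₗ[ℂ] Ω
  d_mem : ∀ k, ∀ ω ∈ deg k, d ω ∈ deg (k + 1)
  d_d : ∀ ω, d (d ω) = 0
  leibniz : ∀ k, ∀ ω ∈ deg k, ∀ ν, d (ω * ν) = d ω * ν + (-1 : ℂ) ^ k • (ω * d ν)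
  generated : Algebra.adjoin ℂ (Set.range incl ∪ Set.range fun b => d (incl b)) = ⊤
  /-- the `*`-map -/
  conj : Ω →ₗ⋆[ℂ] Ω
  conj_conj : ∀ ω, conj (conj ω) = ω
  conj_incl : ∀ b, conj (incl b) = incl (star b)
  conj_d : ∀ ω, conj (d ω) = d (conj ω)
  conj_mul : ∀ k l, ∀ ω ∈ deg k, ∀ ν ∈ deg l,
    conj (ω * ν) = (-1 : ℂ) ^ (k * l) • (conj ν * conj ω)

attribute [instance] StarCalculus.gradedAlgebra

section Calculus

variable {B Ω : Type*} [Ring B] [Algebra ℂ B] [StarRing B] [Ring Ω] [Algebra ℂ Ω]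

/-- The projection of a form to its component of degree `k`. -/
def StarCalculus.proj (C : StarCalculus B Ω) (k : ℕ) : Ω →ₗ[ℂ] Ω := GradedAlgebra.proj C.deg k

theorem StarCalculus.proj_mem (C : StarCalculus B Ω) (k : ℕ) (ω : Ω) : C.proj k ω ∈ C.deg k :=
  SetLike.coe_mem _

/-- The projection of a form to its component of degree zero, viewed in `B`. -/
def StarCalculus.toBase (C : StarCalculus B Ω) : Ω →ₗ[ℂ] B :=
  (LinearEquiv.ofInjective C.incl.toLinearMap C.incl_injective).symm.toLinearMap ∘ₗ
    (C.proj 0).codRestrict _ fun ω => C.range_incl ▸ C.proj_mem 0 ω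

theorem StarCalculus.toBase_incl (C : StarCalculus B Ω) (b : B) : C.toBase (C.incl b) = b := by
  apply C.incl_injective
  have h : C.incl b ∈ C.deg 0 := by rw [← C.range_incl]; exact ⟨b, rfl⟩
  have h1 : C.incl (C.toBase (C.incl b)) = C.proj 0 (C.incl b) :=
    congrArg Subtype.val
      ((LinearEquiv.ofInjective C.incl.toLinearMap C.incl_injective).apply_symm_apply _)
  rw [h1]
  exact DirectSum.decompose_of_mem_same C.deg h

/-- A complex structure on a differential `*`-calculus. -/
structure ComplexStructure (C : StarCalculus B Ω) where
  /-- the forms of bidegree `(a, b)` -/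
  bideg : ℕ × ℕ → Submodule ℂ Ω
  bigraded : GradedAlgebra bideg
  deg_eq : ∀ k, C.deg k = ⨆ p : {p : ℕ × ℕ // p.1 + p.2 = k}, bideg p
  conj_mem : ∀ a b, ∀ ω ∈ bideg (a, b), C.conj ω ∈ bideg (b, a)
  d_mem_sup : ∀ a b, ∀ ω ∈ bideg (a, b), C.d ω ∈ bideg (a + 1, b) ⊔ bideg (a, b + 1)

attribute [instance] ComplexStructure.bigraded

namespace ComplexStructure

variable {C : StarCalculus B Ω} (J : ComplexStructure C)

/-- The projection of a form to its component of bidegree `p`. -/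
def biproj (p : ℕ × ℕ) : Ω →ₗ[ℂ] Ω := GradedAlgebra.proj J.bideg p

/-- The operator `∂̄`, which is `proj_{(a, b + 1)} ∘ d` on the forms of bidegree `(a, b)`. -/
def dbar : Ω →ₗ[ℂ] Ω :=
  DirectSum.toModule ℂ (ℕ × ℕ) Ω
      (fun p => J.biproj (p.1, p.2 + 1) ∘ₗ C.d ∘ₗ (J.bideg p).subtype) ∘ₗ
    (DirectSum.decomposeLinearEquiv J.bideg).toLinearMap

/-- The space `Ω^{(0,•)}` of anti-holomorphic forms. -/
def antiholomorphic : Submodule ℂ Ω := ⨆ b, J.bideg (0, b)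

/-- The projection of `Ω` onto `Ω^{(0,•)}` along the other components of the bigrading. -/
def projAntiholomorphic : Ω →ₗ[ℂ] J.antiholomorphic :=
  DirectSum.toModule ℂ (ℕ × ℕ) J.antiholomorphic
      (fun p => if h : p.1 = 0 then
          Submodule.inclusion ((congrArg J.bideg (Prod.ext h rfl : p = (0, p.2))).le.trans
            (le_iSup (fun b => J.bideg (0, b)) p.2))
        else 0) ∘ₗ
    (DirectSum.decomposeLinearEquiv J.bideg).toLinearMap

theorem incl_mem_bideg (b : B) : C.incl b ∈ J.bideg (0, 0) := by
  have h : C.incl b ∈ C.deg 0 := by rw [← C.range_incl]; exact ⟨b, rfl⟩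
  rw [J.deg_eq] at h
  refine (iSup_le ?_ : (⨆ p : {p : ℕ × ℕ // p.1 + p.2 = 0}, J.bideg p) ≤ J.bideg (0, 0)) h
  rintro ⟨⟨a, c⟩, hp⟩
  obtain ⟨rfl, rfl⟩ := Nat.add_eq_zero_iff.mp hp
  exact le_rfl

theorem mul_incl_mem_antiholomorphic {ω : Ω} (hω : ω ∈ J.antiholomorphic) (b : B) :
    ω * C.incl b ∈ J.antiholomorphic := by
  unfold antiholomorphic at hω
  induction hω using Submodule.iSup_induction' with
  | mem k x hx =>
    exact Submodule.mem_iSup_of_mem k (SetLike.mul_mem_graded hx (J.incl_mem_bideg b))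
  | zero => rw [zero_mul]; exact zero_mem _
  | add x y _ _ hx hy => rw [add_mul]; exact add_mem hx hy

end ComplexStructure

/-- A Hermitian structure on a differential `*`-calculus of total degree `2n`. -/
structure HermitianStructure (C : StarCalculus B Ω) extends ComplexStructure C where
  n : ℕ
  deg_top : C.deg (2 * n) ≠ ⊥
  deg_eq_bot : ∀ k, 2 * n < k → C.deg k = ⊥
  /-- the Hermitian form -/
  σ : Ω
  σ_mem : σ ∈ bideg (1, 1)
  σ_central : ∀ ω, σ * ω = ω * σ
  σ_real : C.conj σ = σ
  lefschetz : ∀ k, k < n →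
    Set.BijOn ((LinearMap.mulLeft ℂ σ) ^ (n - k)) (C.deg k) (C.deg (2 * n - k))

namespace HermitianStructure

variable {C : StarCalculus B Ω} (J : HermitianStructure C)

/-- The Lefschetz operator `L ω = σ ∧ ω`. -/
def L : Module.End ℂ Ω := LinearMap.mulLeft ℂ J.σ

/-- `ω` is a primitive form of bidegree `(a, b)`. -/
def IsPrimitive (a b : ℕ) (ω : Ω) : Prop :=
  ω ∈ J.bideg (a, b) ∧ if a + b ≤ J.n then (J.L ^ (J.n - (a + b) + 1)) ω = 0 else ω = 0

/-- The Weil formula characterising the Hodge map. -/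
def IsHodgeMap (s : Module.End ℂ Ω) : Prop :=
  ∀ a b j : ℕ, j + (a + b) ≤ J.n → ∀ ω, J.IsPrimitive a b ω →
    s ((J.L ^ j) ω) =
      ((-1 : ℂ) ^ ((a + b) * (a + b + 1) / 2) * Complex.I ^ ((a : ℤ) - (b : ℤ)) *
        ((j.factorial : ℂ) / ((J.n - j - (a + b)).factorial : ℂ))) •
          (J.L ^ (J.n - j - (a + b))) ω

open Classical in
/-- The Hodge map: the linear map given by the Weil formula. By the Lefschetz decomposition there
is exactly one such map, so the second branch never occurs. -/
def hodge : Module.End ℂ Ω := if h : ∃ s, J.IsHodgeMap s then h.choose else 0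

/-- The metric `g`, regarded as taking values in `Ω ⊇ B`: different degrees are orthogonal, and
`g ω ν = ∗(ω ∧ ∗(ν*))` for forms of equal degree. -/
def metric (ω ν : Ω) : Ω :=
  ∑ k ∈ Finset.range (2 * J.n + 1), J.hodge (C.proj k ω * J.hodge (C.conj (C.proj k ν)))

/-- Positivity: `g ω ω` is a non-zero finite sum of elements `b* b`, for each `ω ≠ 0`. -/
def IsPositive : Prop :=
  ∀ ω, ω ≠ 0 → ∃ b ∈ AddSubmonoid.closure (Set.range fun c : B => star c * c),
    b ≠ 0 ∧ J.metric ω ω = C.incl b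

end HermitianStructure

end Calculus

/-! ### Compact quantum homogeneous Hermitian spaces -/

/-- A compact quantum homogeneous Hermitian space `(B = A^{co H}, Ω^•, Ω^{(•,•)}, σ)`. -/
structure CQHHermitianSpace (A H Ω : Type*)
    [Ring A] [HopfAlgebra ℂ A] [StarRing A] [StarModule ℂ A] [CQGA A]
    [Ring H] [HopfAlgebra ℂ H] [StarRing H] [StarModule ℂ H] [CQGA H]
    [Ring Ω] [Algebra ℂ Ω] where
  /-- the surjective Hopf `*`-algebra map defining the quantum homogeneous space -/
  π : A →ₐc[ℂ] H
  π_star : ∀ a, π (star a) = star (π a)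
  π_surjective : Function.Surjective π
  /-- the differential `*`-calculus over `B = A^{co H}` -/
  calculus : StarCalculus (coinvariants π π_star) Ω
  /-- the left `A`-coaction on forms, an algebra map -/
  coaction : Ω →ₐ[ℂ] A ⊗[ℂ] Ω
  coaction_coassoc : ∀ ω,
    TensorProduct.assoc ℂ A A Ω ((Coalgebra.comul (R := ℂ) (A := A)).rTensor Ω (coaction ω)) =
      coaction.toLinearMap.lTensor A (coaction ω)
  coaction_counit : ∀ ω,
    TensorProduct.lid ℂ Ω ((Coalgebra.counit (R := ℂ) (A := A)).rTensor Ω (coaction ω)) = ω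
  coaction_incl : ∀ b, coaction (calculus.incl b) =
    calculus.incl.toLinearMap.lTensor A (leftCoaction π π_star b)
  coaction_d : ∀ ω, coaction (calculus.d ω) = calculus.d.lTensor A (coaction ω)
  /-- `Ω` is finitely generated as a left `B`-module -/
  finite : @Module.Finite (coinvariants π π_star) Ω _ _
    (Module.compHom Ω calculus.incl.toRingHom)
  /-- `Ω B⁺ = B⁺ Ω` for `B⁺ = B ∩ ker ε` -/
  augmentation : (⊤ : Submodule ℂ Ω) * (LinearMap.ker
        (Coalgebra.counit ∘ₗ coinvariantsIncl π π_star)).map calculus.incl.toLinearMap =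
      (LinearMap.ker (Coalgebra.counit ∘ₗ coinvariantsIncl π π_star)).map
        calculus.incl.toLinearMap * (⊤ : Submodule ℂ Ω)
  /-- the Hermitian structure -/
  hermitian : HermitianStructure calculus
  coaction_bideg : ∀ p, ∀ ω ∈ hermitian.bideg p,
    coaction ω ∈ LinearMap.range ((hermitian.bideg p).subtype.lTensor A)
  coaction_σ : coaction hermitian.σ = 1 ⊗ₜ[ℂ] hermitian.σ
  /-- the integral is closed: `∫ dω = 0` for `ω ∈ Ω^{2n-1}`, where `∫ = haar ∘ ∗` -/
  integral_closed : ∀ k, k + 1 = 2 * hermitian.n → ∀ ω ∈ calculus.deg k,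
    haar A (calculus.toBase (hermitian.hodge (calculus.d ω)) : coinvariants π π_star) = 0
  positive : hermitian.IsPositive

namespace CQHHermitianSpace

variable {A H Ω : Type*}
  [Ring A] [HopfAlgebra ℂ A] [StarRing A] [StarModule ℂ A] [CQGA A]
  [Ring H] [HopfAlgebra ℂ H] [StarRing H] [StarModule ℂ H] [CQGA H]
  [Ring Ω] [Algebra ℂ Ω] (S : CQHHermitianSpace A H Ω)

/-- The quantum homogeneous space `B = A^{co H}`. -/
abbrev B : StarSubalgebra ℂ A := coinvariants S.π S.π_star

/-- The inner product `⟨ω, ν⟩_σ = haar (g_σ ω ν)`, linear in `ω` and conjugate linear in `ν`. -/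
def form (ω ν : Ω) : ℂ := haar A (S.calculus.toBase (S.hermitian.metric ω ν) : S.B)

theorem form_add_left (x y z : Ω) : S.form (x + y) z = S.form x z + S.form y z := by
  simp [form, HermitianStructure.metric, add_mul, Finset.sum_add_distrib]

theorem form_add_right (x y z : Ω) : S.form x (y + z) = S.form x y + S.form x z := by
  simp [form, HermitianStructure.metric, mul_add, Finset.sum_add_distrib]

theorem form_smul_left (r : ℂ) (x y : Ω) : S.form (r • x) y = r * S.form x y := by
  simp [form, HermitianStructure.metric, ← Finset.smul_sum]

theorem form_smul_right (r : ℂ) (x y : Ω) :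
    S.form x (r • y) = (starRingEnd ℂ) r * S.form x y := by
  simp [form, HermitianStructure.metric, ← Finset.smul_sum]

theorem haar_pos_of_mem_closure (b : S.B)
    (hb : b ∈ AddSubmonoid.closure (Set.range fun c : S.B => star c * c)) :
    b = 0 ∨ 0 < haar A (b : A) := by
  induction hb using AddSubmonoid.closure_induction with
  | mem x hx =>
    obtain ⟨c, rfl⟩ := hx
    by_cases hc : c = 0
    · left; simp [hc]
    · right
      exact haar_pos (a := (c : A)) fun h => hc (Subtype.ext h)
  | zero => left; rfl
  | add x y _ _ hx hy =>
    rcases hx with rfl | hx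
    · simpa using hy
    · rcases hy with rfl | hy
      · right; simpa using hx
      · right
        have : haar A ((x + y : S.B) : A) = haar A (x : A) + haar A (y : A) := by simp
        rw [this]
        exact add_pos hx hy

theorem form_self_pos {ω : Ω} (hω : ω ≠ 0) : 0 < S.form ω ω := by
  obtain ⟨b, hb, hb0, h⟩ := S.positive ω hω
  rw [form, h, StarCalculus.toBase_incl]
  exact (S.haar_pos_of_mem_closure b hb).resolve_left hb0

theorem form_self_nonneg (ω : Ω) : 0 ≤ S.form ω ω := by
  by_cases h : ω = 0
  · subst h
    have : S.form 0 0 = 0 := by simpa using S.form_smul_left 0 0 0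
    rw [this]
  · exact (S.form_self_pos h).le

theorem form_conj_symm (x y : Ω) : (starRingEnd ℂ) (S.form x y) = S.form y x := by
  have h0 : ∀ ω, (S.form ω ω).im = 0 := fun ω =>
    (Complex.nonneg_iff.mp (S.form_self_nonneg ω)).2.symm
  have h1 := h0 (x + y)
  have h2 := h0 (x + Complex.I • y)
  simp only [form_add_left, form_add_right, form_smul_left, form_smul_right, Complex.add_im,
    Complex.add_re, Complex.mul_im, Complex.mul_re, Complex.conj_I, Complex.neg_im, Complex.neg_re,
    Complex.I_re, Complex.I_im, h0] at h1 h2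
  apply Complex.ext
  · rw [Complex.conj_re]; linarith
  · rw [Complex.conj_im]; linarith

/-- The space of forms `Ω`, as a type carrying the inner product of `S`. -/
@[nolint unusedArguments]
def Forms (_S : CQHHermitianSpace A H Ω) : Type _ := Ω

instance : AddCommGroup S.Forms := inferInstanceAs (AddCommGroup Ω)

instance : Module ℂ S.Forms := inferInstanceAs (Module ℂ Ω)

/-- Mathlib's inner products are conjugate linear in the first variable, so the order of the
arguments is exchanged. -/
@[reducible]
def innerCore : InnerProductSpace.Core ℂ S.Forms where
  inner ω ν := S.form ν ω
  conj_inner_symm x y := S.form_conj_symm x y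
  re_inner_nonneg x := (Complex.nonneg_iff.mp (S.form_self_nonneg x)).1
  add_left x y z := S.form_add_right z x y
  smul_left x y r := S.form_smul_right r y x
  definite x hx := by
    by_contra h
    exact (S.form_self_pos h).ne' hx

instance : NormedAddCommGroup S.Forms := S.innerCore.toNormedAddCommGroup

instance : InnerProductSpace ℂ S.Forms := InnerProductSpace.ofCore S.innerCore.toCore

theorem inner_eq_form (ω ν : S.Forms) : ⟪ω, ν⟫_ℂ = S.form ν ω := rfl

end CQHHermitianSpace

/-! ### Operators on pre-Hilbert and Hilbert spaces -/

open Classical in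
/-- The adjoint of a linear map on a pre-Hilbert space: the (unique) linear map `T†` with
`⟨T x, y⟩ = ⟨x, T† y⟩`, and `0` if `T` is not adjointable. -/
def preAdjoint {E : Type*} [NormedAddCommGroup E] [InnerProductSpace ℂ E]
    (T : E →ₗ[ℂ] E) : E →ₗ[ℂ] E :=
  if h : ∃ T' : E →ₗ[ℂ] E, ∀ x y, ⟪T x, y⟫_ℂ = ⟪x, T' y⟫_ℂ then h.choose else 0

/-- A linear map `T` on a pre-Hilbert space `E`, as an operator with domain `E` on a Hilbert space
into which `E` is embedded by `ι`. -/
def asOperator {E 𝓗 : Type*} [NormedAddCommGroup E] [InnerProductSpace ℂ E]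
    [NormedAddCommGroup 𝓗] [InnerProductSpace ℂ 𝓗] (ι : E →ₗᵢ[ℂ] 𝓗) (T : E →ₗ[ℂ] E) :
    𝓗 →ₗ.[ℂ] 𝓗 where
  domain := LinearMap.range ι.toLinearMap
  toFun := ι.toLinearMap ∘ₗ T ∘ₗ
    (LinearEquiv.ofInjective ι.toLinearMap ι.injective).symm.toLinearMap

section SpectralTriple

variable {𝓗 : Type*} [NormedAddCommGroup 𝓗] [InnerProductSpace ℂ 𝓗]

/-- The eigenspace `{x ∈ dom D | D x = μ x}` of an unbounded operator. -/
def LinearPMap.eigenspace (D : 𝓗 →ₗ.[ℂ] 𝓗) (μ : ℂ) : Submodule ℂ 𝓗 :=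
  (LinearMap.ker (D.toFun - μ • D.domain.subtype)).map D.domain.subtype

/-- The set of eigenvalues of an unbounded operator. -/
def LinearPMap.pointSpectrum (D : 𝓗 →ₗ.[ℂ] 𝓗) : Set ℂ := {μ | D.eigenspace μ ≠ ⊥}

/-- The eigenvalues of `D` have finite multiplicity. -/
def LinearPMap.HasFiniteMultiplicities (D : 𝓗 →ₗ.[ℂ] 𝓗) : Prop :=
  ∀ μ ∈ D.pointSpectrum, FiniteDimensional ℂ (D.eigenspace μ)

/-- The eigenvalues of `D` tend to infinity: for each `R`, only finitely many eigenvalues have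
absolute value at most `R`. -/
def LinearPMap.EigenvaluesTendToInfinity (D : 𝓗 →ₗ.[ℂ] 𝓗) : Prop :=
  ∀ R : ℝ, {μ ∈ D.pointSpectrum | ‖μ‖ ≤ R}.Finite

/-- `R = (D² + i)⁻¹`, as a two-sided inverse of `D² + i : dom (D²) → 𝓗`. -/
def IsInverseSqAddI (D : 𝓗 →ₗ.[ℂ] 𝓗) (R : 𝓗 →L[ℂ] 𝓗) : Prop :=
  (∀ x : 𝓗, ∃ y z : D.domain, (y : 𝓗) = R x ∧ (z : 𝓗) = D y ∧
      D z + Complex.I • (y : 𝓗) = x) ∧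
    ∀ y z : D.domain, (z : 𝓗) = D y → R (D z + Complex.I • (y : 𝓗)) = y

variable [CompleteSpace 𝓗] {𝒜 : Type*} [Ring 𝒜] [Algebra ℂ 𝒜] [StarRing 𝒜]

/-- `(𝒜, 𝓗, D)` is a spectral triple, for the representation `π` of the unital `*`-algebra `𝒜`. -/
structure IsSpectralTriple (π : 𝒜 →⋆ₐ[ℂ] (𝓗 →L[ℂ] 𝓗)) (D : 𝓗 →ₗ.[ℂ] 𝓗) : Prop where
  separable : TopologicalSpace.SeparableSpace 𝓗
  faithful : Function.Injective π
  dense_domain : Dense (D.domain : Set 𝓗)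
  selfAdjoint : IsSelfAdjoint D
  map_domain : ∀ a, ∀ x ∈ D.domain, π a x ∈ D.domain
  bounded_commutator : ∀ a, ∃ c : ℝ, ∀ x y : D.domain, (y : 𝓗) = π a x →
    ‖D y - π a (D x)‖ ≤ c * ‖(x : 𝓗)‖
  compact_resolvent : ∃ R : 𝓗 →L[ℂ] 𝓗, IsInverseSqAddI D R ∧ IsCompactOperator R

/-- `(𝒜, 𝓗, D, γ)` is an even spectral triple. The grading `𝓗 = 𝓗₀ ⊕ 𝓗₁` is given by the
self-adjoint unitary `γ` which is `1` on `𝓗₀` and `-1` on `𝓗₁`. -/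
structure IsEvenSpectralTriple (π : 𝒜 →⋆ₐ[ℂ] (𝓗 →L[ℂ] 𝓗)) (D : 𝓗 →ₗ.[ℂ] 𝓗)
    (γ : 𝓗 →L[ℂ] 𝓗) : Prop extends IsSpectralTriple π D where
  γ_selfAdjoint : IsSelfAdjoint γ
  γ_sq : γ * γ = 1
  γ_commute : ∀ a, γ * π a = π a * γ
  γ_domain : ∀ x ∈ D.domain, γ x ∈ D.domain
  γ_anticommute : ∀ x y : D.domain, (y : 𝓗) = γ x → D y = -γ (D x)

end SpectralTriple

/-! ### The Dolbeault–Dirac operator -/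

namespace CQHHermitianSpace

variable {A H Ω : Type*}
  [Ring A] [HopfAlgebra ℂ A] [StarRing A] [StarModule ℂ A] [CQGA A]
  [Ring H] [HopfAlgebra ℂ H] [StarRing H] [StarModule ℂ H] [CQGA H]
  [Ring Ω] [Algebra ℂ Ω] (S : CQHHermitianSpace A H Ω)

/-- The operator `∂̄` on the inner product space of forms. -/
def dbar : S.Forms →ₗ[ℂ] S.Forms := S.hermitian.dbar

/-- The Dolbeault–Dirac operator `∂̄ + ∂̄†` on forms. -/
def diracForms : S.Forms →ₗ[ℂ] S.Forms := S.dbar + preAdjoint S.dbar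

/-- The anti-holomorphic forms `Ω^{(0,•)}`, with the restricted inner product. -/
def Antiholomorphic : Submodule ℂ S.Forms := S.hermitian.antiholomorphic

/-- The Hilbert space `L²(Ω^{(0,•)})`, the completion of `Ω^{(0,•)}`. -/
def L2 : Type _ := UniformSpace.Completion S.Antiholomorphic

instance : NormedAddCommGroup S.L2 :=
  inferInstanceAs (NormedAddCommGroup (UniformSpace.Completion S.Antiholomorphic))

instance : InnerProductSpace ℂ S.L2 :=
  inferInstanceAs (InnerProductSpace ℂ (UniformSpace.Completion S.Antiholomorphic))

instance : CompleteSpace S.L2 :=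
  inferInstanceAs (CompleteSpace (UniformSpace.Completion S.Antiholomorphic))

/-- The dense inclusion of `Ω^{(0,•)}` in `L²(Ω^{(0,•)})`. -/
def toL2 : S.Antiholomorphic →ₗᵢ[ℂ] S.L2 :=
  (UniformSpace.Completion.toComplₗᵢ :
    S.Antiholomorphic →ₗᵢ[ℂ] UniformSpace.Completion S.Antiholomorphic)

/-- The Dolbeault–Dirac operator on `Ω^{(0,•)}`. The subspace `Ω^{(0,•)}` is invariant under
`∂̄ + ∂̄†`; composing with the projection only corrects the codomain. -/
def diracAntiholomorphic : S.Antiholomorphic →ₗ[ℂ] S.Antiholomorphic :=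
  S.hermitian.projAntiholomorphic ∘ₗ S.diracForms ∘ₗ S.Antiholomorphic.subtype

/-- The Dolbeault–Dirac operator `D_∂̄` as a closed operator on `L²(Ω^{(0,•)})`: the closure of
`∂̄ + ∂̄†` with domain `Ω^{(0,•)}`. -/
def dirac : S.L2 →ₗ.[ℂ] S.L2 := (asOperator S.toL2 S.diracAntiholomorphic).closure

/-- Right multiplication `ω ↦ ω b` on `Ω^{(0,•)}`. -/
def rightMul (b : S.B) : S.Antiholomorphic →ₗ[ℂ] S.Antiholomorphic :=
  LinearMap.restrict (p := S.hermitian.antiholomorphic) (q := S.hermitian.antiholomorphic)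
    (LinearMap.mulRight ℂ (S.calculus.incl b))
    fun _ hω => S.hermitian.mul_incl_mem_antiholomorphic hω b

/-- `ρ` is the representation of `B^op` on `L²(Ω^{(0,•)})` by right multiplication: it extends
`ω ↦ ω b` from `Ω^{(0,•)}`. -/
def IsRightMultiplication (ρ : (S.B)ᵐᵒᵖ →⋆ₐ[ℂ] (S.L2 →L[ℂ] S.L2)) : Prop :=
  ∀ (b : S.B) (ω : S.Antiholomorphic),
    ρ (MulOpposite.op b) (S.toL2 ω) = S.toL2 (S.rightMul b ω)

/-- `γ` is the grading operator on `L²(Ω^{(0,•)})`, `γ ω = (-1)^k ω` for `ω` of degree `k`. -/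
def IsGradingOperator (γ : S.L2 →L[ℂ] S.L2) : Prop :=
  ∀ (k : ℕ) (ω : S.Antiholomorphic), (show Ω from ω.1) ∈ S.calculus.deg k →
    γ (S.toL2 ω) = (-1 : ℂ) ^ k • S.toL2 ω

end CQHHermitianSpace

end

/-!
The Dolbeault–Dirac operator `D = ∂̄ + ∂̄†` is essentially self-adjoint with bounded commutators
whatever its eigenvalues are. So the one condition of an even spectral triple that is not automatic,
besides the separability that it implies, is compactness of the resolvent, and for a diagonalisable
operator this means that the spectrum is discrete. Three facts carry the argument.

*Local finiteness.* The calculus, the complex structure and `σ` are covariant, so every functional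
`f` on `A` acts on `Ω` by an operator `ω ↦ f(ω₍₋₁₎) ω₍₀₎` that commutes with `∂̄` and with the Hodge
map. For the functionals `a ↦ haar (a x)` this operator has finite rank: on `B` by strong invariance
of the Haar functional, and on `Ω` because `Ω` is finitely generated over `B`
(`CQHHermitianSpace.finiteDimensional_range_act_haarMul`). Each form is fixed by one of these
operators, and the operators have adjoints of the same kind, because the inner product is invariant
and each finite set of forms lies in the span of a unitary family
(`CQHHermitianSpace.exists_unitaryFamily`, `CQHHermitianSpace.form_act`). Hence `∂̄` is adjointable
(`CQHHermitianSpace.form_dbar`), and `D` preserves finite-dimensional subspaces which exhaust `Ω`. A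
symmetric operator with this property is diagonalisable and essentially self-adjoint
(`isSelfAdjoint_closure`), and its resolvent is compact if and only if its eigenvalues have finite
multiplicity and tend to infinity (`exists_compact_inverse_iff`).

*Boundedness.* For a unitary family `w` that generates `Ω` over `B`, the frame operator
`ω ↦ ∑ g(ω, wᵢ) wᵢ` is injective, and it commutes with the action of functionals. It therefore
preserves the finite-dimensional ranges above, and it is bijective. The preimages `ξᵢ` of the `wᵢ`
give a dual basis, `ω = ∑ g(ω, wᵢ) ξᵢ` (`CQHHermitianSpace.exists_dual_basis`). The maps `b ↦ b ξ`
and `ω ↦ g(ω, w)` are bounded, since right multiplication by elements of `B`, which are sums of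
coefficients of unitary corepresentations, is bounded for the norm `haar (a a*)`. So every left
`B`-linear map on `Ω` is bounded (`CQHHermitianSpace.exists_formNorm_le`). This applies to right
multiplication by `b`, and to its commutator with `∂̄`, which is the grading followed by right
multiplication by `∂̄b`. The commutator with `∂̄†` is, up to sign, the adjoint of the commutator of
`∂̄` with right multiplication by `b*`.

*Orthogonality.* The operator acting by `a - b` on `Ω^{(a,b)}` is a derivation that annihilates `σ`,
so it commutes with the Hodge map, and forms of different bidegree are orthogonal
(`HermitianStructure.baseMetric_eq_zero_of_ne`). Thus the grading and the projection onto the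
anti-holomorphic forms are self-adjoint, and `∂̄†` restricts to the anti-holomorphic forms.

The general part is `isEvenSpectralTriple_extend_iff`, about a symmetric, locally finite operator on
a dense subspace of a Hilbert space.
-/

noncomputable section

/-! ### Symmetric, locally finite operators -/

section LocallyFinite

variable {E : Type*} [NormedAddCommGroup E] [InnerProductSpace ℂ E]

/-- A linear map is locally finite if every vector lies in a finite-dimensional invariant
subspace. -/
def LinearMap.IsLocallyFinite (T : E →ₗ[ℂ] E) : Prop :=
  ∀ x, ∃ U : Submodule ℂ E, FiniteDimensional ℂ U ∧ x ∈ U ∧ ∀ y ∈ U, T y ∈ U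

/-- A symmetric, locally finite operator is diagonalisable: each vector lies in an invariant
subspace of finite dimension, to which the spectral theorem applies. -/
theorem LinearMap.IsSymmetric.iSup_eigenspace_eq_top {T : E →ₗ[ℂ] E} (hT : T.IsSymmetric)
    (hfin : T.IsLocallyFinite) : ⨆ μ : ℂ, Module.End.eigenspace T μ = ⊤ := by
  refine eq_top_iff.mpr fun x _ => ?_
  obtain ⟨U, hU, hx, hTU⟩ := hfin x
  have hs := hT.restrict_invariant hTU
  have h1 := hs.orthogonalComplement_iSup_eigenspaces_eq_bot
  rw [Submodule.orthogonal_eq_bot_iff] at h1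
  have h2 : (⟨x, hx⟩ : U) ∈ ⨆ μ, Module.End.eigenspace (T.restrict hTU) μ := by
    rw [h1]; trivial
  have h3 := Submodule.mem_map_of_mem (f := U.subtype) h2
  rw [Submodule.map_iSup] at h3
  exact iSup_mono (fun μ => Module.End.eigenspace_restrict_le_eigenspace T hTU μ) h3

theorem LinearMap.IsSymmetric.abs_im_mul_norm_le {T : E →ₗ[ℂ] E} (hT : T.IsSymmetric) (α : ℂ)
    (x : E) : |α.im| * ‖x‖ ≤ ‖T x - α • x‖ := by
  have h1 : (⟪x, T x⟫_ℂ).im = 0 := by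
    have := hT x x
    rw [← inner_conj_symm] at this
    exact Complex.conj_eq_iff_im.mp this
  have h2 : (⟪x, T x - α • x⟫_ℂ).im = -(α.im * ‖x‖ ^ 2) := by
    rw [inner_sub_right, inner_smul_right, inner_self_eq_norm_sq_to_K, Complex.sub_im, h1]
    simp [← Complex.ofReal_pow]
  have h3 : |α.im| * ‖x‖ ^ 2 ≤ ‖x‖ * ‖T x - α • x‖ := by
    calc |α.im| * ‖x‖ ^ 2 = |(⟪x, T x - α • x⟫_ℂ).im| := by
          rw [h2, abs_neg, abs_mul, abs_of_nonneg (sq_nonneg ‖x‖)]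
      _ ≤ ‖⟪x, T x - α • x⟫_ℂ‖ := Complex.abs_im_le_norm _
      _ ≤ _ := norm_inner_le_norm _ _
  rcases eq_or_ne x 0 with rfl | hx
  · simp
  · have := norm_pos_iff.mpr hx
    nlinarith

/-- On a finite-dimensional invariant subspace, the injective map `T - α` is also surjective. -/
theorem LinearMap.IsSymmetric.bijective_sub_smul {T : E →ₗ[ℂ] E} (hT : T.IsSymmetric)
    (hfin : T.IsLocallyFinite) {α : ℂ} (hα : α.im ≠ 0) :
    Function.Bijective (T - α • LinearMap.id : E →ₗ[ℂ] E) := by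
  have hinj : Function.Injective (T - α • LinearMap.id : E →ₗ[ℂ] E) := by
    refine (injective_iff_map_eq_zero _).mpr fun x hx => ?_
    have h1 := hT.abs_im_mul_norm_le α x
    have h2 : T x - α • x = 0 := hx
    rw [h2, norm_zero] at h1
    have := abs_pos.mpr hα
    exact norm_le_zero_iff.mp (by nlinarith [norm_nonneg x])
  refine ⟨hinj, fun x => ?_⟩
  obtain ⟨U, hU, hx, hTU⟩ := hfin x
  have hV : ∀ y ∈ U, (T - α • LinearMap.id : E →ₗ[ℂ] E) y ∈ U := fun y hy =>
    sub_mem (hTU y hy) (U.smul_mem α hy)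
  have h1 : Function.Injective ((T - α • LinearMap.id : E →ₗ[ℂ] E).restrict hV) :=
    fun a b hab => Subtype.ext (hinj (congrArg Subtype.val hab))
  obtain ⟨y, hy⟩ := LinearMap.injective_iff_surjective.mp h1 ⟨x, hx⟩
  exact ⟨y, congrArg Subtype.val hy⟩

end LocallyFinite

/-! ### The closure of a symmetric operator and its resolvent -/

theorem LinearPMap.mem_eigenspace_iff {𝓗 : Type*} [NormedAddCommGroup 𝓗] [InnerProductSpace ℂ 𝓗]
    {D : 𝓗 →ₗ.[ℂ] 𝓗} {μ : ℂ} {v : 𝓗} : v ∈ D.eigenspace μ ↔ (v, μ • v) ∈ D.graph := by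
  rw [LinearPMap.mem_graph_iff]
  constructor
  · rintro ⟨x, hx, rfl⟩
    exact ⟨x, rfl, sub_eq_zero.mp hx⟩
  · rintro ⟨x, rfl, hx⟩
    exact ⟨x, sub_eq_zero.mpr hx, rfl⟩

section Closure

variable {E 𝓗 : Type*} [NormedAddCommGroup E] [InnerProductSpace ℂ E]
  [NormedAddCommGroup 𝓗] [InnerProductSpace ℂ 𝓗]
  {ι : E →ₗᵢ[ℂ] 𝓗} {T : E →ₗ[ℂ] E}

theorem mem_graph_asOperator {p : 𝓗 × 𝓗} :
    p ∈ (asOperator ι T).graph ↔ ∃ e, (ι e, ι (T e)) = p := by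
  have key : ∀ e h, (asOperator ι T) ⟨ι e, h⟩ = ι (T e) := fun e h => by
    change ι (T ((LinearEquiv.ofInjective ι.toLinearMap ι.injective).symm ⟨ι.toLinearMap e, h⟩)) = _
    have : (⟨ι.toLinearMap e, h⟩ : LinearMap.range ι.toLinearMap) =
      LinearEquiv.ofInjective ι.toLinearMap ι.injective e := rfl
    rw [this, LinearEquiv.symm_apply_apply]
  rw [LinearPMap.mem_graph_iff]
  constructor
  · rintro ⟨⟨_, e, rfl⟩, h1, h2⟩
    exact ⟨e, Prod.ext h1 ((key e _).symm.trans h2)⟩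
  · rintro ⟨e, rfl⟩
    exact ⟨⟨ι e, e, rfl⟩, rfl, key e _⟩

theorem dense_domain_asOperator (hι : DenseRange ι) :
    Dense ((asOperator ι T).domain : Set 𝓗) := by
  have : ((asOperator ι T).domain : Set 𝓗) = Set.range ι := by
    ext x; simp [asOperator]
  rw [this]; exact hι

theorem dense_domain_closure (hι : DenseRange ι) :
    Dense ((asOperator ι T).closure.domain : Set 𝓗) :=
  (dense_domain_asOperator hι).mono (LinearPMap.le_closure _).1

theorem mem_graph_closure (e : E) : (ι e, ι (T e)) ∈ (asOperator ι T).closure.graph :=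
  LinearPMap.le_graph_of_le (LinearPMap.le_closure _) (mem_graph_asOperator.mpr ⟨e, rfl⟩)

variable [CompleteSpace 𝓗]

/-- A symmetric operator is contained in its adjoint, which is closed. -/
theorem isClosable_asOperator (hι : DenseRange ι) (hT : T.IsSymmetric) :
    (asOperator ι T).IsClosable := by
  have h : (asOperator ι T).IsFormalAdjoint (asOperator ι T) := fun x y => by
    obtain ⟨e, he⟩ := mem_graph_asOperator.mp (LinearPMap.mem_graph _ x)
    obtain ⟨e', he'⟩ := mem_graph_asOperator.mp (LinearPMap.mem_graph _ y)
    simp only [Prod.mk.injEq] at he he'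
    rw [← he.1, ← he.2, ← he'.1, ← he'.2, ι.inner_map_map, ι.inner_map_map]
    exact hT _ _
  exact LinearPMap.isClosable_iff_exists_closed_extension.mpr
    ⟨_, LinearPMap.adjoint_isClosed (dense_domain_asOperator hι),
      h.le_adjoint (dense_domain_asOperator hι)⟩

theorem isClosed_graph_closure (hι : DenseRange ι) (hT : T.IsSymmetric) :
    IsClosed ((asOperator ι T).closure.graph : Set (𝓗 × 𝓗)) :=
  (isClosable_asOperator hι hT).closure_isClosed

/-- A closed condition on pairs that holds on the graph of `T` holds on the graph of its closure. -/
theorem graph_closure_induction (hι : DenseRange ι) (hT : T.IsSymmetric) {P : Set (𝓗 × 𝓗)}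
    (hP : IsClosed P) (h : ∀ e, (ι e, ι (T e)) ∈ P) {p : 𝓗 × 𝓗}
    (hp : p ∈ (asOperator ι T).closure.graph) : p ∈ P := by
  rw [← (isClosable_asOperator hι hT).graph_closure_eq_closure_graph] at hp
  refine closure_minimal ?_ hP hp
  intro q hq
  obtain ⟨e, rfl⟩ := mem_graph_asOperator.mp hq
  exact h e

theorem inner_eq_of_mem_graph (hι : DenseRange ι) (hT : T.IsSymmetric) {p q : 𝓗 × 𝓗}
    (hp : p ∈ (asOperator ι T).closure.graph) (hq : q ∈ (asOperator ι T).closure.graph) :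
    ⟪p.2, q.1⟫_ℂ = ⟪p.1, q.2⟫_ℂ := by
  refine graph_closure_induction (P := {p : 𝓗 × 𝓗 | ⟪p.2, q.1⟫_ℂ = ⟪p.1, q.2⟫_ℂ}) hι hT
    (isClosed_eq (by fun_prop) (by fun_prop)) (fun e => ?_) hp
  refine graph_closure_induction
    (P := {q : 𝓗 × 𝓗 | ⟪ι (T e), q.1⟫_ℂ = ⟪ι e, q.2⟫_ℂ}) hι hT
    (isClosed_eq (by fun_prop) (by fun_prop)) (fun e' => ?_) hq
  simp only [Set.mem_ofPred_eq, ι.inner_map_map]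
  exact hT _ _

/-- An eigenvector of the closure has a real eigenvalue. -/
theorem conj_eq_of_mem_graph (hι : DenseRange ι) (hT : T.IsSymmetric) {μ : ℂ} {v : 𝓗}
    (hv : v ≠ 0) (h : (v, μ • v) ∈ (asOperator ι T).closure.graph) :
    (starRingEnd ℂ) μ = μ := by
  have := inner_eq_of_mem_graph hι hT h h
  simp only [inner_smul_left, inner_smul_right] at this
  exact mul_right_cancel₀ (inner_self_ne_zero.mpr hv) this

theorem inner_eq_zero_of_mem_eigenspace (hι : DenseRange ι) (hT : T.IsSymmetric) {μ ν : ℂ}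
    (hμν : μ ≠ ν) {v w : 𝓗} (hv : v ∈ (asOperator ι T).closure.eigenspace μ)
    (hw : w ∈ (asOperator ι T).closure.eigenspace ν) : ⟪v, w⟫_ℂ = 0 := by
  rw [LinearPMap.mem_eigenspace_iff] at hv hw
  rcases eq_or_ne v 0 with rfl | hv0
  · simp
  have h1 := inner_eq_of_mem_graph hι hT hv hw
  simp only [inner_smul_left, inner_smul_right, conj_eq_of_mem_graph hι hT hv0 hv] at h1
  by_contra h
  exact hμν (mul_right_cancel₀ h h1)

open Classical in
/-- The bounded operator `(D - α)⁻¹`, for `D` the closure of `T` and `α` not real, as the extension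
of `(T - α)⁻¹`. -/
def resolventOp (ι : E →ₗᵢ[ℂ] 𝓗) (T : E →ₗ[ℂ] E) (α : ℂ) : 𝓗 →L[ℂ] 𝓗 :=
  if h : Function.Bijective (T - α • LinearMap.id : E →ₗ[ℂ] E) then
    (ι.toLinearMap ∘ₗ (LinearEquiv.ofBijective _ h).symm.toLinearMap).extendOfNorm ι.toLinearMap
  else 0

variable (hι : DenseRange ι) (hT : T.IsSymmetric) (hfin : T.IsLocallyFinite)
include hι hT hfin

theorem resolventOp_apply {α : ℂ} (hα : α.im ≠ 0) (e : E) :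
    resolventOp ι T α (ι (T e - α • e)) = ι e := by
  have hb := hT.bijective_sub_smul hfin hα
  rw [resolventOp, dif_pos hb]
  have hbound : ∃ C : ℝ, ∀ x, ‖(ι.toLinearMap ∘ₗ (LinearEquiv.ofBijective _ hb).symm.toLinearMap) x‖
      ≤ C * ‖ι.toLinearMap x‖ := by
    refine ⟨|α.im|⁻¹, fun x => ?_⟩
    obtain ⟨y, rfl⟩ := (LinearEquiv.ofBijective _ hb).surjective x
    simp only [LinearMap.comp_apply, LinearEquiv.coe_coe, LinearEquiv.symm_apply_apply,
      LinearIsometry.coe_toLinearMap, ι.norm_map]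
    rw [le_inv_mul_iff₀ (abs_pos.mpr hα)]
    exact hT.abs_im_mul_norm_le α y
  have h1 := LinearMap.extendOfNorm_eq (e := ι.toLinearMap) hι hbound (T e - α • e)
  refine h1.trans ?_
  have : T e - α • e = LinearEquiv.ofBijective _ hb e := rfl
  rw [this, LinearMap.comp_apply, LinearEquiv.coe_coe, LinearEquiv.symm_apply_apply]
  rfl

/-- `(D - α) (D - α)⁻¹ u = u`, in terms of the graph of `D`. -/
theorem resolventOp_mem_graph {α : ℂ} (hα : α.im ≠ 0) (u : 𝓗) :
    (resolventOp ι T α u, u + α • resolventOp ι T α u) ∈ (asOperator ι T).closure.graph := by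
  refine hι.induction_on (p := fun u =>
    (resolventOp ι T α u, u + α • resolventOp ι T α u) ∈ (asOperator ι T).closure.graph) u
    ((isClosed_graph_closure hι hT).preimage (by fun_prop)) fun x => ?_
  obtain ⟨e, rfl⟩ := (hT.bijective_sub_smul hfin hα).2 x
  have h := resolventOp_apply hι hT hfin hα e
  simp only [LinearMap.sub_apply, LinearMap.smul_apply, LinearMap.id_apply]
  rw [h, map_sub, map_smul, sub_add_cancel]
  exact mem_graph_closure e

/-- `(D - α)⁻¹ (D - α) x = x`, in terms of the graph of `D`. -/
theorem resolventOp_of_mem_graph {α : ℂ} (hα : α.im ≠ 0) {p : 𝓗 × 𝓗}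
    (hp : p ∈ (asOperator ι T).closure.graph) : resolventOp ι T α (p.2 - α • p.1) = p.1 := by
  refine graph_closure_induction
    (P := {p : 𝓗 × 𝓗 | resolventOp ι T α (p.2 - α • p.1) = p.1}) hι hT
    (isClosed_eq (by fun_prop) (by fun_prop)) (fun e => ?_) hp
  have := resolventOp_apply hι hT hfin hα e
  rwa [map_sub, map_smul] at this

/-- A symmetric, locally finite operator is essentially self-adjoint, since `T - i` and `T + i` are
surjective on the dense subspace. -/
theorem isSelfAdjoint_closure : IsSelfAdjoint (asOperator ι T).closure := by
  have hd := dense_domain_closure (T := T) hι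
  rw [LinearPMap.isSelfAdjoint_def]
  refine le_antisymm ?_ ?_
  · refine LinearPMap.le_of_le_graph fun p hp => ?_
    obtain ⟨y, hy, hy'⟩ := (LinearPMap.mem_graph_iff _).mp hp
    obtain ⟨y0, w⟩ := p
    simp only at hy hy'
    have hadj : ∀ e, ⟪w, ι e⟫_ℂ = ⟪y0, ι (T e)⟫_ℂ := fun e => by
      obtain ⟨x, hx, hx'⟩ := (LinearPMap.mem_graph_iff _).mp
        (mem_graph_closure (ι := ι) (T := T) e)
      have := LinearPMap.adjoint_isFormalAdjoint hd y x
      rwa [hx, hx', hy, hy'] at this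
    have hg := resolventOp_mem_graph hι hT hfin (α := Complex.I) (by simp) (w - Complex.I • y0)
    set x := resolventOp ι T Complex.I (w - Complex.I • y0) with hx
    -- `y0 - x` is in the kernel of `D* - i`, so it is orthogonal to the range of `T + i`.
    have hxy : y0 = x := by
      rw [← sub_eq_zero]
      refine hι.eq_zero_of_inner_left ℂ ?_
      intro f
      obtain ⟨e, rfl⟩ := (hT.bijective_sub_smul hfin (α := -Complex.I) (by simp)).2 f
      have h1 := inner_eq_of_mem_graph hι hT hg (mem_graph_closure e)
      have h2 := hadj e
      simp only [inner_add_left, inner_sub_left, inner_smul_left, Complex.conj_I] at h1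
      simp only [LinearMap.sub_apply, LinearMap.smul_apply, LinearMap.id_apply, map_sub, map_smul,
        inner_sub_left, inner_sub_right, inner_smul_right]
      linear_combination h1 - h2
    have h2 : w - Complex.I • y0 + Complex.I • x = w := by rw [hxy]; abel
    rw [h2, ← hxy] at hg
    exact hg
  · refine LinearPMap.IsFormalAdjoint.le_adjoint hd fun x y => ?_
    exact inner_eq_of_mem_graph hι hT (LinearPMap.mem_graph _ x) (LinearPMap.mem_graph _ y)

/-- If `α² = -i`, then `D² + i = (D + α) (D - α)`. -/
theorem isInverseSqAddI_resolventOp {α : ℂ} (hα : α ^ 2 = -Complex.I) :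
    IsInverseSqAddI (asOperator ι T).closure (resolventOp ι T α * resolventOp ι T (-α)) := by
  have hα1 : α.im ≠ 0 := fun h => by
    have := congrArg Complex.im hα
    simp [sq, h] at this
  have hα2 : (-α).im ≠ 0 := by simpa using hα1
  constructor
  · intro x
    have h1 := resolventOp_mem_graph hι hT hfin hα2 x
    have h2 := resolventOp_mem_graph hι hT hfin hα1 (resolventOp ι T (-α) x)
    have h3 := add_mem h1 (Submodule.smul_mem _ α h2)
    obtain ⟨y, hy, hy'⟩ := (LinearPMap.mem_graph_iff _).mp h2
    obtain ⟨z, hz, hz'⟩ := (LinearPMap.mem_graph_iff _).mp h3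
    simp only [Prod.fst_add, Prod.smul_fst, Prod.snd_add, Prod.smul_snd] at hy hy' hz hz'
    refine ⟨y, z, hy, by rw [hz, hy'], ?_⟩
    rw [hz', hy, smul_add, smul_smul, ← sq, hα]
    module
  · intro y z hz
    have h1 := LinearPMap.mem_graph _ y
    have h2 := LinearPMap.mem_graph _ z
    have h3 := resolventOp_of_mem_graph hι hT hfin hα2 (sub_mem h2 (Submodule.smul_mem _ α h1))
    have h4 := resolventOp_of_mem_graph hι hT hfin hα1 h1
    simp only [Prod.fst_sub, Prod.smul_fst, Prod.snd_sub, Prod.smul_snd] at h3 h4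
    have h5 : (asOperator ι T).closure z + Complex.I • (y : 𝓗) =
        (asOperator ι T).closure z - α • (asOperator ι T).closure y -
          -α • ((z : 𝓗) - α • (y : 𝓗)) := by
      rw [hz, neg_smul, smul_sub, smul_smul, ← sq, hα]
      module
    rw [h5, mul_apply_eq_comp, h3, hz, h4]

end Closure

/-! ### Compactness of the resolvent -/

section CompactResolvent

variable {𝓗 : Type*} [NormedAddCommGroup 𝓗] [InnerProductSpace ℂ 𝓗]

theorem IsInverseSqAddI.smul_apply_eigenvector {D : 𝓗 →ₗ.[ℂ] 𝓗} {R : 𝓗 →L[ℂ] 𝓗}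
    (hR : IsInverseSqAddI D R) {μ : ℂ} {v : 𝓗} (hv : v ∈ D.eigenspace μ) :
    (μ ^ 2 + Complex.I) • R v = v := by
  rw [LinearPMap.mem_eigenspace_iff] at hv
  obtain ⟨y, rfl, hy'⟩ := (LinearPMap.mem_graph_iff _).mp hv
  have h := hR.2 y (μ • y) (by rw [hy']; rfl)
  rw [LinearPMap.map_smul, hy', smul_smul, ← add_smul, ← sq, map_smul] at h
  exact h

/-- The operator `(D² + i)⁻¹` acts on an eigenspace of `D` as a nonzero scalar, and it is compact.
-/
theorem finiteDimensional_eigenspace_of_compact [CompleteSpace 𝓗] {D : 𝓗 →ₗ.[ℂ] 𝓗}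
    (hD : IsClosed (D.graph : Set (𝓗 × 𝓗))) {R : 𝓗 →L[ℂ] 𝓗} (hR : IsInverseSqAddI D R)
    (hc : IsCompactOperator R) (μ : ℂ) : FiniteDimensional ℂ (D.eigenspace μ) := by
  have hcl : IsClosed (D.eigenspace μ : Set 𝓗) := by
    have : (D.eigenspace μ : Set 𝓗) = (fun v => (v, μ • v)) ⁻¹' (D.graph : Set (𝓗 × 𝓗)) := by
      ext v; exact LinearPMap.mem_eigenspace_iff
    rw [this]
    exact hD.preimage (by fun_prop)
  have : CompleteSpace (D.eigenspace μ) := hcl.completeSpace_coe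
  have hmem : ∀ v ∈ D.eigenspace μ, R.toLinearMap v ∈ D.eigenspace μ := by
    intro v hv
    by_cases hμ : μ ^ 2 + Complex.I = 0
    · -- This case is void: it forces `v = 0`.
      have h := hR.smul_apply_eigenvector hv
      rw [hμ, zero_smul] at h
      rw [← h, map_zero]; exact zero_mem _
    · have h := hR.smul_apply_eigenvector hv
      rw [← eq_inv_smul_iff₀ hμ] at h
      change R v ∈ _
      rw [h]
      exact Submodule.smul_mem _ _ hv
  have h1 := (IsCompactOperator.restrict (f := R.toLinearMap) hc hmem hcl).smul (μ ^ 2 + Complex.I)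
  refine FiniteDimensional.of_isCompactOperator_id (𝕜 := ℂ) ?_
  refine (funext fun v => Subtype.ext ?_ : (id : D.eigenspace μ → D.eigenspace μ) = _) ▸ h1
  exact (hR.smul_apply_eigenvector v.2).symm

/-- A compact operator has no orthonormal sequence of eigenvectors with eigenvalues bounded away
from zero. The eigenvalue of `e n` is `(c n)⁻¹`. -/
theorem not_orthonormal_of_compact {R : 𝓗 →L[ℂ] 𝓗} (hc : IsCompactOperator R) {e : ℕ → 𝓗}
    (he : Orthonormal ℂ e) {c : ℕ → ℂ} {r : ℝ} (hcr : ∀ n, ‖c n‖ ≤ r)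
    (h : ∀ n, c n • R (e n) = e n) : False := by
  have hcpt := hc.isCompact_closure_image_closedBall (𝕜₁ := ℂ) (f := R.toLinearMap) 1
  obtain ⟨a, -, φ, hφ, hlim⟩ := hcpt.tendsto_subseq (x := fun n => R (e n)) fun n =>
    subset_closure ⟨e n, by simp [he.1 n], rfl⟩
  have hr : 0 < r := by
    have h0 : c 0 ≠ 0 := fun h0 => by
      have := h 0
      rw [h0, zero_smul] at this
      exact he.ne_zero 0 this.symm
    exact (norm_pos_iff.mpr h0).trans_le (hcr 0)
  obtain ⟨N, hN⟩ := Metric.cauchySeq_iff'.mp hlim.cauchySeq r⁻¹ (inv_pos.mpr hr)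
  have h1 := hN (N + 1) (Nat.le_succ N)
  have hne : φ N ≠ φ (N + 1) := (hφ (Nat.lt_succ_self N)).ne
  simp only [Function.comp_apply, dist_eq_norm] at h1
  have h2 : c (φ (N + 1)) • ⟪e (φ (N + 1)), R (e (φ (N + 1))) - R (e (φ N))⟫_ℂ = 1 := by
    have h3 : ⟪e (φ (N + 1)), R (e (φ N))⟫_ℂ = 0 := by
      have h4 : c (φ N) ≠ 0 := fun h0 => by
        have := h (φ N)
        rw [h0, zero_smul] at this
        exact he.ne_zero _ this.symm
      have h5 : R (e (φ N)) = (c (φ N))⁻¹ • e (φ N) := by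
        rw [eq_inv_smul_iff₀ h4]; exact h _
      rw [h5, inner_smul_right, he.2 hne.symm, mul_zero]
    rw [inner_sub_right, h3, sub_zero, smul_eq_mul, ← inner_smul_right, h,
      inner_self_eq_norm_sq_to_K, he.1]
    simp
  have h3 : (1 : ℝ) ≤ r * ‖R (e (φ (N + 1))) - R (e (φ N))‖ := by
    calc (1 : ℝ) = ‖c (φ (N + 1)) • ⟪e (φ (N + 1)), R (e (φ (N + 1))) - R (e (φ N))⟫_ℂ‖ := by
          rw [h2]; simp
      _ = ‖c (φ (N + 1))‖ * ‖⟪e (φ (N + 1)), R (e (φ (N + 1))) - R (e (φ N))⟫_ℂ‖ := norm_smul _ _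
      _ ≤ r * (‖e (φ (N + 1))‖ * ‖R (e (φ (N + 1))) - R (e (φ N))‖) := by
          gcongr
          · exact hcr _
          · exact norm_inner_le_norm _ _
      _ = _ := by rw [he.1, one_mul]
  have h4 := mul_lt_mul_of_pos_left h1 hr
  rw [mul_inv_cancel₀ hr.ne'] at h4
  linarith

end CompactResolvent

section Closure

variable {E 𝓗 : Type*} [NormedAddCommGroup E] [InnerProductSpace ℂ E]
  [NormedAddCommGroup 𝓗] [InnerProductSpace ℂ 𝓗] [CompleteSpace 𝓗]
  {ι : E →ₗᵢ[ℂ] 𝓗} {T : E →ₗ[ℂ] E}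
  (hι : DenseRange ι) (hT : T.IsSymmetric)

include hι hT in
/-- Infinitely many eigenvalues `μ` in a disk would give an orthonormal sequence of eigenvectors, on
which the eigenvalues `(μ² + i)⁻¹` of the compact operator are bounded away from zero. -/
theorem eigenvaluesTendToInfinity_of_compact {R : 𝓗 →L[ℂ] 𝓗}
    (hR : IsInverseSqAddI (asOperator ι T).closure R) (hc : IsCompactOperator R) :
    (asOperator ι T).closure.EigenvaluesTendToInfinity := by
  intro r
  by_contra hinf
  set s := {μ ∈ (asOperator ι T).closure.pointSpectrum | ‖μ‖ ≤ r} with hs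
  let m := Set.Infinite.natEmbedding s hinf
  have hv : ∀ n, ∃ v ∈ (asOperator ι T).closure.eigenspace (m n : ℂ), ‖v‖ = 1 := fun n => by
    obtain ⟨v, hv, hv0⟩ := Submodule.exists_mem_ne_zero_of_ne_bot (m n).2.1
    refine ⟨((‖v‖ : ℂ)⁻¹) • v, Submodule.smul_mem _ _ hv, norm_smul_inv_norm hv0⟩
  choose e he he1 using hv
  refine not_orthonormal_of_compact hc (e := e) (c := fun n => (m n : ℂ) ^ 2 + Complex.I)
    (r := r ^ 2 + 1) ⟨he1, fun i j hij => ?_⟩ (fun n => ?_)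
    fun n => hR.smul_apply_eigenvector (he n)
  · exact inner_eq_zero_of_mem_eigenspace hι hT
      (fun h => hij (m.injective (Subtype.ext h))) (he i) (he j)
  · refine (norm_add_le _ _).trans ?_
    rw [norm_pow, Complex.norm_I]
    have := (m n).2.2
    gcongr

omit [CompleteSpace 𝓗] in
theorem toHilbert_mem_eigenspace {μ : ℂ} {e : E} (he : e ∈ Module.End.eigenspace T μ) :
    ι e ∈ (asOperator ι T).closure.eigenspace μ := by
  rw [LinearPMap.mem_eigenspace_iff]
  have := mem_graph_closure (ι := ι) (T := T) e
  rwa [Module.End.mem_eigenspace_iff.mp he, map_smul] at this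

/-- The span of the eigenvectors of `D` with eigenvalue of absolute value at most `r`. -/
def lowEigenspace (D : 𝓗 →ₗ.[ℂ] 𝓗) (r : ℝ) : Submodule ℂ 𝓗 :=
  ⨆ μ ∈ {μ ∈ D.pointSpectrum | ‖μ‖ ≤ r}, D.eigenspace μ

omit [CompleteSpace 𝓗] in
theorem finiteDimensional_lowEigenspace {D : 𝓗 →ₗ.[ℂ] 𝓗} (h1 : D.EigenvaluesTendToInfinity)
    (h2 : D.HasFiniteMultiplicities) (r : ℝ) : FiniteDimensional ℂ (lowEigenspace D r) := by
  have : Finite {μ ∈ D.pointSpectrum | ‖μ‖ ≤ r} := h1 r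
  rw [lowEigenspace, iSup_subtype']
  have : ∀ μ : {μ ∈ D.pointSpectrum | ‖μ‖ ≤ r}, FiniteDimensional ℂ (D.eigenspace μ) :=
    fun μ => h2 μ μ.2.1
  infer_instance

omit [CompleteSpace 𝓗] in
/-- The statement includes `v = 0`, for which `μ` need not be an eigenvalue. -/
theorem mem_lowEigenspace {D : 𝓗 →ₗ.[ℂ] 𝓗} {r : ℝ} {μ : ℂ} (hμ : ‖μ‖ ≤ r) {v : 𝓗}
    (hv : v ∈ D.eigenspace μ) : v ∈ lowEigenspace D r := by
  rcases eq_or_ne v 0 with rfl | hv0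
  · exact zero_mem _
  · refine Submodule.mem_iSup_of_mem μ (Submodule.mem_iSup_of_mem ⟨?_, hμ⟩ hv)
    exact (Submodule.ne_bot_iff _).mpr ⟨v, hv, hv0⟩

include hι hT in
theorem mem_lowEigenspace_orthogonal {r : ℝ} {μ : ℂ} (hμ : r < ‖μ‖) {v : 𝓗}
    (hv : v ∈ (asOperator ι T).closure.eigenspace μ) :
    v ∈ (lowEigenspace (asOperator ι T).closure r)ᗮ := by
  rw [Submodule.mem_orthogonal]
  intro u hu
  have : lowEigenspace (asOperator ι T).closure r ≤ (Submodule.span ℂ {v})ᗮ := by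
    refine iSup₂_le fun ν hν w hw => ?_
    rw [Submodule.mem_orthogonal_singleton_iff_inner_left]
    refine inner_eq_zero_of_mem_eigenspace hι hT (fun h => ?_) hw hv
    rw [h] at hν
    exact absurd hν.2 (not_le.mpr hμ)
  exact Submodule.mem_orthogonal_singleton_iff_inner_left.mp (this hu)

variable (hfin : T.IsLocallyFinite)
include hι hT hfin

/-- The resolvent is small on the orthogonal complement of the eigenvectors with small
eigenvalue. -/
theorem norm_resolventOp_sub_le {α : ℂ} (hα : α.im ≠ 0) {r : ℝ} (hr : ‖α‖ < r)
    [FiniteDimensional ℂ (lowEigenspace (asOperator ι T).closure r)] (u : 𝓗) :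
    ‖resolventOp ι T α (u - (lowEigenspace (asOperator ι T).closure r).starProjection u)‖
      ≤ (r - ‖α‖)⁻¹ * ‖u‖ := by
  set F := lowEigenspace (asOperator ι T).closure r with hF
  refine hι.induction_on (p := fun u => ‖resolventOp ι T α (u - F.starProjection u)‖
      ≤ (r - ‖α‖)⁻¹ * ‖u‖) u (isClosed_le (by fun_prop) (by fun_prop)) fun e => ?_
  have he : e ∈ ⨆ μ : ℂ, Module.End.eigenspace T μ := by
    rw [hT.iSup_eigenspace_eq_top hfin]; trivial
  obtain ⟨f, hf, rfl⟩ := (Submodule.mem_iSup_iff_exists_finsupp _ _).mp he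
  have horth := hT.orthogonalFamily_eigenspaces
  have hres : ∀ μ, resolventOp ι T α (ι (f μ) - F.starProjection (ι (f μ))) =
      ι ((if ‖μ‖ ≤ r then 0 else (μ - α)⁻¹) • f μ) := by
    intro μ
    split_ifs with hμ
    · have : ι (f μ) ∈ F := mem_lowEigenspace hμ (toHilbert_mem_eigenspace (hf μ))
      rw [Submodule.starProjection_eq_self_iff.mpr this, sub_self, map_zero, zero_smul, map_zero]
    · have h1 : ι (f μ) ∈ Fᗮ :=
        mem_lowEigenspace_orthogonal hι hT (not_le.mp hμ) (toHilbert_mem_eigenspace (hf μ))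
      rw [(Submodule.starProjection_apply_eq_zero_iff F).mpr h1, sub_zero]
      have h2 := resolventOp_apply hι hT hfin hα (f μ)
      rw [Module.End.mem_eigenspace_iff.mp (hf μ), ← sub_smul, map_smul, map_smul] at h2
      have h3 : μ - α ≠ 0 := by
        intro h
        rw [sub_eq_zero] at h
        rw [h] at hμ
        exact hμ hr.le
      rw [map_smul, eq_inv_smul_iff₀ h3]
      exact h2
  have hr' : 0 < r - ‖α‖ := sub_pos.mpr hr
  simp only [Finsupp.sum, map_sum]
  rw [← Finset.sum_sub_distrib, map_sum, Finset.sum_congr rfl fun μ _ => hres μ, ← map_sum,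
    ← map_sum, ι.norm_map, ι.norm_map]
  refine le_of_sq_le_sq ?_ (by positivity)
  have e1 := horth.norm_sum (fun μ => ⟨f μ, hf μ⟩) f.support
  have e2 := horth.norm_sum
    (fun μ => (if ‖μ‖ ≤ r then (0 : ℂ) else (μ - α)⁻¹) • ⟨f μ, hf μ⟩) f.support
  simp only [map_smul] at e2
  simp only [Submodule.coe_subtypeₗᵢ, Submodule.subtype_apply] at e1 e2
  rw [mul_pow, e1, e2, Finset.mul_sum]
  refine Finset.sum_le_sum fun μ _ => ?_
  rw [norm_smul, mul_pow]
  change _ * ‖f μ‖ ^ 2 ≤ _ * ‖f μ‖ ^ 2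
  gcongr
  split_ifs with hμ
  · rw [norm_zero]; positivity
  · rw [norm_inv]
    gcongr
    have := norm_sub_norm_le μ α
    linarith [not_le.mp hμ]

/-- If `D` has discrete spectrum, then its resolvent is the norm limit of its restrictions to the
spans of the eigenvectors with eigenvalue of absolute value at most `n`, which are of finite rank.
-/
theorem isCompactOperator_resolventOp (h1 : (asOperator ι T).closure.EigenvaluesTendToInfinity)
    (h2 : (asOperator ι T).closure.HasFiniteMultiplicities) {α : ℂ} (hα : α.im ≠ 0) :
    IsCompactOperator (resolventOp ι T α) := by
  have hF := finiteDimensional_lowEigenspace h1 h2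
  let P : ℕ → 𝓗 →L[ℂ] 𝓗 := fun n =>
    (lowEigenspace (asOperator ι T).closure n).starProjection
  have hP : ∀ n, IsCompactOperator (P n) := fun n => by
    have hc : IsCompactOperator (lowEigenspace (asOperator ι T).closure n).subtypeL := by
      have := FiniteDimensional.proper ℂ (lowEigenspace (asOperator ι T).closure n)
      exact isCompactOperator_of_locallyCompactSpace_rng _
    exact hc.comp_clm (lowEigenspace (asOperator ι T).closure n).orthogonalProjectionOnto
  refine isCompactOperator_of_tendsto (F := fun n => resolventOp ι T α * P n) (l := Filter.atTop)
    ?_ (Filter.Eventually.of_forall fun n => (hP n).clm_comp (resolventOp ι T α))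
  rw [tendsto_iff_norm_sub_tendsto_zero]
  have hlim : Filter.Tendsto (fun n : ℕ => ((n : ℝ) - ‖α‖)⁻¹) Filter.atTop (nhds 0) :=
    (Filter.tendsto_atTop_add_const_right _ _ tendsto_natCast_atTop_atTop).inv_tendsto_atTop
  refine squeeze_zero' (Filter.Eventually.of_forall fun n => norm_nonneg _) ?_ hlim
  obtain ⟨N, hN⟩ := exists_nat_gt ‖α‖
  filter_upwards [Filter.eventually_ge_atTop N] with n hn
  have hn' : ‖α‖ < n := hN.trans_le (by exact_mod_cast hn)
  refine ContinuousLinearMap.opNorm_le_bound _ (inv_nonneg.mpr (sub_pos.mpr hn').le) fun u => ?_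
  have := norm_resolventOp_sub_le hι hT hfin hα hn' u
  rw [map_sub] at this
  rw [sub_apply, norm_sub_rev]
  exact this

omit [CompleteSpace 𝓗] in
/-- The eigenvectors of `T` span `E`, and there are finitely many up to linear combination for each
bound on the eigenvalue. -/
theorem separableSpace_of_eigenvalues (h1 : (asOperator ι T).closure.EigenvaluesTendToInfinity)
    (h2 : (asOperator ι T).closure.HasFiniteMultiplicities) :
    TopologicalSpace.SeparableSpace 𝓗 := by
  have hF := finiteDimensional_lowEigenspace h1 h2
  have hs : TopologicalSpace.IsSeparable
      (⋃ n : ℕ, (lowEigenspace (asOperator ι T).closure n : Set 𝓗)) :=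
    TopologicalSpace.IsSeparable.iUnion fun n => by
      have : TopologicalSpace.SeparableSpace (lowEigenspace (asOperator ι T).closure n) := by
        have := FiniteDimensional.proper ℂ (lowEigenspace (asOperator ι T).closure n)
        infer_instance
      exact TopologicalSpace.IsSeparable.of_subtype _
  have hd : Dense (⋃ n : ℕ, (lowEigenspace (asOperator ι T).closure n : Set 𝓗)) := by
    refine hι.mono ?_
    rintro _ ⟨e, rfl⟩
    have he : e ∈ ⨆ μ : ℂ, Module.End.eigenspace T μ := by
      rw [hT.iSup_eigenspace_eq_top hfin]; trivial
    obtain ⟨f, hf, rfl⟩ := (Submodule.mem_iSup_iff_exists_finsupp _ _).mp he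
    obtain ⟨n, hn⟩ := exists_nat_ge (∑ μ ∈ f.support, ‖μ‖)
    refine Set.mem_iUnion.mpr ⟨n, ?_⟩
    rw [Finsupp.sum, map_sum]
    refine sum_mem fun μ hμ => mem_lowEigenspace ?_ (toHilbert_mem_eigenspace (hf μ))
    exact (Finset.single_le_sum (f := fun μ : ℂ => ‖μ‖) (fun _ _ => norm_nonneg _) hμ).trans hn
  exact hd.isSeparable_iff.mp hs

/-- The resolvent is compact if and only if the spectrum is discrete. -/
theorem exists_compact_inverse_iff :
    (∃ R : 𝓗 →L[ℂ] 𝓗, IsInverseSqAddI (asOperator ι T).closure R ∧ IsCompactOperator R) ↔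
      (asOperator ι T).closure.EigenvaluesTendToInfinity ∧
        (asOperator ι T).closure.HasFiniteMultiplicities := by
  constructor
  · rintro ⟨R, hR, hc⟩
    exact ⟨eigenvaluesTendToInfinity_of_compact hι hT hR hc, fun μ _ =>
      finiteDimensional_eigenspace_of_compact (isClosed_graph_closure hι hT) hR hc μ⟩
  · rintro ⟨h1, h2⟩
    obtain ⟨α, hα⟩ := IsAlgClosed.exists_pow_nat_eq (-Complex.I) (n := 2) (by norm_num)
    have hα1 : α.im ≠ 0 := fun h => by
      have := congrArg Complex.im hα
      simp [sq, h] at this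
    refine ⟨_, isInverseSqAddI_resolventOp hι hT hfin hα, ?_⟩
    exact (isCompactOperator_resolventOp hι hT hfin h1 h2 (α := -α) (by simpa using hα1)).clm_comp
      (resolventOp ι T α)

end Closure

/-! ### Extension of bounded operators, and spectral triples -/

section Extension

variable {E 𝓗 : Type*} [NormedAddCommGroup E] [InnerProductSpace ℂ E]
  [NormedAddCommGroup 𝓗] [InnerProductSpace ℂ 𝓗] [CompleteSpace 𝓗]
  {ι : E →ₗᵢ[ℂ] 𝓗} {T : E →ₗ[ℂ] E}

/-- A linear map on a pre-Hilbert space is bounded. -/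
def LinearMap.IsBounded (u : E →ₗ[ℂ] E) : Prop := ∃ C : ℝ, ∀ x, ‖u x‖ ≤ C * ‖x‖

/-- The continuous extension of a bounded linear map on a dense subspace. -/
def extendBounded (ι : E →ₗᵢ[ℂ] 𝓗) (u : E →ₗ[ℂ] E) : 𝓗 →L[ℂ] 𝓗 :=
  (ι.toLinearMap ∘ₗ u).extendOfNorm ι.toLinearMap

theorem extendBounded_apply (hι : DenseRange ι) {u : E →ₗ[ℂ] E} (hu : u.IsBounded) (e : E) :
    extendBounded ι u (ι e) = ι (u e) := by
  obtain ⟨C, hC⟩ := hu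
  refine LinearMap.extendOfNorm_eq (f := ι.toLinearMap ∘ₗ u) (e := ι.toLinearMap) hι
    ⟨C, fun x => ?_⟩ e
  simpa using hC x

omit [CompleteSpace 𝓗] in
theorem ext_of_denseRange (hι : DenseRange ι) {U V : 𝓗 →L[ℂ] 𝓗}
    (h : ∀ e, U (ι e) = V (ι e)) : U = V :=
  ContinuousLinearMap.ext fun x => congrFun (hι.equalizer U.continuous V.continuous (funext h)) x

variable {𝒜 : Type*} [Ring 𝒜] [Algebra ℂ 𝒜] [StarRing 𝒜]

/-- The extension to the Hilbert space of a `*`-representation by bounded operators on a dense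
subspace. -/
def extendRep (hι : DenseRange ι) (ρ : 𝒜 →ₐ[ℂ] Module.End ℂ E)
    (hb : ∀ a, LinearMap.IsBounded (ρ a)) (hs : ∀ a x y, ⟪ρ a x, y⟫_ℂ = ⟪x, ρ (star a) y⟫_ℂ) :
    𝒜 →⋆ₐ[ℂ] (𝓗 →L[ℂ] 𝓗) where
  toFun a := extendBounded ι (ρ a)
  map_one' := ext_of_denseRange hι fun e => by
    rw [extendBounded_apply hι (hb 1), map_one]; rfl
  map_mul' a b := ext_of_denseRange hι fun e => by
    rw [mul_apply_eq_comp, extendBounded_apply hι (hb _), extendBounded_apply hι (hb _),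
      extendBounded_apply hι (hb _), map_mul]
    rfl
  map_zero' := ext_of_denseRange hι fun e => by
    rw [extendBounded_apply hι (hb 0), map_zero, LinearMap.zero_apply, map_zero]; rfl
  map_add' a b := ext_of_denseRange hι fun e => by
    rw [add_apply, extendBounded_apply hι (hb _), extendBounded_apply hι (hb _),
      extendBounded_apply hι (hb _), map_add, LinearMap.add_apply, map_add]
  commutes' r := ext_of_denseRange hι fun e => by
    rw [extendBounded_apply hι (hb _), AlgHom.commutes, Module.algebraMap_end_apply, map_smul]
    rfl
  map_star' a := by
    rw [ContinuousLinearMap.star_eq_adjoint, ContinuousLinearMap.eq_adjoint_iff]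
    intro x y
    refine hι.induction_on (p := fun x => ⟪extendBounded ι (ρ (star a)) x, y⟫_ℂ =
      ⟪x, extendBounded ι (ρ a) y⟫_ℂ) x (isClosed_eq (by fun_prop) (by fun_prop)) fun e => ?_
    refine hι.induction_on (p := fun y => ⟪extendBounded ι (ρ (star a)) (ι e), y⟫_ℂ =
      ⟪ι e, extendBounded ι (ρ a) y⟫_ℂ) y (isClosed_eq (by fun_prop) (by fun_prop)) fun e' => ?_
    rw [extendBounded_apply hι (hb _), extendBounded_apply hι (hb _), ι.inner_map_map,
      ι.inner_map_map, hs, star_star]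

theorem extendRep_apply (hι : DenseRange ι) (ρ : 𝒜 →ₐ[ℂ] Module.End ℂ E)
    (hb : ∀ a, LinearMap.IsBounded (ρ a)) (hs : ∀ a x y, ⟪ρ a x, y⟫_ℂ = ⟪x, ρ (star a) y⟫_ℂ)
    (a : 𝒜) (e : E) : extendRep hι ρ hb hs a (ι e) = ι (ρ a e) :=
  extendBounded_apply hι (hb a) e

/-- If `T u = s u T + c` with `u` and `c` bounded, then the extensions of `u` and `c` preserve this
identity on the domain of the closure of `T`. The scalar `s` is `1` for commutators and `-1` for
anticommutators. -/
theorem extendBounded_mem_graph (hι : DenseRange ι) (hT : T.IsSymmetric) {u c : E →ₗ[ℂ] E}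
    (hu : u.IsBounded) (hc : c.IsBounded) {s : ℂ} (h : ∀ e, T (u e) = s • u (T e) + c e)
    {p : 𝓗 × 𝓗} (hp : p ∈ (asOperator ι T).closure.graph) :
    (extendBounded ι u p.1, s • extendBounded ι u p.2 + extendBounded ι c p.1) ∈
      (asOperator ι T).closure.graph := by
  refine graph_closure_induction (P := {p : 𝓗 × 𝓗 |
    (extendBounded ι u p.1, s • extendBounded ι u p.2 + extendBounded ι c p.1) ∈
      (asOperator ι T).closure.graph}) hι hT ?_ (fun e => ?_) hp
  · exact (isClosed_graph_closure hι hT).preimage (f := fun p : 𝓗 × 𝓗 =>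
      (extendBounded ι u p.1, s • extendBounded ι u p.2 + extendBounded ι c p.1)) (by fun_prop)
  · have := mem_graph_closure (ι := ι) (T := T) (u e)
    rw [h, map_add, map_smul] at this
    simpa only [Set.mem_ofPred_eq, extendBounded_apply hι hu, extendBounded_apply hι hc] using this

omit [CompleteSpace 𝓗] in
theorem LinearPMap.mem_domain_and_eq_of_mem_graph {D : 𝓗 →ₗ.[ℂ] 𝓗} {x y : 𝓗}
    (h : (x, y) ∈ D.graph) : ∃ hx : x ∈ D.domain, D ⟨x, hx⟩ = y := by
  obtain ⟨⟨z, hz⟩, rfl, hz'⟩ := (LinearPMap.mem_graph_iff _).mp h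
  exact ⟨hz, hz'⟩

/-- A symmetric, locally finite operator on a dense subspace defines an even spectral triple, for a
`*`-representation with bounded commutators, if and only if its closure has discrete spectrum. -/
theorem isEvenSpectralTriple_extend_iff (hι : DenseRange ι) (hT : T.IsSymmetric)
    (hfin : T.IsLocallyFinite) (ρ : 𝒜 →ₐ[ℂ] Module.End ℂ E)
    (hb : ∀ a, LinearMap.IsBounded (ρ a)) (hs : ∀ a x y, ⟪ρ a x, y⟫_ℂ = ⟪x, ρ (star a) y⟫_ℂ)
    (hinj : Function.Injective ρ)
    (hcomm : ∀ a, LinearMap.IsBounded (T ∘ₗ ρ a - ρ a ∘ₗ T))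
    {γ : E →ₗ[ℂ] E} (hγ : γ.IsBounded) (hγs : γ.IsSymmetric) (hγ2 : ∀ x, γ (γ x) = x)
    (hγρ : ∀ a x, γ (ρ a x) = ρ a (γ x)) (hγT : ∀ x, T (γ x) = -γ (T x)) :
    IsEvenSpectralTriple (extendRep hι ρ hb hs) (asOperator ι T).closure (extendBounded ι γ) ↔
      (asOperator ι T).closure.EigenvaluesTendToInfinity ∧
        (asOperator ι T).closure.HasFiniteMultiplicities := by
  have hiff := exists_compact_inverse_iff hι hT hfin
  have hρ : ∀ a, ∀ p ∈ (asOperator ι T).closure.graph,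
      (extendRep hι ρ hb hs a p.1, extendRep hι ρ hb hs a p.2 +
        extendBounded ι (T ∘ₗ ρ a - ρ a ∘ₗ T) p.1) ∈ (asOperator ι T).closure.graph := by
    intro a p hp
    have := extendBounded_mem_graph hι hT (hb a) (hcomm a) (s := 1)
      (fun e => by simp) hp
    rwa [one_smul] at this
  have hγg : ∀ p ∈ (asOperator ι T).closure.graph,
      (extendBounded ι γ p.1, -extendBounded ι γ p.2) ∈ (asOperator ι T).closure.graph := by
    intro p hp
    have h0 : (0 : E →ₗ[ℂ] E).IsBounded := ⟨0, by simp⟩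
    have := extendBounded_mem_graph hι hT hγ h0 (s := -1)
      (fun e => by simp [hγT]) hp
    have h1 : extendBounded ι (0 : E →ₗ[ℂ] E) = 0 := ext_of_denseRange hι fun e => by
      rw [extendBounded_apply hι h0]; simp
    rwa [h1, zero_apply, add_zero, neg_one_smul] at this
  constructor
  · exact fun h => hiff.mp h.compact_resolvent
  · intro h
    refine
      { separable := separableSpace_of_eigenvalues hι hT hfin h.1 h.2
        faithful := ?_
        dense_domain := dense_domain_closure hι
        selfAdjoint := isSelfAdjoint_closure hι hT hfin
        map_domain := ?_
        bounded_commutator := ?_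
        compact_resolvent := hiff.mpr h
        γ_selfAdjoint := ?_
        γ_sq := ?_
        γ_commute := ?_
        γ_domain := ?_
        γ_anticommute := ?_ }
    · intro a b hab
      refine hinj (LinearMap.ext fun e => ι.injective ?_)
      rw [← extendRep_apply hι ρ hb hs, ← extendRep_apply hι ρ hb hs, hab]
    · intro a x hx
      exact (LinearPMap.mem_domain_and_eq_of_mem_graph
        (hρ a _ (LinearPMap.mem_graph _ ⟨x, hx⟩))).1
    · intro a
      refine ⟨‖extendBounded ι (T ∘ₗ ρ a - ρ a ∘ₗ T)‖, fun x y hy => ?_⟩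
      obtain ⟨hx, hx'⟩ := LinearPMap.mem_domain_and_eq_of_mem_graph
        (hρ a _ (LinearPMap.mem_graph _ x))
      obtain rfl : y = ⟨_, hx⟩ := Subtype.ext hy
      rw [hx', add_sub_cancel_left]
      exact ContinuousLinearMap.le_opNorm _ _
    · rw [ContinuousLinearMap.isSelfAdjoint_iff_isSymmetric]
      intro x y
      refine hι.induction_on (p := fun x => ⟪extendBounded ι γ x, y⟫_ℂ =
        ⟪x, extendBounded ι γ y⟫_ℂ) x (isClosed_eq (by fun_prop) (by fun_prop)) fun e => ?_
      refine hι.induction_on (p := fun y => ⟪extendBounded ι γ (ι e), y⟫_ℂ =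
        ⟪ι e, extendBounded ι γ y⟫_ℂ) y (isClosed_eq (by fun_prop) (by fun_prop)) fun e' => ?_
      rw [extendBounded_apply hι hγ, extendBounded_apply hι hγ, ι.inner_map_map,
        ι.inner_map_map]
      exact hγs _ _
    · refine ext_of_denseRange hι fun e => ?_
      rw [mul_apply_eq_comp, extendBounded_apply hι hγ, extendBounded_apply hι hγ, hγ2]
      rfl
    · intro a
      refine ext_of_denseRange hι fun e => ?_
      rw [mul_apply_eq_comp, mul_apply_eq_comp, extendBounded_apply hι hγ, extendRep_apply,
        extendRep_apply, extendBounded_apply hι hγ, hγρ]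
    · intro x hx
      exact (LinearPMap.mem_domain_and_eq_of_mem_graph
        (hγg _ (LinearPMap.mem_graph _ ⟨x, hx⟩))).1
    · intro x y hy
      obtain ⟨hx, hx'⟩ := LinearPMap.mem_domain_and_eq_of_mem_graph
        (hγg _ (LinearPMap.mem_graph _ x))
      obtain rfl : y = ⟨_, hx⟩ := Subtype.ext hy
      exact hx'

end Extension

/-! ### Operators defined by the bidegree -/

namespace ComplexStructure

variable {B Ω : Type*} [Ring B] [Algebra ℂ B] [StarRing B] [Ring Ω] [Algebra ℂ Ω]
  {C : StarCalculus B Ω} (J : ComplexStructure C)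

theorem hom_ext {M : Type*} [AddCommMonoid M] {f g : Ω → M}
    (hf : ∀ x y, f (x + y) = f x + f y) (hg : ∀ x y, g (x + y) = g x + g y)
    (hf0 : f 0 = 0) (hg0 : g 0 = 0)
    (h : ∀ p, ∀ ω ∈ J.bideg p, f ω = g ω) (ω : Ω) : f ω = g ω := by
  induction ω using DirectSum.Decomposition.inductionOn J.bideg with
  | zero => rw [hf0, hg0]
  | homogeneous ω => exact h _ _ ω.2
  | add x y hx hy => rw [hf, hg, hx, hy]

theorem linearMap_ext {M : Type*} [AddCommMonoid M] [Module ℂ M] {f g : Ω →ₗ[ℂ] M}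
    (h : ∀ p, ∀ ω ∈ J.bideg p, f ω = g ω) (ω : Ω) : f ω = g ω :=
  J.hom_ext (map_add f) (map_add g) (map_zero f) (map_zero g) h ω

theorem biproj_mem (p : ℕ × ℕ) (ω : Ω) : J.biproj p ω ∈ J.bideg p := SetLike.coe_mem _

theorem biproj_of_mem_same {p : ℕ × ℕ} {ω : Ω} (h : ω ∈ J.bideg p) : J.biproj p ω = ω :=
  DirectSum.decompose_of_mem_same J.bideg h

theorem biproj_of_mem_ne {p q : ℕ × ℕ} {ω : Ω} (h : ω ∈ J.bideg p) (hpq : p ≠ q) :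
    J.biproj q ω = 0 :=
  DirectSum.decompose_of_mem_ne J.bideg h hpq

theorem bideg_le_deg (p : ℕ × ℕ) : J.bideg p ≤ C.deg (p.1 + p.2) := by
  rw [J.deg_eq]
  exact le_iSup (fun q : {q : ℕ × ℕ // q.1 + q.2 = p.1 + p.2} => J.bideg q) ⟨p, rfl⟩

theorem dbar_of_mem {p : ℕ × ℕ} {ω : Ω} (h : ω ∈ J.bideg p) :
    J.dbar ω = J.biproj (p.1, p.2 + 1) (C.d ω) := by
  simp only [dbar, LinearMap.comp_apply, LinearEquiv.coe_coe, DirectSum.decomposeLinearEquiv_apply]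
  rw [DirectSum.decompose_of_mem _ h, ← DirectSum.lof_eq_of ℂ, DirectSum.toModule_lof]
  rfl

theorem dbar_mem {p : ℕ × ℕ} {ω : Ω} (h : ω ∈ J.bideg p) :
    J.dbar ω ∈ J.bideg (p.1, p.2 + 1) := by
  rw [J.dbar_of_mem h]; exact J.biproj_mem _ _

/-- The operator acting on the forms of bidegree `p` as multiplication by the scalar `c p`. -/
def diag (c : ℕ × ℕ → ℂ) : Ω →ₗ[ℂ] Ω :=
  DirectSum.toModule ℂ (ℕ × ℕ) Ω (fun p => c p • (J.bideg p).subtype) ∘ₗ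
    (DirectSum.decomposeLinearEquiv J.bideg).toLinearMap

theorem diag_of_mem (c : ℕ × ℕ → ℂ) {p : ℕ × ℕ} {ω : Ω} (h : ω ∈ J.bideg p) :
    J.diag c ω = c p • ω := by
  simp only [diag, LinearMap.comp_apply, LinearEquiv.coe_coe, DirectSum.decomposeLinearEquiv_apply]
  rw [DirectSum.decompose_of_mem _ h, ← DirectSum.lof_eq_of ℂ, DirectSum.toModule_lof]
  rfl

theorem diag_diag (c c' : ℕ × ℕ → ℂ) (ω : Ω) :
    J.diag c (J.diag c' ω) = J.diag (fun p => c p * c' p) ω :=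
  J.linearMap_ext (f := J.diag c ∘ₗ J.diag c') (fun p ω h => by
    rw [LinearMap.comp_apply, J.diag_of_mem _ h, map_smul, J.diag_of_mem _ h, J.diag_of_mem _ h,
      smul_smul, mul_comm]) ω

theorem diag_one (ω : Ω) : J.diag (fun _ => 1) ω = ω :=
  J.linearMap_ext (g := LinearMap.id) (fun p ω h => by
    rw [J.diag_of_mem _ h, one_smul, LinearMap.id_apply]) ω

theorem proj_eq_diag (k : ℕ) (ω : Ω) :
    C.proj k ω = J.diag (fun p => if p.1 + p.2 = k then 1 else 0) ω := by
  refine J.linearMap_ext (fun p ω h => ?_) ω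
  rw [J.diag_of_mem _ h]
  have h' := J.bideg_le_deg p h
  split_ifs with hk
  · rw [one_smul]
    subst hk
    exact DirectSum.decompose_of_mem_same C.deg h'
  · rw [zero_smul]
    exact DirectSum.decompose_of_mem_ne C.deg h' hk

theorem map_diag {X : Ω →ₗ[ℂ] Ω} (hX : ∀ p, ∀ ω ∈ J.bideg p, X ω ∈ J.bideg p) (c : ℕ × ℕ → ℂ)
    (ω : Ω) : X (J.diag c ω) = J.diag c (X ω) :=
  J.linearMap_ext (f := X ∘ₗ J.diag c) (g := J.diag c ∘ₗ X) (fun p ω h => by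
    rw [LinearMap.comp_apply, LinearMap.comp_apply, J.diag_of_mem _ h, J.diag_of_mem _ (hX p ω h),
      map_smul]) ω

theorem biproj_eq_diag (q : ℕ × ℕ) (ω : Ω) :
    J.biproj q ω = J.diag (fun p => if p = q then 1 else 0) ω := by
  refine J.linearMap_ext (fun p ω h => ?_) ω
  rw [J.diag_of_mem _ h]
  split_ifs with hk
  · rw [one_smul]
    subst hk
    exact J.biproj_of_mem_same h
  · rw [zero_smul]
    exact J.biproj_of_mem_ne h hk

theorem map_dbar {X : Ω →ₗ[ℂ] Ω} (hX : ∀ p, ∀ ω ∈ J.bideg p, X ω ∈ J.bideg p)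
    (hd : ∀ ω, X (C.d ω) = C.d (X ω)) (ω : Ω) : X (J.dbar ω) = J.dbar (X ω) :=
  J.linearMap_ext (f := X ∘ₗ J.dbar) (g := J.dbar ∘ₗ X) (fun p ω h => by
    rw [LinearMap.comp_apply, LinearMap.comp_apply, J.dbar_of_mem h, J.dbar_of_mem (hX p ω h),
      biproj_eq_diag, J.map_diag hX, hd, biproj_eq_diag]) ω

/-- Since `∂̄` has bidegree `(0, 1)`, it intertwines diagonal operators whose scalars are shifted.
-/
theorem dbar_diag {c c' : ℕ × ℕ → ℂ} (h : ∀ a b, c' (a, b + 1) = c (a, b)) (ω : Ω) :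
    J.dbar (J.diag c ω) = J.diag c' (J.dbar ω) :=
  J.linearMap_ext (f := J.dbar ∘ₗ J.diag c) (g := J.diag c' ∘ₗ J.dbar) (fun p ω hω => by
    rw [LinearMap.comp_apply, LinearMap.comp_apply, J.diag_of_mem _ hω, map_smul,
      J.diag_of_mem _ (J.dbar_mem hω), h]) ω

/-- The weight `a - b` of a bidegree `(a, b)`. -/
def weight (p : ℕ × ℕ) : ℂ := (p.1 : ℂ) - p.2

/-- The operator acting by the weight is a derivation. -/
theorem diag_weight_mul (ω ν : Ω) :
    J.diag weight (ω * ν) = J.diag weight ω * ν + ω * J.diag weight ν := by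
  refine J.hom_ext (f := fun ω => J.diag weight (ω * ν))
    (g := fun ω => J.diag weight ω * ν + ω * J.diag weight ν)
    (by simp [add_mul]) (fun x y => ?_) (by simp) (by simp) (fun p ω h => ?_) ω
  · simp only [map_add, add_mul]; abel
  refine J.hom_ext (f := fun ν => J.diag weight (ω * ν))
    (g := fun ν => J.diag weight ω * ν + ω * J.diag weight ν)
    (by simp [mul_add]) (fun x y => ?_) (by simp) (by simp) (fun q ν h' => ?_) ν
  · simp only [map_add, mul_add]; abel
  rw [J.diag_of_mem _ h, J.diag_of_mem _ h', J.diag_of_mem _ (SetLike.mul_mem_graded h h')]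
  simp only [weight, Prod.fst_add, Prod.snd_add, Nat.cast_add, smul_mul_assoc, mul_smul_comm,
    ← add_smul]
  congr 1
  ring

/-- The operator acting by `(-1)^k` on the forms of degree `k`. -/
def parity : Ω →ₗ[ℂ] Ω := J.diag fun p => (-1) ^ (p.1 + p.2)

/-- The projection onto the anti-holomorphic forms, as an operator on all forms. -/
def antiProj : Ω →ₗ[ℂ] Ω := J.diag fun p => if p.1 = 0 then 1 else 0

theorem biproj_mul {p q r : ℕ × ℕ} {ω : Ω} (h : ω ∈ J.bideg p) (ν : Ω) (hr : r = p + q) :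
    J.biproj r (ω * ν) = ω * J.biproj q ν := by
  refine J.hom_ext (f := fun ν => J.biproj r (ω * ν)) (g := fun ν => ω * J.biproj q ν)
    (by simp [mul_add]) (by simp [mul_add]) (by simp) (by simp) (fun q' ν h' => ?_) ν
  have hm : ω * ν ∈ J.bideg (p + q') := SetLike.mul_mem_graded h h'
  by_cases hq : q' = q
  · subst hq
    rw [J.biproj_of_mem_same h', J.biproj_of_mem_same (hr ▸ hm)]
  · rw [J.biproj_of_mem_ne h' hq, J.biproj_of_mem_ne hm, mul_zero]
    rw [hr]
    exact fun hh => hq (add_left_cancel hh)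

theorem biproj_mul' {p q r : ℕ × ℕ} {ν : Ω} (h : ν ∈ J.bideg q) (ω : Ω) (hr : r = p + q) :
    J.biproj r (ω * ν) = J.biproj p ω * ν := by
  refine J.hom_ext (f := fun ω => J.biproj r (ω * ν)) (g := fun ω => J.biproj p ω * ν)
    (by simp [add_mul]) (by simp [add_mul]) (by simp) (by simp) (fun q' ω h' => ?_) ω
  have hm : ω * ν ∈ J.bideg (q' + q) := SetLike.mul_mem_graded h' h
  by_cases hq : q' = p
  · subst hq
    rw [J.biproj_of_mem_same h', J.biproj_of_mem_same (hr ▸ hm)]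
  · rw [J.biproj_of_mem_ne h' hq, J.biproj_of_mem_ne hm, zero_mul]
    rw [hr]
    exact fun hh => hq (add_right_cancel hh)

/-- The graded Leibniz rule for `∂̄`, from the one for `d` by comparison of bidegrees. -/
theorem dbar_mul_incl (ω : Ω) (b : B) :
    J.dbar (ω * C.incl b) = J.dbar ω * C.incl b + J.parity ω * J.dbar (C.incl b) := by
  refine J.hom_ext (f := fun ω => J.dbar (ω * C.incl b))
    (g := fun ω => J.dbar ω * C.incl b + J.parity ω * J.dbar (C.incl b))
    (by simp [add_mul]) (fun x y => ?_) (by simp) (by simp) (fun p ω h => ?_) ω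
  · simp only [map_add, add_mul]; abel
  have hb := J.incl_mem_bideg b
  have hm : ω * C.incl b ∈ J.bideg p := by
    have := SetLike.mul_mem_graded h hb
    rwa [show p + (0, 0) = p from add_zero p] at this
  rw [J.dbar_of_mem hm, J.dbar_of_mem h, J.dbar_of_mem hb, parity, J.diag_of_mem _ h,
    C.leibniz _ ω (J.bideg_le_deg p h), map_add, map_smul, smul_mul_assoc,
    J.biproj_mul' (p := (p.1, p.2 + 1)) hb _ (add_zero _).symm,
    J.biproj_mul (q := (0, 1)) (r := (p.1, p.2 + 1)) h _ rfl]

theorem antiProj_mem (ω : Ω) : J.antiProj ω ∈ J.antiholomorphic := by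
  induction ω using DirectSum.Decomposition.inductionOn J.bideg with
  | zero => rw [map_zero]; exact zero_mem _
  | @homogeneous p ω =>
    rw [antiProj, J.diag_of_mem _ ω.2]
    split_ifs with hp
    · rw [one_smul]
      have : (ω : Ω) ∈ J.bideg (0, p.2) := by rw [← hp]; exact ω.2
      exact Submodule.mem_iSup_of_mem p.2 this
    · rw [zero_smul]; exact zero_mem _
  | add x y hx hy => rw [map_add]; exact add_mem hx hy

theorem antiProj_of_mem {ω : Ω} (h : ω ∈ J.antiholomorphic) : J.antiProj ω = ω := by
  unfold antiholomorphic at h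
  induction h using Submodule.iSup_induction' with
  | mem b ω hω => rw [antiProj, J.diag_of_mem _ hω]; simp
  | zero => exact map_zero _
  | add x y _ _ hx hy => rw [map_add, hx, hy]

theorem mem_antiholomorphic_iff {ω : Ω} : ω ∈ J.antiholomorphic ↔ J.antiProj ω = ω :=
  ⟨J.antiProj_of_mem, fun h => h ▸ J.antiProj_mem ω⟩

theorem parity_parity (ω : Ω) : J.parity (J.parity ω) = ω := by
  rw [parity, J.diag_diag]
  simp only [← mul_pow, mul_neg, neg_neg, mul_one, one_pow]
  exact J.diag_one ω

theorem dbar_parity (ω : Ω) : J.dbar (J.parity ω) = -J.parity (J.dbar ω) := by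
  have h1 := J.dbar_diag (c := fun p => (-1) ^ (p.1 + p.2))
    (c' := fun p => (-1) * (-1) ^ (p.1 + p.2)) (fun a b => by
      simp only [← add_assoc, pow_succ]; ring) ω
  have h2 := J.diag_diag (fun _ => -1) (fun p => (-1) ^ (p.1 + p.2)) (J.dbar ω)
  have h3 : ∀ ν, J.diag (fun _ => -1) ν = -ν := fun ν =>
    J.linearMap_ext (g := -LinearMap.id) (fun p ν h => by rw [J.diag_of_mem _ h]; simp) ν
  rw [parity, h1, ← h2, h3]

theorem dbar_antiProj (ω : Ω) : J.dbar (J.antiProj ω) = J.antiProj (J.dbar ω) :=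
  J.dbar_diag (fun _ _ => rfl) ω

theorem parity_antiProj (ω : Ω) : J.parity (J.antiProj ω) = J.antiProj (J.parity ω) := by
  rw [parity, antiProj, J.diag_diag, J.diag_diag]
  simp only [mul_comm]

theorem parity_of_mem_deg {k : ℕ} {ω : Ω} (h : ω ∈ C.deg k) : J.parity ω = (-1 : ℂ) ^ k • ω := by
  rw [J.deg_eq] at h
  induction h using Submodule.iSup_induction' with
  | mem p ω hω => rw [parity, J.diag_of_mem _ hω, p.2]
  | zero => simp
  | add x y _ _ hx hy => rw [map_add, smul_add, hx, hy]

theorem parity_mul_incl (ω : Ω) (b : B) :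
    J.parity (ω * C.incl b) = J.parity ω * C.incl b :=
  (J.map_diag (X := LinearMap.mulRight ℂ (C.incl b)) (fun p ω h => by
    have := SetLike.mul_mem_graded h (J.incl_mem_bideg b)
    rwa [show p + (0, 0) = p from add_zero p] at this) _ ω).symm

theorem coe_projAntiholomorphic (ω : Ω) : (J.projAntiholomorphic ω : Ω) = J.antiProj ω := by
  refine J.linearMap_ext (f := J.antiholomorphic.subtype ∘ₗ J.projAntiholomorphic)
    (g := J.antiProj) (fun p ω h => ?_) ω
  simp only [projAntiholomorphic, LinearMap.comp_apply, LinearEquiv.coe_coe,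
    DirectSum.decomposeLinearEquiv_apply]
  rw [DirectSum.decompose_of_mem _ h, ← DirectSum.lof_eq_of ℂ, DirectSum.toModule_lof, antiProj,
    J.diag_of_mem _ h]
  split_ifs with hp
  · rw [one_smul]; rfl
  · rw [zero_smul]; rfl

end ComplexStructure

/-! ### The Lefschetz decomposition and the Hodge map -/

namespace HermitianStructure

variable {B Ω : Type*} [Ring B] [Algebra ℂ B] [StarRing B] [Ring Ω] [Algebra ℂ Ω]
  {C : StarCalculus B Ω} (J : HermitianStructure C)

theorem L_apply (ω : Ω) : J.L ω = J.σ * ω := rfl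

theorem L_pow_mem_deg {k : ℕ} {ω : Ω} (h : ω ∈ C.deg k) (j : ℕ) :
    (J.L ^ j) ω ∈ C.deg (k + 2 * j) := by
  induction j with
  | zero => simpa using h
  | succ j ih =>
    rw [pow_succ', Module.End.mul_apply, L_apply]
    have := SetLike.mul_mem_graded (J.bideg_le_deg _ J.σ_mem) ih
    convert this using 2
    simp; ring

theorem L_pow_biproj (j : ℕ) (p : ℕ × ℕ) (ω : Ω) :
    (J.L ^ j) (J.biproj p ω) = J.biproj (p + (j, j)) ((J.L ^ j) ω) := by
  induction j with
  | zero => simp [show ((0, 0) : ℕ × ℕ) = 0 from rfl]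
  | succ j ih =>
    rw [pow_succ', Module.End.mul_apply, Module.End.mul_apply, ih, L_apply, L_apply,
      J.biproj_mul J.σ_mem]
    ext <;> simp <;> ring

theorem map_L_pow {X : Ω →ₗ[ℂ] Ω} (hX : ∀ ω, X (J.σ * ω) = J.σ * X ω) (j : ℕ) (ω : Ω) :
    X ((J.L ^ j) ω) = (J.L ^ j) (X ω) := by
  induction j with
  | zero => rfl
  | succ j ih =>
    rw [pow_succ', Module.End.mul_apply, Module.End.mul_apply, L_apply, L_apply, hX, ih]

theorem IsPrimitive.map {X : Ω →ₗ[ℂ] Ω} (hb : ∀ p, ∀ ω ∈ J.bideg p, X ω ∈ J.bideg p)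
    (hX : ∀ ω, X (J.σ * ω) = J.σ * X ω) {a b : ℕ} {ω : Ω} (h : J.IsPrimitive a b ω) :
    J.IsPrimitive a b (X ω) := by
  refine ⟨hb _ _ h.1, ?_⟩
  have h2 := h.2
  split_ifs with hab
  · rw [if_pos hab] at h2
    rw [← J.map_L_pow hX, h2, map_zero]
  · rw [if_neg hab] at h2
    rw [h2, map_zero]

/-- The span of the forms `L^j ω` with `ω` primitive. -/
def lefschetzSpan : Submodule ℂ Ω :=
  Submodule.span ℂ {x | ∃ a b j ω, j + (a + b) ≤ J.n ∧ J.IsPrimitive a b ω ∧ (J.L ^ j) ω = x}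

theorem L_mem_lefschetzSpan {ω : Ω} (h : ω ∈ J.lefschetzSpan) : J.L ω ∈ J.lefschetzSpan := by
  unfold lefschetzSpan at h
  induction h using Submodule.span_induction with
  | mem x hx =>
    obtain ⟨a, b, j, ω, hj, hω, rfl⟩ := hx
    rw [← Module.End.mul_apply, ← pow_succ']
    by_cases hj' : j + 1 + (a + b) ≤ J.n
    · exact Submodule.subset_span ⟨a, b, j + 1, ω, hj', hω, rfl⟩
    · have h2 := hω.2
      rw [if_pos (by omega), show J.n - (a + b) + 1 = j + 1 by omega] at h2
      rw [h2]; exact zero_mem _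
  | zero => rw [map_zero]; exact zero_mem _
  | add x y _ _ hx hy => rw [map_add]; exact add_mem hx hy
  | smul c x _ hx => rw [map_smul]; exact Submodule.smul_mem _ _ hx

theorem L_pow_mem_lefschetzSpan {ω : Ω} (h : ω ∈ J.lefschetzSpan) (j : ℕ) :
    (J.L ^ j) ω ∈ J.lefschetzSpan := by
  induction j with
  | zero => exact h
  | succ j ih => rw [pow_succ', Module.End.mul_apply]; exact J.L_mem_lefschetzSpan ih

/-- The components of a primitive form with respect to the bidegree are primitive, because `L` is
homogeneous. -/
theorem primitive_mem_lefschetzSpan {k : ℕ} (hk : k ≤ J.n) {ω : Ω} (hω : ω ∈ C.deg k)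
    (h : (J.L ^ (J.n - k + 1)) ω = 0) : ω ∈ J.lefschetzSpan := by
  classical
  rw [← DirectSum.sum_support_decompose J.bideg ω]
  refine sum_mem fun p _ => ?_
  change J.biproj p ω ∈ _
  by_cases hp : p.1 + p.2 = k
  · refine Submodule.subset_span ⟨p.1, p.2, 0, J.biproj p ω, by omega, ⟨J.biproj_mem p ω, ?_⟩, rfl⟩
    rw [if_pos (by omega), hp, J.L_pow_biproj, h, map_zero]
  · have h1 : C.proj k ω = ω := DirectSum.decompose_of_mem_same C.deg hω
    rw [← h1, J.proj_eq_diag, J.biproj_eq_diag, J.diag_diag]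
    have : (fun q : ℕ × ℕ => (if q = p then (1 : ℂ) else 0) * if q.1 + q.2 = k then 1 else 0) =
        fun _ => 0 := by
      ext q
      split_ifs with h1 h2
      · rw [h1] at h2; exact absurd h2 hp
      all_goals simp
    rw [this]
    have : J.diag (fun _ => 0) ω = 0 := J.linearMap_ext (g := 0) (fun p ω h => by
      rw [J.diag_of_mem _ h, zero_smul, LinearMap.zero_apply]) ω
    rw [this]; exact zero_mem _

/-- The induction step subtracts from a form `ω` of degree `k` a form `L α`, with `α` of degree `k -
2`, so that the difference is primitive. -/
theorem deg_le_lefschetzSpan_of_le (k : ℕ) (hk : k ≤ J.n) : C.deg k ≤ J.lefschetzSpan := by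
  induction k using Nat.strong_induction_on with
  | _ k ih =>
    intro ω hω
    by_cases hk2 : k < 2
    · refine J.primitive_mem_lefschetzSpan hk hω ?_
      have := J.L_pow_mem_deg hω (J.n - k + 1)
      rwa [J.deg_eq_bot _ (by omega), Submodule.mem_bot] at this
    · have hm : (J.L ^ (J.n - k + 1)) ω ∈ C.deg (2 * J.n - (k - 2)) := by
        have := J.L_pow_mem_deg hω (J.n - k + 1)
        rwa [show k + 2 * (J.n - k + 1) = 2 * J.n - (k - 2) by omega] at this
      obtain ⟨α, hα, hα'⟩ := (J.lefschetz (k - 2) (by omega)).surjOn hm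
      have h1 : α ∈ J.lefschetzSpan := ih (k - 2) (by omega) (by omega) hα
      have hLα : J.L α ∈ C.deg k := by
        have := J.L_pow_mem_deg hα 1
        rwa [pow_one, show k - 2 + 2 * 1 = k by omega] at this
      -- By the choice of `α` one has `L ^ (n - k + 1) ω = L ^ (n - k + 2) α`.
      have h2 : ω - J.L α ∈ J.lefschetzSpan := by
        refine J.primitive_mem_lefschetzSpan hk (sub_mem hω hLα) ?_
        rw [map_sub, ← Module.End.mul_apply, ← pow_succ, ← hα', sub_eq_zero,
          show J.n - (k - 2) = J.n - k + 1 + 1 by omega]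
        rfl
      have := add_mem h2 (J.L_mem_lefschetzSpan h1)
      rwa [sub_add_cancel] at this

/-- The Lefschetz decomposition: the forms `L^j ω` with `ω` primitive span all forms. -/
theorem lefschetzSpan_eq_top : J.lefschetzSpan = ⊤ := by
  refine eq_top_iff.mpr fun ω _ => ?_
  induction ω using DirectSum.Decomposition.inductionOn C.deg with
  | zero => exact zero_mem _
  | @homogeneous k ω =>
    obtain ⟨ω, hω⟩ := ω
    change ω ∈ _
    by_cases hk : k ≤ J.n
    · exact J.deg_le_lefschetzSpan_of_le k hk hω
    · by_cases hk2 : k ≤ 2 * J.n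
      · rw [show k = 2 * J.n - (2 * J.n - k) by omega] at hω
        obtain ⟨β, hβ, hβ'⟩ := (J.lefschetz (2 * J.n - k) (by omega)).surjOn hω
        rw [← hβ']
        exact J.L_pow_mem_lefschetzSpan (J.deg_le_lefschetzSpan_of_le _ (by omega) hβ) _
      · rw [J.deg_eq_bot _ (not_le.mp hk2), Submodule.mem_bot] at hω
        rw [hω]; exact zero_mem _
  | add x y hx hy => exact add_mem (hx trivial) (hy trivial)

/-- Positivity of the metric excludes the junk value of the Hodge map. -/
theorem isHodgeMap_hodge (hpos : J.IsPositive) : J.IsHodgeMap J.hodge := by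
  by_cases h : ∃ s, J.IsHodgeMap s
  · rw [hodge, dif_pos h]; exact h.choose_spec
  · exfalso
    obtain ⟨ω, -, hω⟩ := Submodule.exists_mem_ne_zero_of_ne_bot J.deg_top
    obtain ⟨b, -, hb, h1⟩ := hpos ω hω
    have : J.hodge = 0 := by rw [hodge, dif_neg h]
    simp only [metric, this, LinearMap.zero_apply, Finset.sum_const_zero] at h1
    exact hb (C.incl_injective (by rw [← h1, map_zero]))

/-- A linear map commutes with the Hodge map if it preserves the bidegree and commutes with the
Lefschetz operator. -/
theorem map_hodge (hpos : J.IsPositive) {X : Ω →ₗ[ℂ] Ω}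
    (hb : ∀ p, ∀ ω ∈ J.bideg p, X ω ∈ J.bideg p)
    (hX : ∀ ω, X (J.σ * ω) = J.σ * X ω) (ω : Ω) : X (J.hodge ω) = J.hodge (X ω) := by
  have hH := J.isHodgeMap_hodge hpos
  have h : ω ∈ J.lefschetzSpan := by rw [J.lefschetzSpan_eq_top]; trivial
  unfold lefschetzSpan at h
  induction h using Submodule.span_induction with
  | mem x hx =>
    obtain ⟨a, b, j, ω, hj, hω, rfl⟩ := hx
    rw [hH a b j hj ω hω, map_smul, J.map_L_pow hX, J.map_L_pow hX,
      hH a b j hj _ (IsPrimitive.map J hb hX hω)]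
  | zero => simp
  | add x y _ _ hx hy => simp only [map_add, hx, hy]
  | smul c x _ hx => simp only [map_smul, hx]

variable (hpos : J.IsPositive)
include hpos

theorem hodge_incl_mul (b : B) (ω : Ω) : J.hodge (C.incl b * ω) = C.incl b * J.hodge ω := by
  refine (J.map_hodge hpos (X := LinearMap.mulLeft ℂ (C.incl b)) (fun p ω h => ?_)
    (fun ω => ?_) ω).symm
  · have := SetLike.mul_mem_graded (J.incl_mem_bideg b) h
    rwa [show (0, 0) + p = p from zero_add p] at this
  · simp only [LinearMap.mulLeft_apply, ← mul_assoc, J.σ_central]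

theorem hodge_mul_incl (ω : Ω) (b : B) : J.hodge (ω * C.incl b) = J.hodge ω * C.incl b := by
  refine (J.map_hodge hpos (X := LinearMap.mulRight ℂ (C.incl b)) (fun p ω h => ?_)
    (fun ω => ?_) ω).symm
  · have := SetLike.mul_mem_graded h (J.incl_mem_bideg b)
    rwa [show p + (0, 0) = p from add_zero p] at this
  · simp only [LinearMap.mulRight_apply, mul_assoc]

/-- The form `σ` has weight zero, so the derivation given by the weight commutes with the Hodge map.
-/
theorem hodge_diag_weight (ω : Ω) :
    J.hodge (J.diag ComplexStructure.weight ω) = J.diag ComplexStructure.weight (J.hodge ω) := by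
  refine (J.map_hodge hpos (fun p ω h => ?_) (fun ω => ?_) ω).symm
  · rw [J.diag_of_mem _ h]; exact Submodule.smul_mem _ _ h
  · rw [J.diag_weight_mul, J.diag_of_mem _ J.σ_mem]
    simp [ComplexStructure.weight]

end HermitianStructure

/-! ### The metric with values in the base algebra -/

namespace StarCalculus

variable {B Ω : Type*} [Ring B] [Algebra ℂ B] [StarRing B] [Ring Ω] [Algebra ℂ Ω]
  (C : StarCalculus B Ω)

theorem incl_toBase (ω : Ω) : C.incl (C.toBase ω) = C.proj 0 ω :=
  congrArg Subtype.val
    ((LinearEquiv.ofInjective C.incl.toLinearMap C.incl_injective).apply_symm_apply _)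

theorem incl_mem (b : B) : C.incl b ∈ C.deg 0 := by rw [← C.range_incl]; exact ⟨b, rfl⟩

theorem hom_ext {M : Type*} [AddCommMonoid M] {f g : Ω → M}
    (hf : ∀ x y, f (x + y) = f x + f y) (hg : ∀ x y, g (x + y) = g x + g y)
    (hf0 : f 0 = 0) (hg0 : g 0 = 0)
    (h : ∀ k, ∀ ω ∈ C.deg k, f ω = g ω) (ω : Ω) : f ω = g ω := by
  induction ω using DirectSum.Decomposition.inductionOn C.deg with
  | zero => rw [hf0, hg0]
  | homogeneous ω => exact h _ _ ω.2
  | add x y hx hy => rw [hf, hg, hx, hy]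

theorem conj_incl_mul (b : B) (ω : Ω) : C.conj (C.incl b * ω) = C.conj ω * C.incl (star b) := by
  refine C.hom_ext (f := fun ω => C.conj (C.incl b * ω))
    (g := fun ω => C.conj ω * C.incl (star b)) (by simp [mul_add]) (by simp [add_mul]) (by simp)
    (by simp) (fun k ω h => ?_) ω
  rw [C.conj_mul 0 k _ (C.incl_mem b) _ h, zero_mul, pow_zero, one_smul, C.conj_incl]

theorem conj_mul_incl (ω : Ω) (b : B) : C.conj (ω * C.incl b) = C.incl (star b) * C.conj ω := by
  refine C.hom_ext (f := fun ω => C.conj (ω * C.incl b))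
    (g := fun ω => C.incl (star b) * C.conj ω) (by simp [add_mul]) (by simp [mul_add]) (by simp)
    (by simp) (fun k ω h => ?_) ω
  rw [C.conj_mul k 0 _ h _ (C.incl_mem b), mul_zero, pow_zero, one_smul, C.conj_incl]

theorem proj_incl_mul (k : ℕ) (b : B) (ω : Ω) :
    C.proj k (C.incl b * ω) = C.incl b * C.proj k ω := by
  have := DirectSum.coe_decompose_mul_add_of_left_mem C.deg (j := k) (b := ω) (C.incl_mem b)
  rwa [zero_add] at this

theorem proj_mul_incl (k : ℕ) (ω : Ω) (b : B) :
    C.proj k (ω * C.incl b) = C.proj k ω * C.incl b := by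
  have := DirectSum.coe_decompose_mul_add_of_right_mem C.deg (i := k) (a := ω) (C.incl_mem b)
  rwa [add_zero] at this

theorem toBase_incl_mul (b : B) (ω : Ω) : C.toBase (C.incl b * ω) = b * C.toBase ω := by
  apply C.incl_injective
  rw [map_mul C.incl, C.incl_toBase, C.incl_toBase, C.proj_incl_mul]

theorem toBase_mul_incl (ω : Ω) (b : B) : C.toBase (ω * C.incl b) = C.toBase ω * b := by
  apply C.incl_injective
  rw [map_mul C.incl, C.incl_toBase, C.incl_toBase, C.proj_mul_incl]

end StarCalculus

namespace HermitianStructure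

variable {B Ω : Type*} [Ring B] [Algebra ℂ B] [StarRing B] [Ring Ω] [Algebra ℂ Ω]
  {C : StarCalculus B Ω} (J : HermitianStructure C)

/-- The forms of degree zero have weight zero. -/
theorem toBase_diag_weight (ω : Ω) : C.toBase (J.diag ComplexStructure.weight ω) = 0 := by
  apply C.incl_injective
  rw [map_zero, C.incl_toBase, J.proj_eq_diag, J.diag_diag]
  refine J.linearMap_ext (g := 0) (fun p ω h => ?_) ω
  rw [J.diag_of_mem _ h, LinearMap.zero_apply]
  split_ifs with hp
  · obtain ⟨h1, h2⟩ := Nat.add_eq_zero_iff.mp hp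
    simp [ComplexStructure.weight, h1, h2]
  · simp

/-- The metric as a `B`-valued map. -/
def baseMetric (ω ν : Ω) : B := C.toBase (J.metric ω ν)

theorem baseMetric_def (ω ν : Ω) : J.baseMetric ω ν =
    ∑ k ∈ Finset.range (2 * J.n + 1),
      C.toBase (J.hodge (C.proj k ω * J.hodge (C.conj (C.proj k ν)))) := by
  rw [baseMetric, metric, map_sum]

theorem baseMetric_add_left (x y z : Ω) :
    J.baseMetric (x + y) z = J.baseMetric x z + J.baseMetric y z := by
  simp [baseMetric_def, add_mul, Finset.sum_add_distrib]

theorem baseMetric_add_right (x y z : Ω) :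
    J.baseMetric x (y + z) = J.baseMetric x y + J.baseMetric x z := by
  simp [baseMetric_def, mul_add, Finset.sum_add_distrib]

theorem baseMetric_smul_left (r : ℂ) (x y : Ω) :
    J.baseMetric (r • x) y = r • J.baseMetric x y := by
  simp [baseMetric_def, Finset.smul_sum]

theorem baseMetric_smul_right (r : ℂ) (x y : Ω) :
    J.baseMetric x (r • y) = (starRingEnd ℂ) r • J.baseMetric x y := by
  simp [baseMetric_def, Finset.smul_sum]

/-- The metric with fixed second argument, as a linear map. -/
def baseMetricLeft (ν : Ω) : Ω →ₗ[ℂ] B where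
  toFun ω := J.baseMetric ω ν
  map_add' x y := J.baseMetric_add_left x y ν
  map_smul' r x := J.baseMetric_smul_left r x ν

/-- The metric with fixed first argument, as a conjugate-linear map. -/
def baseMetricRight (ω : Ω) : Ω →ₗ⋆[ℂ] B where
  toFun ν := J.baseMetric ω ν
  map_add' x y := J.baseMetric_add_right ω x y
  map_smul' r x := J.baseMetric_smul_right r ω x

theorem baseMetric_sum_right {ι : Type*} (s : Finset ι) (f : ι → Ω) (ω : Ω) :
    J.baseMetric ω (∑ i ∈ s, f i) = ∑ i ∈ s, J.baseMetric ω (f i) :=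
  map_sum (J.baseMetricRight ω) f s

theorem baseMetric_zero_left (ω : Ω) : J.baseMetric 0 ω = 0 := map_zero (J.baseMetricLeft ω)

theorem baseMetric_zero_right (ω : Ω) : J.baseMetric ω 0 = 0 := map_zero (J.baseMetricRight ω)

variable (hpos : J.IsPositive)
include hpos

theorem baseMetric_incl_mul_left (b : B) (ω ν : Ω) :
    J.baseMetric (C.incl b * ω) ν = b * J.baseMetric ω ν := by
  simp only [baseMetric_def, Finset.mul_sum]
  refine Finset.sum_congr rfl fun k _ => ?_
  rw [C.proj_incl_mul, mul_assoc, J.hodge_incl_mul hpos, C.toBase_incl_mul]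

theorem baseMetric_incl_mul_right (b : B) (ω ν : Ω) :
    J.baseMetric ω (C.incl b * ν) = J.baseMetric ω ν * star b := by
  simp only [baseMetric_def, Finset.sum_mul]
  refine Finset.sum_congr rfl fun k _ => ?_
  rw [C.proj_incl_mul, C.conj_incl_mul, J.hodge_mul_incl hpos, ← mul_assoc, J.hodge_mul_incl hpos,
    C.toBase_mul_incl]

theorem baseMetric_mul_incl (b : B) (ω ν : Ω) :
    J.baseMetric (ω * C.incl b) ν = J.baseMetric ω (ν * C.incl (star b)) := by
  simp only [baseMetric_def]
  refine Finset.sum_congr rfl fun k _ => ?_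
  rw [C.proj_mul_incl, C.proj_mul_incl, C.conj_mul_incl, J.hodge_incl_mul hpos, mul_assoc,
    star_star]

/-- The form inside `toBase` has weight `w(p) - w(q)`, while only forms of weight zero have a
component of degree zero. -/
theorem toBase_hodge_mul_eq_zero {p q : ℕ × ℕ}
    (hpq : ComplexStructure.weight p ≠ ComplexStructure.weight q) {x y : Ω}
    (hx : x ∈ J.bideg p) (hy : y ∈ J.bideg q) :
    C.toBase (J.hodge (x * J.hodge (C.conj y))) = 0 := by
  have h1 := J.toBase_diag_weight (J.hodge (x * J.hodge (C.conj y)))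
  rw [← J.hodge_diag_weight hpos, J.diag_weight_mul, ← J.hodge_diag_weight hpos,
    J.diag_of_mem _ hx, J.diag_of_mem _ (J.conj_mem q.1 q.2 y hy)] at h1
  have h2 : ComplexStructure.weight (q.2, q.1) = -ComplexStructure.weight q := by
    simp [ComplexStructure.weight]
  rw [h2, map_smul, mul_smul_comm, smul_mul_assoc, ← add_smul, map_smul, map_smul] at h1
  refine (smul_eq_zero.mp h1).resolve_left fun h => hpq ?_
  linear_combination h

/-- Forms of different bidegree are orthogonal. If the degrees agree then the weights differ, and
the Hodge map preserves the weight, while the forms of degree zero have weight zero. -/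
theorem baseMetric_eq_zero_of_ne {p q : ℕ × ℕ} (hpq : p ≠ q) {x y : Ω}
    (hx : x ∈ J.bideg p) (hy : y ∈ J.bideg q) : J.baseMetric x y = 0 := by
  rw [baseMetric_def]
  refine Finset.sum_eq_zero fun k _ => ?_
  rw [J.proj_eq_diag, J.proj_eq_diag, J.diag_of_mem _ hx, J.diag_of_mem _ hy]
  split_ifs with h1 h2
  · rw [one_smul, one_smul]
    refine J.toBase_hodge_mul_eq_zero hpos (fun hw => hpq ?_) hx hy
    simp only [ComplexStructure.weight] at hw
    have h3 : ((p.1 + q.2 : ℕ) : ℂ) = (q.1 + p.2 : ℕ) := by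
      push_cast; linear_combination hw
    have h4 : p.1 + q.2 = q.1 + p.2 := by exact_mod_cast h3
    exact Prod.ext (by omega) (by omega)
  all_goals simp

theorem baseMetric_diag (c : ℕ × ℕ → ℂ) (x y : Ω) :
    J.baseMetric (J.diag c x) y = J.baseMetric x (J.diag (fun p => (starRingEnd ℂ) (c p)) y) := by
  refine J.hom_ext (f := fun x => J.baseMetric (J.diag c x) y)
    (g := fun x => J.baseMetric x (J.diag (fun p => (starRingEnd ℂ) (c p)) y))
    (by simp [baseMetric_add_left]) (by simp [baseMetric_add_left])
    (by simp [baseMetric_zero_left]) (by simp [baseMetric_zero_left]) (fun p x hx => ?_) x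
  refine J.hom_ext (f := fun y => J.baseMetric (J.diag c x) y)
    (g := fun y => J.baseMetric x (J.diag (fun p => (starRingEnd ℂ) (c p)) y))
    (by simp [baseMetric_add_right]) (by simp [baseMetric_add_right])
    (by simp [baseMetric_zero_right]) (by simp [baseMetric_zero_right]) (fun q y hy => ?_) y
  rw [J.diag_of_mem _ hx, J.diag_of_mem _ hy, baseMetric_smul_left, baseMetric_smul_right,
    starRingEnd_self_apply]
  by_cases hpq : p = q
  · rw [hpq]
  · rw [J.baseMetric_eq_zero_of_ne hpos hpq hx hy, smul_zero, smul_zero]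

end HermitianStructure

/-! ### Slices of tensors -/

section Slice

variable {A M N : Type*} [AddCommGroup A] [Module ℂ A] [AddCommGroup M] [Module ℂ M]
  [AddCommGroup N] [Module ℂ N]

/-- The slice map `f ⊗ id : A ⊗ M → M` of a functional `f` on `A`. -/
def slice (f : A →ₗ[ℂ] ℂ) : A ⊗[ℂ] M →ₗ[ℂ] M :=
  (TensorProduct.lid ℂ M).toLinearMap ∘ₗ f.rTensor M

@[simp]
theorem slice_tmul (f : A →ₗ[ℂ] ℂ) (a : A) (m : M) : slice f (a ⊗ₜ[ℂ] m) = f a • m := rfl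

theorem slice_lTensor (f : A →ₗ[ℂ] ℂ) (X : M →ₗ[ℂ] N) (t : A ⊗[ℂ] M) :
    slice f (X.lTensor A t) = X (slice f t) := by
  induction t using TensorProduct.induction_on with
  | zero => simp
  | tmul a m => simp
  | add x y hx hy => simp only [map_add, hx, hy]

theorem slice_add_left (f g : A →ₗ[ℂ] ℂ) (t : A ⊗[ℂ] M) :
    slice (f + g) t = slice f t + slice g t := by
  simp [slice, LinearMap.rTensor_add]

theorem slice_smul_left (c : ℂ) (f : A →ₗ[ℂ] ℂ) (t : A ⊗[ℂ] M) :
    slice (c • f) t = c • slice f t := by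
  simp [slice, LinearMap.rTensor_smul]

/-- The slices of a tensor separate tensors. -/
theorem slice_ext {t t' : A ⊗[ℂ] M} (h : ∀ f : A →ₗ[ℂ] ℂ, slice f t = slice f t') : t = t' := by
  classical
  let 𝒷 := Module.Basis.ofVectorSpace ℂ A
  apply (TensorProduct.equivFinsuppOfBasisLeft (N := M) 𝒷).injective
  have key : ∀ (s : A ⊗[ℂ] M) i,
      TensorProduct.equivFinsuppOfBasisLeft (N := M) 𝒷 s i = slice (𝒷.coord i) s := by
    intro s i
    induction s using TensorProduct.induction_on with
    | zero => simp
    | tmul a m => simp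
    | add x y hx hy => simp only [map_add, Finsupp.add_apply, hx, hy]
  ext i
  rw [key, key, h]

/-- The space of all slices of a tensor. -/
def sliceRange (t : A ⊗[ℂ] M) : Submodule ℂ M where
  carrier := Set.range fun f : A →ₗ[ℂ] ℂ => slice f t
  zero_mem' := ⟨0, by simp [slice]⟩
  add_mem' := by
    rintro _ _ ⟨f, rfl⟩ ⟨g, rfl⟩
    exact ⟨f + g, slice_add_left f g t⟩
  smul_mem' := by
    rintro c _ ⟨f, rfl⟩
    exact ⟨c • f, slice_smul_left c f t⟩

theorem slice_mem_sliceRange (f : A →ₗ[ℂ] ℂ) (t : A ⊗[ℂ] M) : slice f t ∈ sliceRange t :=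
  ⟨f, rfl⟩

instance finiteDimensional_sliceRange (t : A ⊗[ℂ] M) : FiniteDimensional ℂ (sliceRange t) := by
  induction t using TensorProduct.induction_on with
  | zero =>
    have : sliceRange (0 : A ⊗[ℂ] M) ≤ ⊥ := by
      rintro _ ⟨f, rfl⟩
      simp
    exact Submodule.finiteDimensional_of_le this
  | tmul a m =>
    have : sliceRange (a ⊗ₜ[ℂ] m) ≤ Submodule.span ℂ {m} := by
      rintro _ ⟨f, rfl⟩
      exact Submodule.smul_mem _ _ (Submodule.mem_span_singleton_self m)
    exact Submodule.finiteDimensional_of_le this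
  | add x y hx hy =>
    have : sliceRange (x + y) ≤ sliceRange x ⊔ sliceRange y := by
      rintro _ ⟨f, rfl⟩
      simp only [map_add]
      exact add_mem (Submodule.mem_sup_left ⟨f, rfl⟩) (Submodule.mem_sup_right ⟨f, rfl⟩)
    exact Submodule.finiteDimensional_of_le this

/-- The slice map `id ⊗ φ : A ⊗ M → A` of a functional `φ` on `M`. -/
def coslice (φ : M →ₗ[ℂ] ℂ) : A ⊗[ℂ] M →ₗ[ℂ] A :=
  (TensorProduct.rid ℂ A).toLinearMap ∘ₗ φ.lTensor A

@[simp]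
theorem coslice_tmul (φ : M →ₗ[ℂ] ℂ) (a : A) (m : M) : coslice φ (a ⊗ₜ[ℂ] m) = φ m • a := rfl

theorem apply_coslice (f : A →ₗ[ℂ] ℂ) (φ : M →ₗ[ℂ] ℂ) (t : A ⊗[ℂ] M) :
    f (coslice φ t) = φ (slice f t) := by
  induction t using TensorProduct.induction_on with
  | zero => simp
  | tmul a m => simp [mul_comm]
  | add x y hx hy => simp only [map_add, hx, hy]

theorem coslice_lTensor (φ : N →ₗ[ℂ] ℂ) (X : M →ₗ[ℂ] N)
    (t : A ⊗[ℂ] M) : coslice φ (X.lTensor A t) = coslice (φ ∘ₗ X) t := by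
  induction t using TensorProduct.induction_on with
  | zero => simp
  | tmul a m => simp
  | add x y hx hy => simp only [map_add, hx, hy]

end Slice

/-! ### The Haar functional -/

section Haar

variable {A : Type*} [Ring A] [HopfAlgebra ℂ A] [StarRing A] [StarModule ℂ A] [CQGA A]

theorem haar_star_mul_self_nonneg (a : A) : 0 ≤ haar A (star a * a) := by
  rcases eq_or_ne a 0 with rfl | ha
  · simp
  · exact (haar_pos ha).le

theorem haar_mul_star_self_nonneg (a : A) : 0 ≤ haar A (a * star a) := by
  simpa using haar_star_mul_self_nonneg (star a)

/-- Positivity forces the Haar functional to be hermitian. -/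
theorem haar_star (a : A) : haar A (star a) = (starRingEnd ℂ) (haar A a) := by
  have h0 : ∀ x : A, (haar A (star x * x)).im = 0 := fun x =>
    (Complex.nonneg_iff.mp (haar_star_mul_self_nonneg x)).2.symm
  have h1 := h0 (1 + a)
  have h2 := h0 (1 + Complex.I • a)
  have hone := (haar_isHaarFunctional A).map_one
  simp only [star_add, star_one, star_smul, add_mul, mul_add, one_mul, mul_one, map_add,
    smul_mul_assoc, mul_smul_comm, map_smul, Complex.add_im, hone, h0, smul_eq_mul,
    Complex.mul_im, Complex.mul_re, Complex.star_def, Complex.conj_I, Complex.neg_re,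
    Complex.neg_im, Complex.I_re, Complex.I_im, Complex.one_im] at h1 h2
  apply Complex.ext
  · rw [Complex.conj_re]; linarith
  · rw [Complex.conj_im]; linarith

/-- The Haar functional is faithful. -/
theorem eq_zero_of_haar_mul_eq_zero {a : A} (h : ∀ b, haar A (a * b) = 0) : a = 0 := by
  by_contra ha
  have h1 := haar_pos (a := star a) (star_ne_zero.mpr ha)
  rw [star_star, h] at h1
  exact lt_irrefl _ h1

/-- The functional `a ↦ haar (a x)`. -/
def haarMul (x : A) : A →ₗ[ℂ] ℂ := haar A ∘ₗ LinearMap.mulRight ℂ x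

@[simp]
theorem haarMul_apply (x a : A) : haarMul x a = haar A (a * x) := rfl

/-- On a finite-dimensional subspace every functional is of the form `a ↦ haar (a x)`. -/
theorem exists_haarMul_eq (V : Submodule ℂ A) [FiniteDimensional ℂ V] (f : A →ₗ[ℂ] ℂ) :
    ∃ x, ∀ a ∈ V, haarMul x a = f a := by
  let F : A →ₗ[ℂ] Module.Dual ℂ V :=
    { toFun := fun x => haarMul x ∘ₗ V.subtype
      map_add' := fun x y => by ext v; simp [mul_add]
      map_smul' := fun c x => by ext v; simp }
  have hF : Function.Surjective F := by
    rw [← LinearMap.dualMap_injective_iff, injective_iff_map_eq_zero]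
    intro ψ hψ
    obtain ⟨v, rfl⟩ := (Module.evalEquiv ℂ V).surjective ψ
    have : (v : A) = 0 := eq_zero_of_haar_mul_eq_zero fun b => by
      have := LinearMap.congr_fun hψ b
      simpa [F] using this
    rw [show v = 0 from Subtype.ext this, map_zero]
  obtain ⟨x, hx⟩ := hF (f ∘ₗ V.subtype)
  exact ⟨x, fun a ha => LinearMap.congr_fun hx ⟨a, ha⟩⟩

omit [StarRing A] [StarModule ℂ A] [CQGA A] in
/-- The identity `∑ y₁₁ ⊗ y₁₂ S(y₂) = y ⊗ 1`. -/
theorem lTensor_mul_antipode_assoc_comul (y : A) :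
    (LinearMap.mul' ℂ A ∘ₗ (HopfAlgebra.antipode ℂ).lTensor A).lTensor A
      (TensorProduct.assoc ℂ A A A ((Coalgebra.comul (R := ℂ) (A := A)).rTensor A
        (Coalgebra.comul y))) = y ⊗ₜ[ℂ] (1 : A) := by
  rw [Coalgebra.coassoc_apply, ← LinearMap.comp_apply, ← LinearMap.lTensor_comp,
    LinearMap.comp_assoc, HopfAlgebra.mul_antipode_lTensor_comul, LinearMap.lTensor_comp,
    LinearMap.comp_apply, Coalgebra.lTensor_counit_comul]
  simp

/-- Strong invariance of the Haar functional: `∑ haar (a₁ y) a₂ = ∑ haar (a y₁) S(y₂)`. -/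
theorem slice_haarMul_comul (a y : A) :
    slice (haarMul y) (Coalgebra.comul a) =
      slice (haar A ∘ₗ LinearMap.mulLeft ℂ a)
        ((HopfAlgebra.antipode ℂ).lTensor A (Coalgebra.comul y)) := by
  have h1 : ∀ u : A ⊗[ℂ] A, slice (haarMul y) u = slice (haar A) (u * y ⊗ₜ[ℂ] (1 : A)) := by
    intro u
    induction u using TensorProduct.induction_on with
    | zero => simp
    | tmul p q => simp
    | add p q hp hq => simp only [map_add, add_mul, hp, hq]
  have h2 : ∀ t u : A ⊗[ℂ] A, ∀ q : A, slice (haar A) (u *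
      (LinearMap.mul' ℂ A ∘ₗ (HopfAlgebra.antipode ℂ).lTensor A).lTensor A
        (TensorProduct.assoc ℂ A A A (t ⊗ₜ[ℂ] q))) =
      slice (haar A) (u * t) * HopfAlgebra.antipode ℂ q := by
    intro t u q
    induction t using TensorProduct.induction_on with
    | zero => simp
    | add p q hp hq => simp only [map_add, mul_add, add_mul, TensorProduct.add_tmul, hp, hq]
    | tmul p r =>
      induction u using TensorProduct.induction_on with
      | zero => simp
      | add p q hp hq => simp only [map_add, add_mul, hp, hq]
      | tmul c d => simp [mul_assoc]
  have h3 : ∀ t : A ⊗[ℂ] A, slice (haar A) (Coalgebra.comul a *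
      (LinearMap.mul' ℂ A ∘ₗ (HopfAlgebra.antipode ℂ).lTensor A).lTensor A
        (TensorProduct.assoc ℂ A A A ((Coalgebra.comul (R := ℂ) (A := A)).rTensor A t))) =
      slice (haar A ∘ₗ LinearMap.mulLeft ℂ a) ((HopfAlgebra.antipode ℂ).lTensor A t) := by
    intro t
    induction t using TensorProduct.induction_on with
    | zero => simp
    | add p q hp hq => simp only [map_add, mul_add, hp, hq]
    | tmul p q =>
      rw [LinearMap.rTensor_tmul, h2, ← Bialgebra.comul_mul]
      have := (haar_isHaarFunctional A).left_inv (a * p)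
      change slice (haar A) (Coalgebra.comul (a * p)) = _ at this
      rw [this]
      simp
  rw [h1, ← lTensor_mul_antipode_assoc_comul, h3]

end Haar

/-! ### The action of functionals on the forms -/

namespace CQHHermitianSpace

variable {A H Ω : Type*}
  [Ring A] [HopfAlgebra ℂ A] [StarRing A] [StarModule ℂ A] [CQGA A]
  [Ring H] [HopfAlgebra ℂ H] [StarRing H] [StarModule ℂ H] [CQGA H]
  [Ring Ω] [Algebra ℂ Ω] (S : CQHHermitianSpace A H Ω)

/-- The action `ω ↦ f(ω₍₋₁₎) ω₍₀₎` of a functional `f` on `A`. -/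
def act (f : A →ₗ[ℂ] ℂ) : Ω →ₗ[ℂ] Ω := slice f ∘ₗ S.coaction.toLinearMap

theorem act_apply (f : A →ₗ[ℂ] ℂ) (ω : Ω) : S.act f ω = slice f (S.coaction ω) := rfl

theorem act_counit (ω : Ω) : S.act Coalgebra.counit ω = ω := S.coaction_counit ω

/-- A linear map that commutes with the action of all functionals is a comodule map. -/
theorem coaction_map {X : Ω →ₗ[ℂ] Ω} (hX : ∀ f ω, X (S.act f ω) = S.act f (X ω)) (ω : Ω) :
    S.coaction (X ω) = X.lTensor A (S.coaction ω) := by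
  refine slice_ext fun f => ?_
  rw [slice_lTensor]
  exact (hX f ω).symm

theorem act_mem_bideg (f : A →ₗ[ℂ] ℂ) (p : ℕ × ℕ) (ω : Ω) (h : ω ∈ S.hermitian.bideg p) :
    S.act f ω ∈ S.hermitian.bideg p := by
  obtain ⟨t, ht⟩ := S.coaction_bideg p ω h
  rw [act_apply, ← ht, slice_lTensor]
  exact Subtype.property _

theorem act_d (f : A →ₗ[ℂ] ℂ) (ω : Ω) :
    S.act f (S.calculus.d ω) = S.calculus.d (S.act f ω) := by
  rw [act_apply, S.coaction_d, slice_lTensor, act_apply]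

theorem act_sigma_mul (f : A →ₗ[ℂ] ℂ) (ω : Ω) :
    S.act f (S.hermitian.σ * ω) = S.hermitian.σ * S.act f ω := by
  rw [act_apply, map_mul, S.coaction_σ, act_apply]
  induction S.coaction ω using TensorProduct.induction_on with
  | zero => simp
  | tmul a x => simp
  | add x y hx hy => simp only [map_add, mul_add, hx, hy]

theorem act_hodge (f : A →ₗ[ℂ] ℂ) (ω : Ω) :
    S.act f (S.hermitian.hodge ω) = S.hermitian.hodge (S.act f ω) :=
  S.hermitian.map_hodge S.positive (S.act_mem_bideg f) (S.act_sigma_mul f) ω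

theorem act_diag (f : A →ₗ[ℂ] ℂ) (c : ℕ × ℕ → ℂ) (ω : Ω) :
    S.act f (S.hermitian.diag c ω) = S.hermitian.diag c (S.act f ω) :=
  S.hermitian.map_diag (S.act_mem_bideg f) c ω

theorem act_proj (f : A →ₗ[ℂ] ℂ) (k : ℕ) (ω : Ω) :
    S.act f (S.calculus.proj k ω) = S.calculus.proj k (S.act f ω) := by
  rw [S.hermitian.proj_eq_diag, S.hermitian.proj_eq_diag, act_diag]

theorem act_dbar (f : A →ₗ[ℂ] ℂ) (ω : Ω) :
    S.act f (S.hermitian.dbar ω) = S.hermitian.dbar (S.act f ω) :=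
  S.hermitian.map_dbar (S.act_mem_bideg f) (S.act_d f) ω

theorem act_incl (f : A →ₗ[ℂ] ℂ) (b : S.B) :
    S.act f (S.calculus.incl b) = S.calculus.incl (slice f (leftCoaction S.π S.π_star b)) := by
  rw [act_apply, S.coaction_incl, slice_lTensor]; rfl

theorem coe_slice_leftCoaction (f : A →ₗ[ℂ] ℂ) (b : S.B) :
    ((slice f (leftCoaction S.π S.π_star b) : S.B) : A) = slice f (Coalgebra.comul (b : A)) := by
  rw [← lTensor_leftCoaction S.π S.π_star b, slice_lTensor]; rfl

/-- The convolution product of two functionals. -/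
def convFunctional (f g : A →ₗ[ℂ] ℂ) : A →ₗ[ℂ] ℂ :=
  g ∘ₗ slice f ∘ₗ Coalgebra.comul

/-- Successive actions of functionals compose by convolution. -/
theorem act_act (f g : A →ₗ[ℂ] ℂ) (ω : Ω) :
    S.act g (S.act f ω) = S.act (convFunctional f g) ω := by
  have h1 : S.act g (S.act f ω) =
      slice g (slice f (S.coaction.toLinearMap.lTensor A (S.coaction ω))) := by
    rw [slice_lTensor]; rfl
  rw [h1, ← S.coaction_coassoc, act_apply]
  induction S.coaction ω using TensorProduct.induction_on with
  | zero => simp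
  | add x y hx hy => simp only [map_add, hx, hy]
  | tmul a m =>
    rw [LinearMap.rTensor_tmul, slice_tmul, convFunctional, LinearMap.comp_apply,
      LinearMap.comp_apply]
    induction (Coalgebra.comul a : A ⊗[ℂ] A) using TensorProduct.induction_on with
    | zero => simp
    | add x y hx hy => simp only [map_add, add_smul, TensorProduct.add_tmul, hx, hy]
    | tmul x y => simp [smul_smul]

/-- By strong invariance, every slice of `Δ(b)` along `a ↦ haar (a x)` is a slice of the tensor `∑
x₁ ⊗ S(x₂)`, which does not depend on `b`. -/
theorem finiteDimensional_act_haarMul_incl (x : A) : FiniteDimensional ℂ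
    (LinearMap.range (S.act (haarMul x) ∘ₗ S.calculus.incl.toLinearMap)) := by
  have h1 : S.act (haarMul x) ∘ₗ S.calculus.incl.toLinearMap =
      S.calculus.incl.toLinearMap ∘ₗ (slice (haarMul x) ∘ₗ leftCoaction S.π S.π_star) :=
    LinearMap.ext fun b => S.act_incl (haarMul x) b
  rw [h1, LinearMap.range_comp]
  set g := slice (haarMul x) ∘ₗ leftCoaction S.π S.π_star with hg
  have h2 : (LinearMap.range g).map (coinvariantsIncl S.π S.π_star) ≤
      sliceRange ((HopfAlgebra.antipode ℂ).lTensor A (Coalgebra.comul x)) := by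
    rintro _ ⟨_, ⟨b, rfl⟩, rfl⟩
    have : coinvariantsIncl S.π S.π_star (g b) = slice (haarMul x) (Coalgebra.comul (b : A)) :=
      S.coe_slice_leftCoaction _ b
    rw [this, slice_haarMul_comul]
    exact slice_mem_sliceRange _ _
  have h3 := Submodule.finiteDimensional_of_le h2
  have h4 : FiniteDimensional ℂ (LinearMap.range g) :=
    ((LinearMap.range g).equivMapOfInjective (coinvariantsIncl S.π S.π_star)
      Subtype.val_injective).symm.finiteDimensional
  infer_instance

/-- The functional `a ↦ haar (a x)` maps `B y` into a space of finite dimension, for a form `y`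
whose coaction is `t`. -/
theorem exists_finiteDimensional_slice_mem (t : A ⊗[ℂ] Ω) (x : A) :
    ∃ F : Submodule ℂ Ω, FiniteDimensional ℂ F ∧
      ∀ b, slice (haarMul x) (S.coaction (S.calculus.incl b) * t) ∈ F := by
  induction t using TensorProduct.induction_on with
  | zero => exact ⟨⊥, inferInstance, by simp⟩
  | add s t hs ht =>
    obtain ⟨F, hF, h⟩ := hs
    obtain ⟨F', hF', h'⟩ := ht
    refine ⟨F ⊔ F', inferInstance, fun b => ?_⟩
    rw [mul_add, map_add]
    exact add_mem (Submodule.mem_sup_left (h b)) (Submodule.mem_sup_right (h' b))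
  | tmul c ω =>
    have := S.finiteDimensional_act_haarMul_incl (c * x)
    refine ⟨(LinearMap.range (S.act (haarMul (c * x)) ∘ₗ S.calculus.incl.toLinearMap)).map
      (LinearMap.mulRight ℂ ω), inferInstance, fun b => ?_⟩
    have h1 : ∀ u : A ⊗[ℂ] Ω, slice (haarMul x) (u * c ⊗ₜ[ℂ] ω) =
        slice (haarMul (c * x)) u * ω := by
      intro u
      induction u using TensorProduct.induction_on with
      | zero => simp
      | tmul p q => simp [mul_assoc]
      | add p q hp hq => simp only [map_add, add_mul, hp, hq]
    rw [h1]
    exact ⟨_, ⟨b, rfl⟩, rfl⟩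

/-- The finite generation over `B`, in terms of the inclusion of `B` in `Ω`. -/
theorem exists_generators : ∃ s : Finset Ω, ∀ ω, ∃ c : Ω → S.B,
    ∑ y ∈ s, S.calculus.incl (c y) * y = ω := by
  let := Module.compHom Ω S.calculus.incl.toRingHom
  obtain ⟨s, hs⟩ := S.finite.fg_top
  refine ⟨s, fun ω => ?_⟩
  have h : ω ∈ Submodule.span S.B (s : Set Ω) := by rw [hs]; trivial
  obtain ⟨c, -, hc⟩ := Submodule.mem_span_finset.mp h
  exact ⟨c, hc⟩

/-- The functionals `a ↦ haar (a x)` act on the forms by operators of finite rank, since the forms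
are finitely generated over `B`. -/
theorem finiteDimensional_range_act_haarMul (x : A) :
    FiniteDimensional ℂ (LinearMap.range (S.act (haarMul x))) := by
  obtain ⟨s, hs⟩ := S.exists_generators
  choose F hF hmem using fun y : Ω => S.exists_finiteDimensional_slice_mem (S.coaction y) x
  have h : LinearMap.range (S.act (haarMul x)) ≤ ⨆ y : s, F y := by
    rintro _ ⟨ω, rfl⟩
    obtain ⟨c, rfl⟩ := hs ω
    rw [map_sum]
    refine sum_mem fun y hy => Submodule.mem_iSup_of_mem ⟨y, hy⟩ ?_
    rw [act_apply, map_mul]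
    exact hmem y (c y)
  have : FiniteDimensional ℂ (⨆ y : s, F y : Submodule ℂ Ω) := by
    have : ∀ y : s, FiniteDimensional ℂ (F y) := fun y => hF y
    infer_instance
  exact Submodule.finiteDimensional_of_le h

end CQHHermitianSpace

/-! ### Invariance of the inner product, and unitary families -/

namespace CQHHermitianSpace

variable {A H Ω : Type*}
  [Ring A] [HopfAlgebra ℂ A] [StarRing A] [StarModule ℂ A] [CQGA A]
  [Ring H] [HopfAlgebra ℂ H] [StarRing H] [StarModule ℂ H] [CQGA H]
  [Ring Ω] [Algebra ℂ Ω] (S : CQHHermitianSpace A H Ω)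

/-- The conjugate-linear map `* ⊗ *` on `A ⊗ Ω`. -/
def tensorConj : A ⊗[ℂ] Ω →ₗ⋆[ℂ] A ⊗[ℂ] Ω :=
  TensorProduct.map (starLinearEquiv ℂ (A := A)).toLinearMap S.calculus.conj

@[simp]
theorem tensorConj_tmul (a : A) (ω : Ω) :
    S.tensorConj (a ⊗ₜ[ℂ] ω) = star a ⊗ₜ[ℂ] S.calculus.conj ω := rfl

theorem leftCoaction_star (b : S.B) :
    leftCoaction S.π S.π_star (star b) =
      TensorProduct.map (starLinearEquiv ℂ (A := A)).toLinearMap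
        (starLinearEquiv ℂ (A := S.B)).toLinearMap (leftCoaction S.π S.π_star b) := by
  apply coinvariantsIncl_lTensor_injective S.π S.π_star
  have h1 : ∀ t : A ⊗[ℂ] S.B, (coinvariantsIncl S.π S.π_star).lTensor A
      (TensorProduct.map (starLinearEquiv ℂ (A := A)).toLinearMap
        (starLinearEquiv ℂ (A := S.B)).toLinearMap t) =
      star ((coinvariantsIncl S.π S.π_star).lTensor A t) := by
    intro t
    induction t using TensorProduct.induction_on with
    | zero => simp
    | tmul a m => simp [TensorProduct.star_tmul, coinvariantsIncl]
    | add x y hx hy => simp only [map_add, star_add, hx, hy]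
  rw [h1, lTensor_leftCoaction, lTensor_leftCoaction, ← CQGA.comul_star]
  rfl

theorem coaction_conj_incl (b : S.B) : S.coaction (S.calculus.conj (S.calculus.incl b)) =
    S.tensorConj (S.coaction (S.calculus.incl b)) := by
  rw [S.calculus.conj_incl, S.coaction_incl, S.coaction_incl, leftCoaction_star]
  induction leftCoaction S.π S.π_star b using TensorProduct.induction_on with
  | zero => simp
  | tmul a m => simp [S.calculus.conj_incl]
  | add x y hx hy => simp only [map_add, hx, hy]

theorem coaction_mem_deg {k : ℕ} {ω : Ω} (h : ω ∈ S.calculus.deg k) :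
    S.coaction ω ∈ LinearMap.range ((S.calculus.deg k).subtype.lTensor A) := by
  have h1 : S.calculus.proj k ω = ω := DirectSum.decompose_of_mem_same _ h
  have h2 : S.calculus.proj k = (S.calculus.deg k).subtype ∘ₗ
      (S.calculus.proj k).codRestrict _ (S.calculus.proj_mem k) := rfl
  rw [← h1, S.coaction_map (fun f ω => (S.act_proj f k ω).symm), h2, LinearMap.lTensor_comp]
  exact ⟨_, rfl⟩

theorem tensorConj_mul {k l : ℕ} (t : A ⊗[ℂ] S.calculus.deg k) (t' : A ⊗[ℂ] S.calculus.deg l) :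
    S.tensorConj ((S.calculus.deg k).subtype.lTensor A t *
        (S.calculus.deg l).subtype.lTensor A t') =
      (-1 : ℂ) ^ (k * l) • (S.tensorConj ((S.calculus.deg l).subtype.lTensor A t') *
        S.tensorConj ((S.calculus.deg k).subtype.lTensor A t)) := by
  induction t using TensorProduct.induction_on with
  | zero => simp
  | add x y hx hy => simp only [map_add, add_mul, mul_add, smul_add, hx, hy]
  | tmul a ω =>
    induction t' using TensorProduct.induction_on with
    | zero => simp
    | add x y hx hy => simp only [map_add, add_mul, mul_add, smul_add, hx, hy]
    | tmul c ν => simp [S.calculus.conj_mul k l _ ω.2 _ ν.2]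

/-- The coaction is compatible with the `*`-maps: it suffices to check this on the generators of the
calculus. -/
theorem coaction_conj (ω : Ω) :
    S.coaction (S.calculus.conj ω) = S.tensorConj (S.coaction ω) := by
  have hω : ω ∈ Algebra.adjoin ℂ (Set.range S.calculus.incl ∪
      Set.range fun b => S.calculus.d (S.calculus.incl b)) := by
    rw [S.calculus.generated]; trivial
  rw [← Subalgebra.mem_toSubmodule, Algebra.adjoin_eq_span] at hω
  induction hω using Submodule.span_induction with
  | zero => simp
  | add x y _ _ hx hy => simp only [map_add, hx, hy]
  | smul c x _ hx => rw [LinearMap.map_smulₛₗ, map_smul, map_smul, LinearMap.map_smulₛₗ, hx]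
  | mem x hx =>
    suffices h : ∃ k, x ∈ S.calculus.deg k ∧
        S.coaction (S.calculus.conj x) = S.tensorConj (S.coaction x) from h.choose_spec.2
    induction hx using Submonoid.closure_induction with
    | mem x hx =>
      rcases hx with ⟨b, rfl⟩ | ⟨b, rfl⟩
      · exact ⟨0, S.calculus.incl_mem b, S.coaction_conj_incl b⟩
      · refine ⟨1, S.calculus.d_mem 0 _ (S.calculus.incl_mem b), ?_⟩
        dsimp only
        rw [S.calculus.conj_d, S.coaction_d, coaction_conj_incl, S.coaction_d]
        induction S.coaction (S.calculus.incl b) using TensorProduct.induction_on with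
        | zero => simp
        | tmul a m => simp [S.calculus.conj_d]
        | add x y hx hy => simp only [map_add, hx, hy]
    | one =>
      have := S.coaction_conj_incl 1
      rw [map_one] at this
      refine ⟨0, ?_, this⟩
      have := S.calculus.incl_mem 1
      rwa [map_one] at this
    | mul x y _ _ hx hy =>
      obtain ⟨k, hk, hx⟩ := hx
      obtain ⟨l, hl, hy⟩ := hy
      refine ⟨k + l, SetLike.mul_mem_graded hk hl, ?_⟩
      obtain ⟨t, ht⟩ := S.coaction_mem_deg hk
      obtain ⟨t', ht'⟩ := S.coaction_mem_deg hl
      rw [S.calculus.conj_mul k l _ hk _ hl, map_smul, map_mul, map_mul, hx, hy, ← ht, ← ht',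
        tensorConj_mul]

/-- The `B`-valued metric. -/
def G (ω ν : Ω) : S.B := S.hermitian.baseMetric ω ν

theorem form_eq (ω ν : Ω) : S.form ω ν = haar A (S.G ω ν : A) := rfl

section Covariance

variable {ι κ : Type*} {s : Finset ι} {t : Finset κ} {a : ι → A} {c : κ → A} {x : ι → Ω}
  {y : κ → Ω} {ω ν : Ω}

/-- The metric is covariant: `g(ω, ν)₍₋₁₎ ⊗ g(ω, ν)₍₀₎ = ω₍₋₁₎ ν₍₋₁₎* ⊗ g(ω₍₀₎, ν₍₀₎)`. -/
theorem coaction_incl_G (hω : S.coaction ω = ∑ i ∈ s, a i ⊗ₜ[ℂ] x i)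
    (hν : S.coaction ν = ∑ j ∈ t, c j ⊗ₜ[ℂ] y j) :
    S.coaction (S.calculus.incl (S.G ω ν)) =
      ∑ i ∈ s, ∑ j ∈ t, (a i * star (c j)) ⊗ₜ[ℂ] S.calculus.incl (S.G (x i) (y j)) := by
  have hproj : ∀ k ω, S.coaction (S.calculus.proj k ω) =
      (S.calculus.proj k).lTensor A (S.coaction ω) := fun k ω =>
    S.coaction_map (fun f ω => (S.act_proj f k ω).symm) ω
  have hhodge : ∀ ω, S.coaction (S.hermitian.hodge ω) =
      S.hermitian.hodge.lTensor A (S.coaction ω) := fun ω =>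
    S.coaction_map (fun f ω => (S.act_hodge f ω).symm) ω
  simp only [G, HermitianStructure.baseMetric_def, map_sum, S.calculus.incl_toBase]
  simp only [hproj, hhodge, coaction_conj, map_mul, hω, hν, map_sum, LinearMap.lTensor_tmul,
    tensorConj_tmul, Finset.sum_mul_sum, Algebra.TensorProduct.tmul_mul_tmul,
    TensorProduct.tmul_sum]
  rw [Finset.sum_comm]
  refine Finset.sum_congr rfl fun i _ => ?_
  rw [Finset.sum_comm]

/-- Invariance of the Haar functional, transported to the base algebra inside the forms. -/
theorem coslice_haar_coaction_incl (b : S.B) :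
    coslice (haar A ∘ₗ coinvariantsIncl S.π S.π_star ∘ₗ S.calculus.toBase)
      (S.coaction (S.calculus.incl b)) = haar A (b : A) • (1 : A) := by
  have h1 := (haar_isHaarFunctional A).right_inv (b : A)
  change coslice (haar A) (Coalgebra.comul (b : A)) = _ at h1
  rw [← h1, ← lTensor_leftCoaction S.π S.π_star b, S.coaction_incl, coslice_lTensor,
    coslice_lTensor]
  congr 1
  congr 1
  ext b
  simp [S.calculus.toBase_incl]

/-- The inner product on forms is invariant under the coaction. -/
theorem form_invariant (hω : S.coaction ω = ∑ i ∈ s, a i ⊗ₜ[ℂ] x i)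
    (hν : S.coaction ν = ∑ j ∈ t, c j ⊗ₜ[ℂ] y j) :
    ∑ i ∈ s, ∑ j ∈ t, S.form (x i) (y j) • (a i * star (c j)) = S.form ω ν • (1 : A) := by
  rw [form_eq, ← S.coslice_haar_coaction_incl, S.coaction_incl_G hω hν]
  simp only [map_sum, coslice_tmul, LinearMap.comp_apply, S.calculus.toBase_incl]
  rfl

end Covariance

/-- The inner product with fixed second argument, as a linear functional. -/
def formLeft (ν : Ω) : Ω →ₗ[ℂ] ℂ where
  toFun ω := S.form ω ν
  map_add' x y := S.form_add_left x y ν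
  map_smul' r x := S.form_smul_left r x ν

@[simp]
theorem formLeft_apply (ω ν : Ω) : S.formLeft ν ω = S.form ω ν := rfl

/-- A finite orthonormal family of forms that spans a subcomodule, with the unitary matrix of
coefficients of the coaction. -/
structure IsUnitaryFamily {m : ℕ} (w : Fin m → Ω) (u : Matrix (Fin m) (Fin m) A) : Prop where
  coaction_eq : ∀ i, S.coaction (w i) = ∑ j, u i j ⊗ₜ[ℂ] w j
  form_eq : ∀ i j, S.form (w i) (w j) = if i = j then 1 else 0
  mul_star : u * star u = 1
  antipode_eq : ∀ i j, HopfAlgebra.antipode ℂ (u i j) = star (u j i)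
  counit_eq : ∀ i j, Coalgebra.counit (R := ℂ) (u i j) = if i = j then 1 else 0
  star_mul : star u * u = 1

variable {S} in
/-- The matrix of the coaction in an orthonormal basis is unitary: the invariance of the inner
product provides the right inverse `u*`, and the antipode provides a left inverse. -/
theorem IsUnitaryFamily.of_coaction_eq {m : ℕ} {w : Fin m → Ω} {u : Matrix (Fin m) (Fin m) A}
    (h1 : ∀ i, S.coaction (w i) = ∑ j, u i j ⊗ₜ[ℂ] w j)
    (h2 : ∀ i j, S.form (w i) (w j) = if i = j then 1 else 0) : S.IsUnitaryFamily w u := by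
  have hu : ∀ i j, coslice (S.formLeft (w j)) (S.coaction (w i)) = u i j := fun i j => by
    rw [h1, map_sum]
    simp [h2]
  have hright : u * star u = 1 := by
    ext i k
    rw [Matrix.mul_apply, Matrix.one_apply]
    have := S.form_invariant (h1 i) (h1 k)
    simp only [h2, ite_smul, one_smul, zero_smul, Finset.sum_ite_eq, Finset.mem_univ,
      if_true] at this
    exact this
  have hcomul : ∀ i j, Coalgebra.comul (u i j) = ∑ k, u i k ⊗ₜ[ℂ] u k j := by
    intro i j
    have h3 := congrArg ((coslice (S.formLeft (w j))).lTensor A) (S.coaction_coassoc (w i))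
    have h4 : ∀ (t : A ⊗[ℂ] A) (ω : Ω), (coslice (S.formLeft (w j))).lTensor A
        (TensorProduct.assoc ℂ A A Ω (t ⊗ₜ[ℂ] ω)) = S.form ω (w j) • t := by
      intro t ω
      induction t using TensorProduct.induction_on with
      | zero => simp
      | tmul a c => simp
      | add x y hx hy => simp only [TensorProduct.add_tmul, map_add, smul_add, hx, hy]
    simp only [h1 i, map_sum, LinearMap.rTensor_tmul, LinearMap.lTensor_tmul, h4, h2,
      AlgHom.toLinearMap_apply, hu, ite_smul, one_smul, zero_smul, Finset.sum_ite_eq',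
      Finset.mem_univ, if_true] at h3
    exact h3
  have hcounit : ∀ i j, Coalgebra.counit (R := ℂ) (u i j) = if i = j then 1 else 0 := by
    intro i j
    rw [← hu, apply_coslice]
    change S.form (S.act Coalgebra.counit (w i)) (w j) = _
    rw [act_counit, h2]
  have hleft : Matrix.of (fun i j => HopfAlgebra.antipode ℂ (u i j)) * u = 1 := by
    ext i j
    have := HopfAlgebra.mul_antipode_rTensor_comul_apply (R := ℂ) (u i j)
    simp only [hcomul, map_sum, LinearMap.rTensor_tmul, LinearMap.mul'_apply, hcounit] at this
    rw [Matrix.mul_apply, Matrix.one_apply]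
    simp only [Matrix.of_apply, this]
    split_ifs <;> simp
  have hstar := left_inv_eq_right_inv hleft hright
  refine ⟨h1, h2, hright, fun i j => congrFun (congrFun hstar i) j, hcounit, ?_⟩
  rw [← hstar, hleft]

theorem act_mem_sliceRange {ω y : Ω} (f : A →ₗ[ℂ] ℂ) (hy : y ∈ sliceRange (S.coaction ω)) :
    S.act f y ∈ sliceRange (S.coaction ω) := by
  obtain ⟨g, rfl⟩ := hy
  exact ⟨convFunctional g f, (S.act_act g f ω).symm⟩

/-- Local finiteness of the coaction: any finite set of forms lies in the span of a unitary
family. -/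
theorem exists_unitaryFamily (s : Finset Ω) : ∃ (m : ℕ) (w : Fin m → Ω)
    (u : Matrix (Fin m) (Fin m) A), S.IsUnitaryFamily w u ∧
      ∀ x ∈ s, x ∈ Submodule.span ℂ (Set.range w) := by
  let W₀ : Submodule ℂ Ω := ⨆ x : s, sliceRange (S.coaction x)
  let W : Submodule ℂ S.Forms := W₀
  have hWfin : FiniteDimensional ℂ W := inferInstanceAs (FiniteDimensional ℂ W₀)
  have hWact : ∀ f, ∀ y ∈ W₀, S.act f y ∈ W₀ := by
    intro f y hy
    induction hy using Submodule.iSup_induction' with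
    | mem x y hy => exact Submodule.mem_iSup_of_mem x (S.act_mem_sliceRange f hy)
    | zero => rw [map_zero]; exact zero_mem _
    | add x y _ _ hx hy => rw [map_add]; exact add_mem hx hy
  let e := stdOrthonormalBasis ℂ W
  let w : Fin (Module.finrank ℂ W) → Ω := fun i => (e i : S.Forms)
  have hexp : ∀ y ∈ W₀, y = ∑ j, S.form y (w j) • w j := by
    intro y hy
    have := e.sum_repr' ⟨y, hy⟩
    have h2 := congrArg Subtype.val this
    rw [Submodule.coe_sum] at h2
    exact h2.symm
  refine ⟨_, w, Matrix.of fun i j => coslice (S.formLeft (w j)) (S.coaction (w i)),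
    .of_coaction_eq (fun i => slice_ext fun f => ?_) fun i j => ?_, fun x hx => ?_⟩
  · rw [map_sum]
    simp only [slice_tmul, Matrix.of_apply, apply_coslice]
    exact hexp _ (hWact f _ (e i).2)
  · have := orthonormal_iff_ite.mp e.orthonormal j i
    rw [Submodule.coe_inner, inner_eq_form] at this
    refine this.trans ?_
    simp only [eq_comm]
  · have hxW : x ∈ W₀ := by
      refine Submodule.mem_iSup_of_mem (⟨x, hx⟩ : s) ?_
      exact ⟨Coalgebra.counit, S.act_counit x⟩
    rw [hexp x hxW]
    exact sum_mem fun j _ => Submodule.smul_mem _ _ (Submodule.subset_span ⟨j, rfl⟩)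

/-- The functional `a ↦ conj (f (S(a)*))`, whose action on the forms is adjoint to that of `f`. -/
def adjFunctional (f : A →ₗ[ℂ] ℂ) : A →ₗ[ℂ] ℂ where
  toFun a := (starRingEnd ℂ) (f (star (HopfAlgebra.antipode ℂ a)))
  map_add' x y := by simp
  map_smul' r x := by simp

variable {S} in
theorem IsUnitaryFamily.act_eq {m : ℕ} {w : Fin m → Ω} {u : Matrix (Fin m) (Fin m) A}
    (hw : S.IsUnitaryFamily w u) (f : A →ₗ[ℂ] ℂ) (i : Fin m) :
    S.act f (w i) = ∑ j, f (u i j) • w j := by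
  rw [act_apply, hw.coaction_eq, map_sum]; rfl

/-- For every form there is an operator of finite rank, given by the Haar functional, which fixes
the form together with its adjoint. -/
theorem exists_act_haarMul_eq_and_adj (ω : Ω) :
    ∃ x : A, S.act (haarMul x) ω = ω ∧ S.act (adjFunctional (haarMul x)) ω = ω := by
  obtain ⟨m, w, u, hw, hspan⟩ := S.exists_unitaryFamily {ω}
  have hω := hspan ω (by simp)
  clear hspan
  have := FiniteDimensional.span_of_finite ℂ
    (Set.finite_range fun p : Fin m × Fin m => u p.1 p.2)
  obtain ⟨x, hx⟩ := exists_haarMul_eq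
    (Submodule.span ℂ (Set.range fun p : Fin m × Fin m => u p.1 p.2)) Coalgebra.counit
  have hx' : ∀ i j, haarMul x (u i j) = if i = j then 1 else 0 := fun i j => by
    rw [hx _ (Submodule.subset_span ⟨(i, j), rfl⟩), hw.counit_eq]
  refine ⟨x, ?_, ?_⟩
  · induction hω using Submodule.span_induction with
    | zero => rw [map_zero]
    | add x y _ _ hx hy => rw [map_add, hx, hy]
    | smul c x _ hx => rw [map_smul, hx]
    | mem y hy =>
      obtain ⟨i, rfl⟩ := hy
      rw [hw.act_eq]
      simp only [hx', ite_smul, one_smul, zero_smul, Finset.sum_ite_eq, Finset.mem_univ, if_true]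
  · induction hω using Submodule.span_induction with
    | zero => rw [map_zero]
    | add x y _ _ hx hy => rw [map_add, hx, hy]
    | smul c x _ hx => rw [map_smul, hx]
    | mem y hy =>
      obtain ⟨i, rfl⟩ := hy
      have h : ∀ j, adjFunctional (haarMul x) (u i j) = if i = j then 1 else 0 := fun j => by
        change (starRingEnd ℂ) (haarMul x (star (HopfAlgebra.antipode ℂ (u i j)))) = _
        rw [hw.antipode_eq, star_star, hx']
        simp only [eq_comm, apply_ite (starRingEnd ℂ), map_one, map_zero]
      rw [hw.act_eq]
      simp only [h, ite_smul, one_smul, zero_smul, Finset.sum_ite_eq, Finset.mem_univ, if_true]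

end CQHHermitianSpace

/-! ### Boundedness of left linear maps -/

section HaarNorm

variable {A : Type*} [Ring A] [HopfAlgebra ℂ A] [StarRing A] [StarModule ℂ A] [CQGA A]

/-- The square `haar (a a*)` of the norm for which right multiplications are to be bounded. -/
def haarSq (a : A) : ℝ := (haar A (a * star a)).re

theorem haarSq_nonneg (a : A) : 0 ≤ haarSq a :=
  (Complex.nonneg_iff.mp (haar_mul_star_self_nonneg a)).1

theorem haar_mul_star_self (a : A) : haar A (a * star a) = (haarSq a : ℂ) :=
  Complex.ext rfl (Complex.nonneg_iff.mp (haar_mul_star_self_nonneg a)).2.symm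

theorem eq_zero_of_haarSq_eq_zero {a : A} (h : haarSq a = 0) : a = 0 := by
  by_contra ha
  have h1 := haar_pos (a := star a) (star_ne_zero.mpr ha)
  rw [star_star, haar_mul_star_self, h] at h1
  simp at h1

theorem haarSq_add_le (a b : A) : haarSq (a + b) ≤ 2 * haarSq a + 2 * haarSq b := by
  have h := haarSq_nonneg (a - b)
  simp only [haarSq, star_add, star_sub, add_mul, mul_add, sub_mul, mul_sub, map_add, map_sub,
    Complex.add_re, Complex.sub_re] at h ⊢
  linarith

theorem haarSq_smul (c : ℂ) (a : A) : haarSq (c • a) = ‖c‖ ^ 2 * haarSq a := by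
  have h : c * (starRingEnd ℂ) c = ((‖c‖ ^ 2 : ℝ) : ℂ) := by
    rw [Complex.mul_conj, Complex.normSq_eq_norm_sq]
  rw [haarSq, star_smul, smul_mul_smul_comm, Complex.star_def, h, map_smul, smul_eq_mul,
    Complex.re_ofReal_mul, haarSq]

variable (A) in
/-- The elements `x` for which right multiplication by `x` is bounded for the norm given by
`haar (a a*)`. -/
def rightBounded : Submodule ℂ A where
  carrier := {x | ∃ C : ℝ, 0 ≤ C ∧ ∀ c, haarSq (c * x) ≤ C * haarSq c}
  zero_mem' := ⟨0, le_rfl, fun c => by simp [haarSq]⟩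
  add_mem' := by
    rintro x y ⟨C, hC, hx⟩ ⟨D, hD, hy⟩
    refine ⟨2 * C + 2 * D, by positivity, fun c => ?_⟩
    rw [mul_add]
    have := haarSq_add_le (c * x) (c * y)
    linarith [hx c, hy c]
  smul_mem' := by
    rintro r x ⟨C, hC, hx⟩
    refine ⟨‖r‖ ^ 2 * C, by positivity, fun c => ?_⟩
    rw [mul_smul_comm, haarSq_smul, mul_assoc]
    exact mul_le_mul_of_nonneg_left (hx c) (by positivity)

/-- The entries of a unitary matrix act by contractions. -/
theorem mem_rightBounded_of_unitary {m : ℕ} {u : Matrix (Fin m) (Fin m) A} (hu : u * star u = 1)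
    (i j : Fin m) : u i j ∈ rightBounded A := by
  refine ⟨1, zero_le_one, fun c => ?_⟩
  have h1 : ∑ k, u i k * star (u i k) = 1 := by
    have := congrFun (congrFun hu i) i
    rwa [Matrix.mul_apply, Matrix.one_apply_eq] at this
  have h2 : ∑ k, haarSq (c * u i k) = haarSq c := by
    simp only [haarSq]
    rw [← Complex.re_sum, ← map_sum]
    have h3 : ∑ k, c * u i k * star (c * u i k) = c * (∑ k, u i k * star (u i k)) * star c := by
      simp only [star_mul, Finset.mul_sum, Finset.sum_mul, mul_assoc]
    rw [h3, h1, mul_one]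
  rw [one_mul, ← h2]
  exact Finset.single_le_sum (f := fun k => haarSq (c * u i k)) (fun k _ => haarSq_nonneg _)
    (Finset.mem_univ j)

end HaarNorm

namespace CQHHermitianSpace

variable {A H Ω : Type*}
  [Ring A] [HopfAlgebra ℂ A] [StarRing A] [StarModule ℂ A] [CQGA A]
  [Ring H] [HopfAlgebra ℂ H] [StarRing H] [StarModule ℂ H] [CQGA H]
  [Ring Ω] [Algebra ℂ Ω] (S : CQHHermitianSpace A H Ω)

/-- Right multiplication by an element of `B` is bounded, since `B` consists of coefficients of
unitary corepresentations. -/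
theorem coe_mem_rightBounded (b : S.B) : (b : A) ∈ rightBounded A := by
  obtain ⟨m, w, u, hw, hb⟩ := S.exists_unitaryFamily {S.calculus.incl b}
  let ψ : Ω →ₗ[ℂ] ℂ := Coalgebra.counit ∘ₗ coinvariantsIncl S.π S.π_star ∘ₗ S.calculus.toBase
  have h1 : coslice ψ (S.coaction (S.calculus.incl b)) = (b : A) := by
    have h2 : coslice Coalgebra.counit (Coalgebra.comul (b : A)) = (b : A) := by
      change TensorProduct.rid ℂ A (Coalgebra.counit.lTensor A (Coalgebra.comul (b : A))) = _
      rw [Coalgebra.lTensor_counit_comul]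
      simp
    rw [← h2, ← lTensor_leftCoaction S.π S.π_star b, S.coaction_incl, coslice_lTensor,
      coslice_lTensor]
    congr 1
    congr 1
    ext b
    simp [ψ, S.calculus.toBase_incl]
  have h3 : ∀ y ∈ Submodule.span ℂ (Set.range w), coslice ψ (S.coaction y) ∈ rightBounded A := by
    intro y hy
    induction hy using Submodule.span_induction with
    | mem y hy =>
      obtain ⟨i, rfl⟩ := hy
      rw [hw.coaction_eq, map_sum]
      exact sum_mem fun j _ => Submodule.smul_mem _ _ (mem_rightBounded_of_unitary hw.mul_star i j)
    | zero => rw [map_zero, map_zero]; exact zero_mem _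
    | add x y _ _ hx hy => rw [map_add, map_add]; exact add_mem hx hy
    | smul c x _ hx => rw [map_smul, map_smul]; exact Submodule.smul_mem _ _ hx
  rw [← h1]
  exact h3 _ (hb _ (Finset.mem_singleton_self _))

theorem G_incl_mul_left (b : S.B) (ω ν : Ω) : S.G (S.calculus.incl b * ω) ν = b * S.G ω ν :=
  S.hermitian.baseMetric_incl_mul_left S.positive b ω ν

theorem G_incl_mul_right (b : S.B) (ω ν : Ω) : S.G ω (S.calculus.incl b * ν) = S.G ω ν * star b :=
  S.hermitian.baseMetric_incl_mul_right S.positive b ω ν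

/-- The metric is hermitian: both sides have the same inner products with `B`, and the Haar
functional is faithful. -/
theorem star_G (ω ν : Ω) : star (S.G ω ν) = S.G ν ω := by
  have h1 : ∀ b : S.B, haar A ((b * (S.G ν ω - star (S.G ω ν)) : S.B) : A) = 0 := by
    intro b
    have h2 : haar A ((b * S.G ν ω : S.B) : A) = S.form (S.calculus.incl b * ν) ω := by
      rw [form_eq, G_incl_mul_left]
    have h3 : haar A ((b * star (S.G ω ν) : S.B) : A) =
        (starRingEnd ℂ) (S.form ω (S.calculus.incl b * ν)) := by
      rw [form_eq, G_incl_mul_right, ← haar_star]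
      simp
    rw [form_conj_symm, ← h2] at h3
    rw [mul_sub]
    simp only [AddSubgroupClass.coe_sub, map_sub]
    rw [h3, sub_self]
  by_contra h
  have h2 : ((S.G ν ω - star (S.G ω ν) : S.B) : A) ≠ 0 := fun h0 =>
    h (sub_eq_zero.mp (Subtype.ext h0)).symm
  have h3 := haar_pos h2
  have h4 := h1 (star (S.G ν ω - star (S.G ω ν)))
  rw [MulMemClass.coe_mul, StarMemClass.coe_star] at h4
  exact h3.ne' h4

/-- The norm of a form, for the inner product `form`. -/
def formNorm (ω : Ω) : ℝ := @norm S.Forms _ ω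

theorem formNorm_nonneg (ω : Ω) : 0 ≤ S.formNorm ω := @norm_nonneg S.Forms _ ω

theorem formNorm_sq (ω : Ω) : S.formNorm ω ^ 2 = (S.form ω ω).re :=
  @norm_sq_eq_re_inner ℂ S.Forms _ _ _ ω

theorem norm_form_le (ω ν : Ω) : ‖S.form ω ν‖ ≤ S.formNorm ω * S.formNorm ν := by
  rw [mul_comm]
  exact @norm_inner_le_norm ℂ S.Forms _ _ _ ν ω

theorem formNorm_sum_le {ι : Type*} (s : Finset ι) (f : ι → Ω) :
    S.formNorm (∑ i ∈ s, f i) ≤ ∑ i ∈ s, S.formNorm (f i) :=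
  @norm_sum_le ι S.Forms _ s f

theorem G_self_mem_closure (ξ : Ω) :
    S.G ξ ξ ∈ AddSubmonoid.closure (Set.range fun c : S.B => star c * c) := by
  rcases eq_or_ne ξ 0 with rfl | hξ
  · rw [G, HermitianStructure.baseMetric_zero_left]; exact zero_mem _
  · obtain ⟨b, hb, -, h⟩ := S.positive ξ hξ
    have : S.G ξ ξ = b := by
      change S.calculus.toBase (S.hermitian.metric ξ ξ) = b
      rw [h, S.calculus.toBase_incl]
    rw [this]; exact hb

/-- The map `b ↦ b ξ` from `B` to the forms is bounded. -/
theorem exists_formNorm_incl_mul_le (ξ : Ω) : ∃ C : ℝ, 0 ≤ C ∧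
    ∀ b : S.B, S.formNorm (S.calculus.incl b * ξ) ≤ C * √(haarSq (b : A)) := by
  have key : ∀ x ∈ AddSubmonoid.closure (Set.range fun c : S.B => star c * c),
      ∃ C : ℝ, 0 ≤ C ∧ ∀ b : S.B,
        (haar A ((b * x * star b : S.B) : A)).re ≤ C * haarSq (b : A) := by
    intro x hx
    induction hx using AddSubmonoid.closure_induction with
    | mem x hx =>
      obtain ⟨c, rfl⟩ := hx
      obtain ⟨C, hC, h⟩ := S.coe_mem_rightBounded (star c)
      refine ⟨C, hC, fun b => ?_⟩
      refine le_of_eq_of_le ?_ (h b)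
      simp [haarSq, mul_assoc]
    | zero => exact ⟨0, le_rfl, fun b => by simp⟩
    | add x y _ _ hx hy =>
      obtain ⟨C, hC, hx⟩ := hx
      obtain ⟨D, hD, hy⟩ := hy
      refine ⟨C + D, by positivity, fun b => ?_⟩
      have := add_le_add (hx b) (hy b)
      rw [mul_add, add_mul, add_mul, AddMemClass.coe_add, map_add, Complex.add_re]
      exact this
  obtain ⟨C, hC, h⟩ := key _ (S.G_self_mem_closure ξ)
  refine ⟨√C, Real.sqrt_nonneg _, fun b => ?_⟩
  rw [← Real.sqrt_mul hC]
  refine Real.le_sqrt_of_sq_le ?_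
  rw [formNorm_sq, form_eq, G_incl_mul_left, G_incl_mul_right, ← mul_assoc]
  exact h b

/-- The map `ω ↦ g(ω, η)` from the forms to `B` is bounded, being adjoint to `b ↦ b η`. -/
theorem exists_haarSq_G_le (η : Ω) : ∃ C : ℝ, 0 ≤ C ∧
    ∀ ω, √(haarSq (S.G ω η : A)) ≤ C * S.formNorm ω := by
  obtain ⟨C, hC, h⟩ := S.exists_formNorm_incl_mul_le η
  refine ⟨C, hC, fun ω => ?_⟩
  set r := √(haarSq (S.G ω η : A)) with hr
  have hr2 : r ^ 2 = haarSq (S.G ω η : A) := Real.sq_sqrt (haarSq_nonneg _)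
  have h1 : S.form (S.calculus.incl (S.G ω η) * η) ω = (haarSq (S.G ω η : A) : ℂ) := by
    rw [← haar_mul_star_self, form_eq, G_incl_mul_left, ← S.star_G ω η]
    rfl
  have h2 := S.norm_form_le (S.calculus.incl (S.G ω η) * η) ω
  rw [h1, Complex.norm_real, Real.norm_of_nonneg (haarSq_nonneg _), ← hr2] at h2
  have h3 := h (S.G ω η)
  rw [← hr] at h3
  have h4 := S.formNorm_nonneg ω
  rcases (Real.sqrt_nonneg (haarSq (S.G ω η : A))).eq_or_lt with h0 | h0
  · rw [hr, ← h0]; positivity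
  · rw [← hr] at h0
    have h5 : r * r ≤ r * (C * S.formNorm ω) := by nlinarith
    exact le_of_mul_le_mul_left h5 h0

theorem exists_coaction_eq_sum (ω : Ω) : ∃ (n : ℕ) (a : Fin n → A) (x : Fin n → Ω),
    S.coaction ω = ∑ k, a k ⊗ₜ[ℂ] x k := by
  obtain ⟨n, a, x, h⟩ := TensorProduct.exists_sum_tmul_eq (S.coaction ω)
  exact ⟨n, a, x, h⟩

/-- The operator `ω ↦ ∑ g(ω, wᵢ) wᵢ`. -/
def frameOp {m : ℕ} (w : Fin m → Ω) : Ω →ₗ[ℂ] Ω :=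
  ∑ i, LinearMap.mulRight ℂ (w i) ∘ₗ S.calculus.incl.toLinearMap ∘ₗ
    S.hermitian.baseMetricLeft (w i)

theorem frameOp_apply {m : ℕ} (w : Fin m → Ω) (ω : Ω) :
    S.frameOp w ω = ∑ i, S.calculus.incl (S.G ω (w i)) * w i := by
  simp only [frameOp, LinearMap.sum_apply]
  rfl

variable {S} in
/-- The frame operator of a unitary family is a comodule map. -/
theorem IsUnitaryFamily.act_frameOp {m : ℕ} {w : Fin m → Ω} {u : Matrix (Fin m) (Fin m) A}
    (hw : S.IsUnitaryFamily w u) (f : A →ₗ[ℂ] ℂ) (ω : Ω) :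
    S.act f (S.frameOp w ω) = S.frameOp w (S.act f ω) := by
  obtain ⟨n, a, x, h⟩ := S.exists_coaction_eq_sum ω
  have hu : ∀ j l, ∑ i, star (u i j) * u i l = if j = l then 1 else 0 := by
    intro j l
    have := congrFun (congrFun hw.star_mul j) l
    rwa [Matrix.mul_apply, Matrix.one_apply] at this
  have h1 : S.coaction (S.frameOp w ω) = (S.frameOp w).lTensor A (S.coaction ω) := by
    have h2 : ∀ i, S.coaction (S.calculus.incl (S.G ω (w i)) * w i) = ∑ k, ∑ j, ∑ l,
        (a k * (star (u i j) * u i l)) ⊗ₜ[ℂ] (S.calculus.incl (S.G (x k) (w j)) * w l) := by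
      intro i
      rw [map_mul, S.coaction_incl_G h (hw.coaction_eq _), hw.coaction_eq]
      simp only [Finset.sum_mul, Finset.mul_sum, Algebra.TensorProduct.tmul_mul_tmul, mul_assoc]
      rw [Finset.sum_comm]
      exact Finset.sum_congr rfl fun k _ => Finset.sum_comm
    have h3 : ∀ k j l, ∑ i, (a k * (star (u i j) * u i l)) ⊗ₜ[ℂ]
        (S.calculus.incl (S.G (x k) (w j)) * w l) =
        if j = l then a k ⊗ₜ[ℂ] (S.calculus.incl (S.G (x k) (w j)) * w j) else 0 := by
      intro k j l
      rw [← TensorProduct.sum_tmul, ← Finset.mul_sum, hu]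
      split_ifs with hjl
      · rw [mul_one, hjl]
      · rw [mul_zero, TensorProduct.zero_tmul]
    rw [frameOp_apply, map_sum, Finset.sum_congr rfl fun i _ => h2 i, Finset.sum_comm, h, map_sum]
    refine Finset.sum_congr rfl fun k _ => ?_
    rw [Finset.sum_comm, LinearMap.lTensor_tmul, frameOp_apply, TensorProduct.tmul_sum]
    refine Finset.sum_congr rfl fun j _ => ?_
    rw [Finset.sum_comm, Finset.sum_congr rfl fun l _ => h3 k j l]
    simp
  rw [act_apply, h1, slice_lTensor, act_apply]

/-- The frame operator of a generating family is injective. -/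
theorem frameOp_injective {m : ℕ} {w : Fin m → Ω}
    (hgen : ∀ ω, ∃ c : Fin m → S.B, ω = ∑ i, S.calculus.incl (c i) * w i) :
    Function.Injective (S.frameOp w) := by
  refine (injective_iff_map_eq_zero _).mpr fun ω hω => ?_
  have h1 : S.form (S.frameOp w ω) ω = ((∑ i, haarSq (S.G ω (w i) : A) : ℝ) : ℂ) := by
    rw [frameOp_apply]
    change S.formLeft ω _ = _
    rw [map_sum, Complex.ofReal_sum]
    refine Finset.sum_congr rfl fun i _ => ?_
    rw [formLeft_apply, ← haar_mul_star_self, form_eq, G_incl_mul_left, ← S.star_G ω (w i)]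
    rfl
  have h0 : S.form 0 ω = 0 := map_zero (S.formLeft ω)
  rw [hω, h0, eq_comm, Complex.ofReal_eq_zero,
    Finset.sum_eq_zero_iff_of_nonneg fun i _ => haarSq_nonneg _] at h1
  have h2 : ∀ i, S.G ω (w i) = 0 := fun i =>
    Subtype.ext (eq_zero_of_haarSq_eq_zero (h1 i (Finset.mem_univ i)))
  by_contra hne
  have h3 := S.form_self_pos hne
  obtain ⟨c, hc⟩ := hgen ω
  have h4 : S.G ω (∑ i, S.calculus.incl (c i) * w i) = 0 := by
    rw [G, HermitianStructure.baseMetric_sum_right]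
    refine Finset.sum_eq_zero fun i _ => ?_
    change S.G ω _ = 0
    rw [G_incl_mul_right, h2, zero_mul]
  rw [← hc] at h4
  rw [form_eq, h4] at h3
  simp at h3

/-- The forms have a finite dual basis for the `B`-valued metric. The frame operator of a generating
unitary family is a comodule map, so it preserves the finite-dimensional ranges of the operators
given by the Haar functional. As it is injective, it is bijective. -/
theorem exists_dual_basis : ∃ (m : ℕ) (w ξ : Fin m → Ω),
    ∀ ω, ω = ∑ i, S.calculus.incl (S.G ω (w i)) * ξ i := by
  obtain ⟨s, hs⟩ := S.exists_generators
  obtain ⟨m, w, u, hw, hsw⟩ := S.exists_unitaryFamily s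
  have hgen : ∀ ω, ∃ c : Fin m → S.B, ω = ∑ i, S.calculus.incl (c i) * w i := by
    intro ω
    choose! l hl using fun y hy => (Submodule.mem_span_range_iff_exists_fun ℂ).mp (hsw y hy)
    obtain ⟨c, rfl⟩ := hs ω
    refine ⟨fun i => ∑ y ∈ s, l y i • c y, ?_⟩
    simp only [map_sum, map_smul, Finset.sum_mul]
    rw [Finset.sum_comm]
    refine Finset.sum_congr rfl fun y hy => ?_
    have hy' : S.calculus.incl (c y) * y = S.calculus.incl (c y) * ∑ i, l y i • w i := by
      rw [hl y hy]
    rw [hy', Finset.mul_sum]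
    simp
  have hinj := S.frameOp_injective hgen
  have hsurj : Function.Surjective (S.frameOp w) := by
    intro ω
    obtain ⟨x, hx, -⟩ := S.exists_act_haarMul_eq_and_adj ω
    have := S.finiteDimensional_range_act_haarMul x
    have hK : ∀ y ∈ LinearMap.range (S.act (haarMul x)),
        S.frameOp w y ∈ LinearMap.range (S.act (haarMul x)) := by
      rintro _ ⟨y, rfl⟩
      exact ⟨S.frameOp w y, hw.act_frameOp _ _⟩
    have h1 : Function.Injective ((S.frameOp w).restrict hK) :=
      fun a b hab => Subtype.ext (hinj (congrArg Subtype.val hab))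
    obtain ⟨y, hy⟩ := LinearMap.injective_iff_surjective.mp h1 ⟨ω, ω, hx⟩
    exact ⟨y, congrArg Subtype.val hy⟩
  choose ξ hξ using fun i => hsurj (w i)
  refine ⟨m, w, ξ, fun ω => hinj ?_⟩
  rw [map_sum]
  have hlin : ∀ (b : S.B) ν, S.frameOp w (S.calculus.incl b * ν) =
      S.calculus.incl b * S.frameOp w ν := by
    intro b ν
    simp only [frameOp_apply, G_incl_mul_left, map_mul, Finset.mul_sum, mul_assoc]
  simp only [hlin, hξ]
  exact S.frameOp_apply w ω

/-- Every left `B`-linear map on the forms is bounded. -/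
theorem exists_formNorm_le {X : Ω →ₗ[ℂ] Ω}
    (hX : ∀ b ω, X (S.calculus.incl b * ω) = S.calculus.incl b * X ω) :
    ∃ C : ℝ, 0 ≤ C ∧ ∀ ω, S.formNorm (X ω) ≤ C * S.formNorm ω := by
  obtain ⟨m, w, ξ, h⟩ := S.exists_dual_basis
  choose C hC hC' using fun i => S.exists_haarSq_G_le (w i)
  choose D hD hD' using fun i => S.exists_formNorm_incl_mul_le (X (ξ i))
  refine ⟨∑ i, D i * C i, Finset.sum_nonneg fun i _ => mul_nonneg (hD i) (hC i), fun ω => ?_⟩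
  conv_lhs => rw [h ω]
  rw [map_sum, Finset.sum_mul]
  refine (S.formNorm_sum_le _ _).trans (Finset.sum_le_sum fun i _ => ?_)
  rw [hX, mul_assoc]
  exact (hD' i _).trans (mul_le_mul_of_nonneg_left (hC' i ω) (hD i))

/-! ### Sesquilinearity of the inner product, and orthogonality -/

theorem form_zero_left (ω : Ω) : S.form 0 ω = 0 := map_zero (S.formLeft ω)

theorem form_neg_left (x y : Ω) : S.form (-x) y = -S.form x y := map_neg (S.formLeft y) x

theorem form_sub_left (x y z : Ω) : S.form (x - y) z = S.form x z - S.form y z :=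
  map_sub (S.formLeft z) x y

theorem form_zero_right (ω : Ω) : S.form ω 0 = 0 := by
  rw [← form_conj_symm, form_zero_left, map_zero]

theorem form_neg_right (x y : Ω) : S.form x (-y) = -S.form x y := by
  rw [← form_conj_symm, form_neg_left, map_neg, form_conj_symm]

theorem form_sub_right (x y z : Ω) : S.form x (y - z) = S.form x y - S.form x z := by
  rw [sub_eq_add_neg, form_add_right, form_neg_right, ← sub_eq_add_neg]

theorem ext_form_right {y z : Ω} (h : ∀ x, S.form x y = S.form x z) : y = z := by
  rw [← sub_eq_zero]
  by_contra hne
  have := S.form_self_pos hne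
  rw [form_sub_right, h, sub_self] at this
  exact lt_irrefl _ this

/-- Right multiplication is a `*`-representation. -/
theorem form_mul_incl (b : S.B) (ω ν : Ω) :
    S.form (ω * S.calculus.incl b) ν = S.form ω (ν * S.calculus.incl (star b)) := by
  rw [form_eq, form_eq, G, G, S.hermitian.baseMetric_mul_incl S.positive]

/-- Forms of different bidegree are orthogonal, so the adjoint of a diagonal operator has the
conjugate scalars. -/
theorem form_diag (c : ℕ × ℕ → ℂ) (x y : Ω) : S.form (S.hermitian.diag c x) y =
    S.form x (S.hermitian.diag (fun p => (starRingEnd ℂ) (c p)) y) := by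
  rw [form_eq, form_eq, G, G, S.hermitian.baseMetric_diag S.positive]

theorem form_parity (x y : Ω) :
    S.form (S.hermitian.parity x) y = S.form x (S.hermitian.parity y) := by
  rw [ComplexStructure.parity, form_diag]; simp

theorem form_antiProj (x y : Ω) :
    S.form (S.hermitian.antiProj x) y = S.form x (S.hermitian.antiProj y) := by
  rw [ComplexStructure.antiProj, form_diag]
  simp only [apply_ite (starRingEnd ℂ), map_one, map_zero]

theorem formNorm_parity (x : Ω) : S.formNorm (S.hermitian.parity x) = S.formNorm x := by
  have h : S.formNorm (S.hermitian.parity x) ^ 2 = S.formNorm x ^ 2 := by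
    rw [formNorm_sq, form_parity, S.hermitian.parity_parity, formNorm_sq]
  exact (pow_left_inj₀ (S.formNorm_nonneg _) (S.formNorm_nonneg _) two_ne_zero).mp h

/-! ### Adjoints of comodule maps -/

/-- The action of a functional is adjointable, by unitarity of the corepresentations. -/
theorem form_act (f : A →ₗ[ℂ] ℂ) (ω ν : Ω) :
    S.form (S.act f ω) ν = S.form ω (S.act (adjFunctional f) ν) := by
  classical
  obtain ⟨m, w, u, hw, hspan⟩ := S.exists_unitaryFamily {ω, ν}
  have hω := hspan ω (by simp)
  have hν := hspan ν (by simp)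
  clear hspan
  induction hω using Submodule.span_induction with
  | zero => rw [map_zero, form_zero_left, form_zero_left]
  | add x y _ _ hx hy => rw [map_add, form_add_left, form_add_left, hx, hy]
  | smul c x _ hx => rw [map_smul, form_smul_left, form_smul_left, hx]
  | mem x hx =>
    obtain ⟨i, rfl⟩ := hx
    induction hν using Submodule.span_induction with
    | zero => rw [map_zero, form_zero_right, form_zero_right]
    | add x y _ _ hx hy => rw [map_add, form_add_right, form_add_right, hx, hy]
    | smul c x _ hx => rw [map_smul, form_smul_right, form_smul_right, hx]
    | mem x hx =>
      obtain ⟨j, rfl⟩ := hx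
      have h1 : S.form (S.act f (w i)) (w j) = f (u i j) := by
        rw [hw.act_eq, ← formLeft_apply, map_sum]
        simp [hw.form_eq]
      have h2 : S.form (S.act (adjFunctional f) (w j)) (w i) = adjFunctional f (u j i) := by
        rw [hw.act_eq, ← formLeft_apply, map_sum]
        simp [hw.form_eq]
      rw [h1, ← form_conj_symm, h2]
      simp [adjFunctional, hw.antipode_eq]

/-- Riesz representation on a finite-dimensional space of forms. -/
theorem exists_form_eq (E : Submodule ℂ Ω) [hE : FiniteDimensional ℂ E] (φ : Ω →ₗ[ℂ] ℂ) :
    ∃ ν, ∀ ω ∈ E, φ ω = S.form ω ν := by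
  let E' : Submodule ℂ S.Forms := E
  let φ' : S.Forms →ₗ[ℂ] ℂ := φ
  have : FiniteDimensional ℂ E' := hE
  have : CompleteSpace E' := FiniteDimensional.complete ℂ E'
  let ν := (InnerProductSpace.toDual ℂ E').symm
    (LinearMap.toContinuousLinearMap (φ' ∘ₗ E'.subtype))
  refine ⟨(ν : S.Forms), fun ω hω => ?_⟩
  exact (InnerProductSpace.toDual_symm_apply (𝕜 := ℂ) (E := E') (x := ⟨ω, hω⟩)
    (y := LinearMap.toContinuousLinearMap (φ' ∘ₗ E'.subtype))).symm

/-- A comodule map on the forms is adjointable. -/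
theorem exists_adjoint {X : Ω →ₗ[ℂ] Ω} (hX : ∀ f ω, S.act f (X ω) = X (S.act f ω)) :
    ∃ Y : Ω →ₗ[ℂ] Ω, ∀ ω ν, S.form (X ω) ν = S.form ω (Y ν) := by
  have h : ∀ ν, ∃ ν', ∀ ω, S.form (X ω) ν = S.form ω ν' := by
    intro ν
    obtain ⟨x, -, hx⟩ := S.exists_act_haarMul_eq_and_adj ν
    have := S.finiteDimensional_range_act_haarMul x
    obtain ⟨e, he⟩ := S.exists_form_eq (LinearMap.range (S.act (haarMul x))) (S.formLeft ν ∘ₗ X)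
    refine ⟨S.act (adjFunctional (haarMul x)) e, fun ω => ?_⟩
    rw [← form_act, ← he _ ⟨ω, rfl⟩]
    -- `X` commutes with the action, so only the finite-dimensional range of the action matters.
    conv_lhs => rw [← hx]
    rw [← form_act, hX]
    rfl
  choose Y hY using h
  refine ⟨{ toFun := Y, map_add' := fun x y => ?_, map_smul' := fun r x => ?_ }, fun ω ν => hY ν ω⟩
  · refine S.ext_form_right fun ω => ?_
    rw [← hY, form_add_right, form_add_right, hY, hY]
  · refine S.ext_form_right fun ω => ?_
    rw [← hY, RingHom.id_apply, form_smul_right, form_smul_right, hY]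

/-! ### The Dolbeault–Dirac operator on forms -/

/-- The adjoint of `∂̄`, as an operator on `Ω`. -/
def dbarAdj : Ω →ₗ[ℂ] Ω := preAdjoint S.dbar

/-- The operator `∂̄` is a comodule map, so it is adjointable, and `preAdjoint` takes its intended
value. -/
theorem form_dbar (ω ν : Ω) : S.form (S.hermitian.dbar ω) ν = S.form ω (S.dbarAdj ν) := by
  obtain ⟨Y, hY⟩ := S.exists_adjoint S.act_dbar
  have h : ∃ T' : S.Forms →ₗ[ℂ] S.Forms, ∀ x y, ⟪S.dbar x, y⟫_ℂ = ⟪x, T' y⟫_ℂ := by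
    have h (x y : Ω) : S.form y (S.hermitian.dbar x) = S.form (Y y) x := by
      rw [← form_conj_symm, ← S.form_conj_symm x (Y y), ← hY]
    exact ⟨Y, h⟩
  have h2 : h.choose = preAdjoint S.dbar := (dif_pos h).symm
  have h1 : S.form ν (S.hermitian.dbar ω) = S.form (S.dbarAdj ν) ω :=
    (h.choose_spec ω ν).trans
      (congrArg (fun T : S.Forms →ₗ[ℂ] S.Forms => S.form (T ν) ω) h2)
  rw [← form_conj_symm, h1, form_conj_symm]

theorem form_dbarAdj (ω ν : Ω) : S.form (S.dbarAdj ω) ν = S.form ω (S.hermitian.dbar ν) := by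
  rw [← form_conj_symm, ← form_dbar, form_conj_symm]

theorem dbarAdj_parity (ω : Ω) :
    S.dbarAdj (S.hermitian.parity ω) = -S.hermitian.parity (S.dbarAdj ω) := by
  refine S.ext_form_right fun x => ?_
  rw [form_neg_right, ← form_parity, ← form_dbar, ← form_dbar, ← form_parity,
    S.hermitian.dbar_parity, form_neg_left, neg_neg]

theorem dbarAdj_antiProj (ω : Ω) :
    S.dbarAdj (S.hermitian.antiProj ω) = S.hermitian.antiProj (S.dbarAdj ω) := by
  refine S.ext_form_right fun x => ?_
  rw [← form_antiProj, ← form_dbar, ← form_dbar, ← form_antiProj, S.hermitian.dbar_antiProj]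

theorem form_act' (f : A →ₗ[ℂ] ℂ) (ω ν : Ω) :
    S.form ω (S.act f ν) = S.form (S.act (adjFunctional f) ω) ν := by
  rw [← form_conj_symm, form_act, form_conj_symm]

theorem act_dbarAdj (f : A →ₗ[ℂ] ℂ) (ω : Ω) :
    S.act f (S.dbarAdj ω) = S.dbarAdj (S.act f ω) := by
  refine S.ext_form_right fun x => ?_
  rw [form_act', ← form_dbar, ← form_dbar, form_act', act_dbar]

/-- The operator `∂̄ + ∂̄†`, as an operator on `Ω`. -/
def dolbeaultDirac : Ω →ₗ[ℂ] Ω := S.hermitian.dbar + S.dbarAdj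

theorem dolbeaultDirac_apply (ω : Ω) :
    S.dolbeaultDirac ω = S.hermitian.dbar ω + S.dbarAdj ω := rfl

theorem form_dolbeaultDirac (ω ν : Ω) :
    S.form (S.dolbeaultDirac ω) ν = S.form ω (S.dolbeaultDirac ν) := by
  rw [dolbeaultDirac_apply, dolbeaultDirac_apply, form_add_left, form_add_right, form_dbar,
    form_dbarAdj, add_comm]

theorem act_dolbeaultDirac (f : A →ₗ[ℂ] ℂ) (ω : Ω) :
    S.act f (S.dolbeaultDirac ω) = S.dolbeaultDirac (S.act f ω) := by
  rw [dolbeaultDirac_apply, map_add, act_dbar, act_dbarAdj, dolbeaultDirac_apply]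

theorem dolbeaultDirac_parity (ω : Ω) : S.dolbeaultDirac (S.hermitian.parity ω) =
    -S.hermitian.parity (S.dolbeaultDirac ω) := by
  rw [dolbeaultDirac_apply, dolbeaultDirac_apply, map_add, S.hermitian.dbar_parity,
    dbarAdj_parity, neg_add]

theorem dolbeaultDirac_antiProj (ω : Ω) : S.dolbeaultDirac (S.hermitian.antiProj ω) =
    S.hermitian.antiProj (S.dolbeaultDirac ω) := by
  rw [dolbeaultDirac_apply, dolbeaultDirac_apply, map_add, S.hermitian.dbar_antiProj,
    dbarAdj_antiProj]

/-- The operator `∂̄ + ∂̄†` is locally finite, since it commutes with operators of finite rank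
that fix any given form. -/
theorem exists_invariant_dolbeaultDirac (ω : Ω) : ∃ U : Submodule ℂ Ω,
    FiniteDimensional ℂ U ∧ ω ∈ U ∧ ∀ y ∈ U, S.dolbeaultDirac y ∈ U := by
  obtain ⟨x, hx, -⟩ := S.exists_act_haarMul_eq_and_adj ω
  refine ⟨_, S.finiteDimensional_range_act_haarMul x, ⟨ω, hx⟩, ?_⟩
  rintro _ ⟨y, rfl⟩
  exact ⟨_, S.act_dolbeaultDirac _ _⟩

/-- Right multiplication by a form is left linear over `B`, hence bounded. -/
theorem exists_formNorm_mul_le (ν : Ω) : ∃ C : ℝ, 0 ≤ C ∧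
    ∀ ω, S.formNorm (ω * ν) ≤ C * S.formNorm ω :=
  S.exists_formNorm_le (X := LinearMap.mulRight ℂ ν) fun b ω => by
    simp [mul_assoc]

/-- The commutator of `∂̄` with right multiplication by `b` is `ω ↦ γ(ω) ∂̄b`. -/
theorem exists_formNorm_dbar_commutator_le (b : S.B) : ∃ C : ℝ, 0 ≤ C ∧ ∀ ω,
    S.formNorm (S.hermitian.dbar (ω * S.calculus.incl b) -
      S.hermitian.dbar ω * S.calculus.incl b) ≤ C * S.formNorm ω := by
  obtain ⟨C, hC, h⟩ := S.exists_formNorm_mul_le (S.hermitian.dbar (S.calculus.incl b))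
  refine ⟨C, hC, fun ω => ?_⟩
  rw [S.hermitian.dbar_mul_incl, add_sub_cancel_left, ← S.formNorm_parity ω]
  exact h _

/-- The commutator of `∂̄†` with right multiplication by `b` is, up to sign, adjoint to the
commutator of `∂̄` with right multiplication by `b*`. -/
theorem exists_formNorm_dbarAdj_commutator_le (b : S.B) : ∃ C : ℝ, 0 ≤ C ∧ ∀ ω,
    S.formNorm (S.dbarAdj (ω * S.calculus.incl b) - S.dbarAdj ω * S.calculus.incl b) ≤
      C * S.formNorm ω := by
  obtain ⟨C, hC, h⟩ := S.exists_formNorm_dbar_commutator_le (star b)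
  refine ⟨C, hC, fun ω => ?_⟩
  set z := S.dbarAdj (ω * S.calculus.incl b) - S.dbarAdj ω * S.calculus.incl b with hz
  -- `z` is the value at `ω` of the adjoint of the negative commutator of `∂̄`.
  have h0 (x : Ω) : S.form x z = S.form (-(S.hermitian.dbar (x * S.calculus.incl (star b)) -
      S.hermitian.dbar x * S.calculus.incl (star b))) ω := by
    rw [hz, form_sub_right, ← form_dbar, neg_sub, form_sub_left, form_mul_incl, star_star,
      form_dbar (S := S) (x * _), form_mul_incl, star_star]
  have h1 := h0 z
  have h2 : S.formNorm z ^ 2 ≤ C * S.formNorm z * S.formNorm ω := by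
    calc S.formNorm z ^ 2 = (S.form z z).re := S.formNorm_sq z
      _ ≤ ‖S.form z z‖ := Complex.re_le_norm _
      _ ≤ _ := by
        rw [h1, form_neg_left, norm_neg]
        exact (S.norm_form_le _ _).trans
          (mul_le_mul_of_nonneg_right (h z) (S.formNorm_nonneg ω))
  rcases (S.formNorm_nonneg z).eq_or_lt with h0 | h0
  · rw [← h0]; exact mul_nonneg hC (S.formNorm_nonneg ω)
  · refine le_of_mul_le_mul_left (a := S.formNorm z) ?_ h0
    linarith

theorem exists_formNorm_dolbeaultDirac_commutator_le (b : S.B) : ∃ C : ℝ, ∀ ω,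
    S.formNorm (S.dolbeaultDirac (ω * S.calculus.incl b) -
      S.dolbeaultDirac ω * S.calculus.incl b) ≤ C * S.formNorm ω := by
  obtain ⟨C, -, hC⟩ := S.exists_formNorm_dbar_commutator_le b
  obtain ⟨D, -, hD⟩ := S.exists_formNorm_dbarAdj_commutator_le b
  refine ⟨C + D, fun ω => ?_⟩
  rw [dolbeaultDirac_apply, dolbeaultDirac_apply, add_mul, add_sub_add_comm, add_mul]
  exact (@norm_add_le S.Forms _ _ _).trans (add_le_add (hC ω) (hD ω))

/-! ### The spectral triple -/

/-- The inclusion of the anti-holomorphic forms in `Ω`. -/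
def toForm : S.Antiholomorphic →ₗ[ℂ] Ω := S.hermitian.antiholomorphic.subtype

theorem toForm_injective : Function.Injective S.toForm := Subtype.val_injective

theorem antiProj_toForm (x : S.Antiholomorphic) :
    S.hermitian.antiProj (S.toForm x) = S.toForm x := S.hermitian.antiProj_of_mem x.2

theorem toForm_diracAntiholomorphic (x : S.Antiholomorphic) :
    S.toForm (S.diracAntiholomorphic x) = S.dolbeaultDirac (S.toForm x) := by
  have h : S.toForm (S.diracAntiholomorphic x) =
      S.hermitian.antiProj (S.dolbeaultDirac (S.toForm x)) :=
    S.hermitian.coe_projAntiholomorphic _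
  rw [h, ← dolbeaultDirac_antiProj, antiProj_toForm]

theorem inner_antiholomorphic (x y : S.Antiholomorphic) :
    ⟪x, y⟫_ℂ = S.form (S.toForm y) (S.toForm x) := rfl

theorem norm_antiholomorphic (x : S.Antiholomorphic) : ‖x‖ = S.formNorm (S.toForm x) := rfl

theorem isSymmetric_diracAntiholomorphic : S.diracAntiholomorphic.IsSymmetric := by
  intro x y
  rw [inner_antiholomorphic, inner_antiholomorphic, toForm_diracAntiholomorphic,
    toForm_diracAntiholomorphic, form_dolbeaultDirac]

/-- The Dolbeault–Dirac operator preserves the ranges of the finite-rank operators given by the Haar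
functional. -/
theorem isLocallyFinite_diracAntiholomorphic : S.diracAntiholomorphic.IsLocallyFinite := by
  intro e
  obtain ⟨U, hU, he, hDU⟩ := S.exists_invariant_dolbeaultDirac (S.toForm e)
  refine ⟨U.comap S.toForm, ?_, he, fun y hy => ?_⟩
  · have : FiniteDimensional ℂ ((U.comap S.toForm).map S.toForm) :=
      Submodule.finiteDimensional_of_le (Submodule.map_comap_le _ _)
    exact ((U.comap S.toForm).equivMapOfInjective S.toForm
      S.toForm_injective).symm.finiteDimensional
  · rw [Submodule.mem_comap, toForm_diracAntiholomorphic]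
    exact hDU _ hy

/-- The action of `B^op` on the anti-holomorphic forms by right multiplication. -/
def rightMulHom : (S.B)ᵐᵒᵖ →ₐ[ℂ] Module.End ℂ S.Antiholomorphic :=
  AlgHom.ofLinearMap
    { toFun := fun b => S.rightMul b.unop
      map_add' := fun a b => LinearMap.ext fun ω => Subtype.ext (by
        change (_ : Ω) * S.calculus.incl (a.unop + b.unop) = _
        rw [map_add, mul_add]; rfl)
      map_smul' := fun r b => LinearMap.ext fun ω => Subtype.ext (by
        change (_ : Ω) * S.calculus.incl (r • b.unop) = _
        rw [map_smul, mul_smul_comm]; rfl) }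
    (LinearMap.ext fun ω => Subtype.ext (by
      change (_ : Ω) * S.calculus.incl 1 = _
      rw [map_one, mul_one]; rfl))
    (fun a b => LinearMap.ext fun ω => Subtype.ext (by
      change (_ : Ω) * S.calculus.incl (b.unop * a.unop) = _
      rw [map_mul, ← mul_assoc]; rfl))

theorem toForm_rightMulHom (b : (S.B)ᵐᵒᵖ) (ω : S.Antiholomorphic) :
    S.toForm (S.rightMulHom b ω) = S.toForm ω * S.calculus.incl b.unop := rfl

/-- The representation is faithful, because `b` is recovered from its action on the unit of `Ω`. -/
theorem rightMulHom_injective : Function.Injective S.rightMulHom := by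
  intro a b hab
  have h1 : (S.calculus.incl 1 : Ω) ∈ S.hermitian.antiholomorphic :=
    Submodule.mem_iSup_of_mem 0 (S.hermitian.incl_mem_bideg 1)
  have h2 : S.calculus.incl 1 * S.calculus.incl a.unop =
      S.calculus.incl 1 * S.calculus.incl b.unop :=
    congrArg S.toForm (LinearMap.congr_fun hab (⟨S.calculus.incl 1, h1⟩ : S.Antiholomorphic))
  rw [map_one, one_mul, one_mul] at h2
  exact MulOpposite.unop_injective (S.calculus.incl_injective h2)

/-- The grading on the anti-holomorphic forms. -/
def antiParity : S.Antiholomorphic →ₗ[ℂ] S.Antiholomorphic :=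
  LinearMap.restrict (p := S.hermitian.antiholomorphic) (q := S.hermitian.antiholomorphic)
    S.hermitian.parity fun ω hω => by
      rw [S.hermitian.mem_antiholomorphic_iff] at hω ⊢
      rw [← S.hermitian.parity_antiProj, hω]

theorem toForm_antiParity (ω : S.Antiholomorphic) :
    S.toForm (S.antiParity ω) = S.hermitian.parity (S.toForm ω) := rfl

theorem denseRange_toL2 : DenseRange S.toL2 :=
  UniformSpace.Completion.denseRange_coe

theorem isBounded_rightMulHom (b : (S.B)ᵐᵒᵖ) : LinearMap.IsBounded (S.rightMulHom b) := by
  obtain ⟨C, -, h⟩ := S.exists_formNorm_mul_le (S.calculus.incl b.unop)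
  exact ⟨C, fun x => h _⟩

theorem inner_rightMulHom (b : (S.B)ᵐᵒᵖ) (x y : S.Antiholomorphic) :
    ⟪S.rightMulHom b x, y⟫_ℂ = ⟪x, S.rightMulHom (star b) y⟫_ℂ := by
  rw [inner_antiholomorphic, inner_antiholomorphic, toForm_rightMulHom, toForm_rightMulHom,
    form_mul_incl, MulOpposite.unop_star, star_star]

theorem isBounded_commutator (b : (S.B)ᵐᵒᵖ) : LinearMap.IsBounded
    (S.diracAntiholomorphic ∘ₗ S.rightMulHom b - S.rightMulHom b ∘ₗ S.diracAntiholomorphic) := by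
  obtain ⟨C, h⟩ := S.exists_formNorm_dolbeaultDirac_commutator_le b.unop
  refine ⟨C, fun x => ?_⟩
  rw [norm_antiholomorphic, norm_antiholomorphic, LinearMap.sub_apply, map_sub,
    LinearMap.comp_apply, LinearMap.comp_apply, toForm_diracAntiholomorphic, toForm_rightMulHom,
    toForm_rightMulHom, toForm_diracAntiholomorphic]
  exact h _

end CQHHermitianSpace

end

/-- For a compact quantum homogeneous Hermitian space, right multiplication by `B` and the degree
grading extend (uniquely) to `L²(Ω^{(0,•)})`, and `(B^op, L²(Ω^{(0,•)}), D_∂̄, γ)` is an even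
spectral triple if and only if the eigenvalues of `D_∂̄` tend to infinity and have finite
multiplicity. -/
theorem mainTheorem6 {A H Ω : Type*}
    [Ring A] [HopfAlgebra ℂ A] [StarRing A] [StarModule ℂ A] [CQGA A]
    [Ring H] [HopfAlgebra ℂ H] [StarRing H] [StarModule ℂ H] [CQGA H]
    [Ring Ω] [Algebra ℂ Ω] (S : CQHHermitianSpace A H Ω) :
    ∃ (ρ : (S.B)ᵐᵒᵖ →⋆ₐ[ℂ] (S.L2 →L[ℂ] S.L2)) (γ : S.L2 →L[ℂ] S.L2),
      S.IsRightMultiplication ρ ∧ S.IsGradingOperator γ ∧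
        (IsEvenSpectralTriple ρ S.dirac γ ↔
          S.dirac.EigenvaluesTendToInfinity ∧ S.dirac.HasFiniteMultiplicities) := by
  have hγ : S.antiParity.IsBounded := ⟨1, fun x => by
    rw [one_mul, S.norm_antiholomorphic, S.norm_antiholomorphic, S.toForm_antiParity,
      S.formNorm_parity]⟩
  refine ⟨extendRep S.denseRange_toL2 S.rightMulHom S.isBounded_rightMulHom S.inner_rightMulHom,
    extendBounded S.toL2 S.antiParity, fun b ω => ?_, fun k ω hω => ?_, ?_⟩
  · exact extendRep_apply _ _ _ _ _ _
  · rw [extendBounded_apply S.denseRange_toL2 hγ, ← map_smul]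
    congr 1
    exact Subtype.ext (S.hermitian.parity_of_mem_deg hω)
  · refine isEvenSpectralTriple_extend_iff S.denseRange_toL2 S.isSymmetric_diracAntiholomorphic
      S.isLocallyFinite_diracAntiholomorphic S.rightMulHom S.isBounded_rightMulHom
      S.inner_rightMulHom S.rightMulHom_injective S.isBounded_commutator hγ (fun x y => ?_)
      (fun x => Subtype.ext (S.hermitian.parity_parity _))
      (fun b x => Subtype.ext (S.hermitian.parity_mul_incl _ _)) fun x => Subtype.ext ?_
    · rw [S.inner_antiholomorphic, S.inner_antiholomorphic, S.toForm_antiParity,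
        S.toForm_antiParity, S.form_parity]
    · change S.toForm (S.diracAntiholomorphic (S.antiParity x)) =
        S.toForm (-S.antiParity (S.diracAntiholomorphic x))
      rw [map_neg, S.toForm_diracAntiholomorphic, S.toForm_antiParity, S.toForm_antiParity,
        S.toForm_diracAntiholomorphic, S.dolbeaultDirac_parity]
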